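/- Let $\mathbb F$ be a field, let $S_1,\dots,S_m\subseteq\mathbb F$ be finite non-empty sets and $S=S_1\times\cdots\times S_m$. A downset is a set $\mathcal D$ of monomials $X^\alpha=X_1^{\alpha_1}\cdots X_m^{\alpha_m}$ with $\alpha_i<|S_i|$ for all $i$, closed under taking factors. The downset code $\mathcal C(S,\mathcal D)$ is the set of all functions $S\to\mathbb F$ that can be represented by a linear combination of monomials from $\mathcal D$, and $\mu(S,\mathcal D)$ is its minimum Hamming distance (with the convention $\mu(S,\emptyset)=0$). For a weighted word $w=(f,u)$, where $f:S\to\mathbb F$ and $u:S\to[0,1]$, and for $g:S\to\mathbb F$ put $$\Delta(w,g)=\sum_{x:\,f(x)=g(x)}\frac{u(x)}2+\sum_{x:\,f(x)\ne g(x)}\Bigl(1-\frac{u(x)}2\Bigr).$$ Theorem. There is a deterministic polynomial-time algorithm which, given $S$, $\mathcal D$ and a weighted word $w:S\to\mathbb F\times[0,1]$, outputs the coefficients of a polynomial that is a linear combination of monomials from $\mathcal D$; whenever there is a codeword $C\in\mathcal C(S,\mathcal D)$ with $\Delta(w,C)<\mu(S,\mathcal D)/2$, the output polynomial represents this (necessarily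 unique) $C$ on $S$. In particular, run on $(f,0)$ for an unweighted word $f:S\to\mathbb F$, the algorithm finds the codeword at Hamming distance less than $\mu(S,\mathcal D)/2$ from $f$ whenever there is one. Here an algorithm is one fixed finite program, the same for all $\mathbb F,m,S,\mathcal D,w$, in an imperative language with arrays, loops and recursive procedures. At unit cost per operation, memory access, test and assignment, it can add, subtract, multiply, invert and compare for equality elements of $\mathbb F$; add, subtract, compare real weights and divide them by natural numbers; and add, subtract, compare natural numbers. The input consists of $m$, $|\mathcal D|$, the sizes $|S_i|$, lists (in any order, without repetitions) of the elements of each $S_i$ and of the exponent vectors of $\mathcal D$, and the tables of $f$ and $u$. Polynomial time means that the program halts on every such input, whether or not a codeword $C$ as above exists, after at most $p(N)$ steps, where $p$ is a fixed polynomial and $N=2+m+m|\mathcal D|+\sum_i|S_i|+2|S|$ is the number of memory cells that the input occupies. -/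

import Mathlib

universe u

/-! ### The machine model

An imperative language over three sorts of data: natural numbers (used for indices and control),
elements of a field `F`, and real weights.  Each sort has arrays, named by a fixed natural number and
indexed by two natural numbers computed at run time.  A program is a finite piece of text which
mentions neither the field nor any particular input.  Every operation, memory access, test and
assignment costs one unit.

Natural numbers can only be added, (truncatedly) subtracted and compared.  Field elements can be
added, subtracted, multiplied, inverted and tested for equality.  Weights can be added, subtracted,
divided by a natural number and compared; they are never multiplied with one another. -/

namespace DownsetDecoding

/-- Expressions whose value is a natural number. -/
inductive NExp where
  /-- a constant of the program -/
  | lit (n : ℕ)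
  /-- the entry `a[i, j]` of the array of natural numbers with name `a` -/
  | get (a : ℕ) (i j : NExp)
  | add (x y : NExp)
  | sub (x y : NExp)

/-- Expressions whose value is a field element. -/
inductive FExp where
  | zero
  | one
  | get (a : ℕ) (i j : NExp)
  | add (x y : FExp)
  | sub (x y : FExp)
  | mul (x y : FExp)
  | inv (x : FExp)

/-- Expressions whose value is a real weight. -/
inductive WExp where
  | ofNat (n : NExp)
  | get (a : ℕ) (i j : NExp)
  | add (x y : WExp)
  | sub (x y : WExp)
  | divNat (x : WExp) (n : NExp)

/-- Tests. -/
inductive BExp where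
  | natEq (x y : NExp)
  | natLt (x y : NExp)
  | fieldEq (x y : FExp)
  | weightLt (x y : WExp)
  | not (b : BExp)
  | and (b c : BExp)

/-- Commands. -/
inductive Com where
  | skip
  /-- `a[i, j] := e` for natural numbers, and likewise for the two other sorts -/
  | setN (a : ℕ) (i j : NExp) (e : NExp)
  | setF (a : ℕ) (i j : NExp) (e : FExp)
  | setW (a : ℕ) (i j : NExp) (e : WExp)
  | seq (c d : Com)
  | cond (b : BExp) (c d : Com)
  /-- while `b` holds, do `c` -/
  | loop (b : BExp) (c : Com)
  /-- call the parameterless, possibly recursive, procedure number `p` -/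
  | call (p : ℕ)

/-- A program: its main command and its finite list of procedures. -/
structure Program where
  main : Com
  procs : List Com

/-- The contents of the memory. -/
@[ext]
structure State (F : Type u) where
  nat : ℕ → ℕ → ℕ → ℕ
  fld : ℕ → ℕ → ℕ → F
  wgt : ℕ → ℕ → ℕ → ℝ

/-- Overwrite the entry `[i, j]` of the array `a`. -/
def write {X : Type*} (M : ℕ → ℕ → ℕ → X) (a i j : ℕ) (v : X) : ℕ → ℕ → ℕ → X :=
  fun a' i' j' => if a' = a ∧ i' = i ∧ j' = j then v else M a' i' j'

/-- Value of an expression. -/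
def NExp.eval {F : Type u} (σ : State F) : NExp → ℕ
  | .lit n => n
  | .get a i j => σ.nat a (i.eval σ) (j.eval σ)
  | .add x y => x.eval σ + y.eval σ
  | .sub x y => x.eval σ - y.eval σ

/-- Number of operations and memory accesses in an expression. -/
def NExp.cost : NExp → ℕ
  | .lit _ => 1
  | .get _ i j => 1 + i.cost + j.cost
  | .add x y => 1 + x.cost + y.cost
  | .sub x y => 1 + x.cost + y.cost

/-- Value of an expression. -/
def FExp.eval {F : Type u} [Field F] (σ : State F) : FExp → F
  | .zero => 0
  | .one => 1
  | .get a i j => σ.fld a (i.eval σ) (j.eval σ)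
  | .add x y => x.eval σ + y.eval σ
  | .sub x y => x.eval σ - y.eval σ
  | .mul x y => x.eval σ * y.eval σ
  | .inv x => (x.eval σ)⁻¹

/-- Number of operations and memory accesses in an expression. -/
def FExp.cost : FExp → ℕ
  | .zero => 1
  | .one => 1
  | .get _ i j => 1 + i.cost + j.cost
  | .add x y => 1 + x.cost + y.cost
  | .sub x y => 1 + x.cost + y.cost
  | .mul x y => 1 + x.cost + y.cost
  | .inv x => 1 + x.cost

/-- Value of an expression. -/
noncomputable def WExp.eval {F : Type u} (σ : State F) : WExp → ℝ
  | .ofNat n => (n.eval σ : ℝ)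
  | .get a i j => σ.wgt a (i.eval σ) (j.eval σ)
  | .add x y => x.eval σ + y.eval σ
  | .sub x y => x.eval σ - y.eval σ
  | .divNat x n => x.eval σ / (n.eval σ : ℝ)

/-- Number of operations and memory accesses in an expression. -/
def WExp.cost : WExp → ℕ
  | .ofNat n => 1 + n.cost
  | .get _ i j => 1 + i.cost + j.cost
  | .add x y => 1 + x.cost + y.cost
  | .sub x y => 1 + x.cost + y.cost
  | .divNat x n => 1 + x.cost + n.cost

/-- Truth of a test. -/
def BExp.Holds {F : Type u} [Field F] (σ : State F) : BExp → Prop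
  | .natEq x y => x.eval σ = y.eval σ
  | .natLt x y => x.eval σ < y.eval σ
  | .fieldEq x y => x.eval σ = y.eval σ
  | .weightLt x y => x.eval σ < y.eval σ
  | .not b => ¬ b.Holds σ
  | .and b c => b.Holds σ ∧ c.Holds σ

/-- Number of operations and memory accesses in a test. -/
def BExp.cost : BExp → ℕ
  | .natEq x y => 1 + x.cost + y.cost
  | .natLt x y => 1 + x.cost + y.cost
  | .fieldEq x y => 1 + x.cost + y.cost
  | .weightLt x y => 1 + x.cost + y.cost
  | .not b => 1 + b.cost
  | .and b c => 1 + b.cost + c.cost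

/-- `Exec procs c σ σ' t`: the command `c`, started in the memory `σ`, halts with the memory `σ'`
after exactly `t` steps. -/
inductive Exec {F : Type u} [Field F] (procs : List Com) :
    Com → State F → State F → ℕ → Prop where
  | skip (σ : State F) : Exec procs .skip σ σ 1
  | setN (a : ℕ) (i j e : NExp) (σ : State F) :
      Exec procs (.setN a i j e) σ
        { σ with nat := write σ.nat a (i.eval σ) (j.eval σ) (e.eval σ) }
        (1 + i.cost + j.cost + e.cost)
  | setF (a : ℕ) (i j : NExp) (e : FExp) (σ : State F) :
      Exec procs (.setF a i j e) σ
        { σ with fld := write σ.fld a (i.eval σ) (j.eval σ) (e.eval σ) }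
        (1 + i.cost + j.cost + e.cost)
  | setW (a : ℕ) (i j : NExp) (e : WExp) (σ : State F) :
      Exec procs (.setW a i j e) σ
        { σ with wgt := write σ.wgt a (i.eval σ) (j.eval σ) (e.eval σ) }
        (1 + i.cost + j.cost + e.cost)
  | seq {c d : Com} {σ σ' σ'' : State F} {t t' : ℕ} :
      Exec procs c σ σ' t → Exec procs d σ' σ'' t' → Exec procs (.seq c d) σ σ'' (t + t')
  | condTrue {b : BExp} {c d : Com} {σ σ' : State F} {t : ℕ} :
      b.Holds σ → Exec procs c σ σ' t → Exec procs (.cond b c d) σ σ' (1 + b.cost + t)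
  | condFalse {b : BExp} {c d : Com} {σ σ' : State F} {t : ℕ} :
      ¬ b.Holds σ → Exec procs d σ σ' t → Exec procs (.cond b c d) σ σ' (1 + b.cost + t)
  | loopDone {b : BExp} {c : Com} {σ : State F} :
      ¬ b.Holds σ → Exec procs (.loop b c) σ σ (1 + b.cost)
  | loopStep {b : BExp} {c : Com} {σ σ' σ'' : State F} {t t' : ℕ} :
      b.Holds σ → Exec procs c σ σ' t → Exec procs (.loop b c) σ' σ'' t' →
      Exec procs (.loop b c) σ σ'' (1 + b.cost + t + t')
  | call {p : ℕ} {σ σ' : State F} {t : ℕ} :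
      Exec procs (procs.getD p .skip) σ σ' t → Exec procs (.call p) σ σ' (1 + t)

/-- The model is deterministic. -/
theorem Exec.deterministic {F : Type u} [Field F] {procs : List Com} {c : Com}
    {σ σ₁ σ₂ : State F} {t₁ t₂ : ℕ} (h₁ : Exec procs c σ σ₁ t₁) (h₂ : Exec procs c σ σ₂ t₂) :
    σ₁ = σ₂ ∧ t₁ = t₂ := by
  induction h₁ generalizing σ₂ t₂ with
  | skip => cases h₂; exact ⟨rfl, rfl⟩
  | setN => cases h₂; exact ⟨rfl, rfl⟩
  | setF => cases h₂; exact ⟨rfl, rfl⟩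
  | setW => cases h₂; exact ⟨rfl, rfl⟩
  | seq _ _ ih₁ ih₂ =>
    cases h₂ with
    | seq k₁ k₂ =>
      obtain ⟨rfl, rfl⟩ := ih₁ k₁
      obtain ⟨rfl, rfl⟩ := ih₂ k₂
      exact ⟨rfl, rfl⟩
  | condTrue hb _ ih =>
    cases h₂ with
    | condTrue _ k => obtain ⟨rfl, rfl⟩ := ih k; exact ⟨rfl, rfl⟩
    | condFalse hb' _ => exact absurd hb hb'
  | condFalse hb _ ih =>
    cases h₂ with
    | condTrue hb' _ => exact absurd hb' hb
    | condFalse _ k => obtain ⟨rfl, rfl⟩ := ih k; exact ⟨rfl, rfl⟩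
  | loopDone hb =>
    cases h₂ with
    | loopDone _ => exact ⟨rfl, rfl⟩
    | loopStep hb' _ _ => exact absurd hb' hb
  | loopStep hb _ _ ih₁ ih₂ =>
    cases h₂ with
    | loopDone hb' => exact absurd hb hb'
    | loopStep _ k₁ k₂ =>
      obtain ⟨rfl, rfl⟩ := ih₁ k₁
      obtain ⟨rfl, rfl⟩ := ih₂ k₂
      exact ⟨rfl, rfl⟩
  | call _ ih =>
    cases h₂ with
    | call k => obtain ⟨rfl, rfl⟩ := ih k; exact ⟨rfl, rfl⟩

/-- The program halts on the initial memory `σ` with the final memory `σ'` after `t` steps. -/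
def Program.Run {F : Type u} [Field F] (P : Program) (σ σ' : State F) (t : ℕ) : Prop :=
  Exec P.procs P.main σ σ' t

/-! ### Grids and downset codes -/

/-- The grid `S₁ × ⋯ × Sₘ`. -/
abbrev Grid {F : Type u} {m : ℕ} (S : Fin m → Finset F) : Type u := (i : Fin m) → S i

/-- A weighted function on the grid. -/
abbrev WeightedWord {F : Type u} {m : ℕ} (S : Fin m → Finset F) : Type u :=
  Grid S → F × Set.Icc (0 : ℝ) 1

/-- A downset for the grid: a set of monomials, closed under taking factors, in which the `i`-th
variable always has exponent less than `|Sᵢ|`. -/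
def IsDownset {F : Type u} {m : ℕ} (S : Fin m → Finset F) (D : Finset (Fin m →₀ ℕ)) : Prop :=
  IsLowerSet (D : Set (Fin m →₀ ℕ)) ∧ ∀ α ∈ D, ∀ i, α i < (S i).card

/-- The downset code: the functions on the grid that are represented by a linear combination of
monomials from `D`. -/
def downsetCode {F : Type u} [Field F] {m : ℕ} (S : Fin m → Finset F)
    (D : Finset (Fin m →₀ ℕ)) : Set (Grid S → F) :=
  {f | ∃ P : MvPolynomial (Fin m) F, P.support ⊆ D ∧
    ∀ x : Grid S, f x = MvPolynomial.eval (fun i => (x i : F)) P}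

/-- The minimum distance of the downset code (`0` by convention if `D = ∅`, when the code has only
one codeword). -/
noncomputable def minDist {F : Type u} [Field F] [DecidableEq F] {m : ℕ} (S : Fin m → Finset F)
    (D : Finset (Fin m →₀ ℕ)) : ℕ :=
  sInf {δ | ∃ f ∈ downsetCode S D, ∃ g ∈ downsetCode S D, f ≠ g ∧ hammingDist f g = δ}

/-- The distance between a weighted function and a function. -/
noncomputable def weightedDist {F : Type u} [DecidableEq F] {m : ℕ} {S : Fin m → Finset F}
    (w : WeightedWord S) (g : Grid S → F) : ℝ :=
  ∑ x, if (w x).1 = g x then ((w x).2 : ℝ) / 2 else 1 - ((w x).2 : ℝ) / 2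

/-! ### Input and output

The sets `Sᵢ` and `D` are given as lists of their elements, in an arbitrary order and without
repetition: `e i` lists `Sᵢ` and `d` lists `D`. -/

/-- The `t`-th point of the grid, the points being ordered lexicographically with the first
coordinate varying fastest. -/
def gridPoint {F : Type u} {m : ℕ} {S : Fin m → Finset F}
    (e : (i : Fin m) → Fin (S i).card ≃ S i) (t : Fin (∏ i, (S i).card)) : Grid S :=
  fun i => e i (finPiFinEquiv.symm t i)

/-- The memory that holds the input `(S, D, w)` and zeros everywhere else:
* natural numbers: `0[0, 0] = m`, `0[0, 1] = |D|`, `1[0, i] = |Sᵢ|`, and `2[j, i]` is the exponent of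
  the `i`-th variable in the `j`-th monomial of `D`;
* field elements: `0[i, t]` is the `t`-th element of `Sᵢ`, and `1[0, t]` is the received symbol at
  the `t`-th point of the grid;
* weights: `0[0, t]` is the weight at the `t`-th point of the grid. -/
noncomputable def inputState {F : Type u} [Field F] {m : ℕ} (S : Fin m → Finset F)
    (D : Finset (Fin m →₀ ℕ)) (e : (i : Fin m) → Fin (S i).card ≃ S i) (d : Fin D.card ≃ D)
    (w : WeightedWord S) : State F where
  nat a i j :=
    match a with
    | 0 => if i = 0 ∧ j = 0 then m else if i = 0 ∧ j = 1 then D.card else 0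
    | 1 => if i = 0 then (if h : j < m then (S ⟨j, h⟩).card else 0) else 0
    | 2 => if hi : i < D.card then
        (if hj : j < m then (d ⟨i, hi⟩ : Fin m →₀ ℕ) ⟨j, hj⟩ else 0) else 0
    | _ => 0
  fld a i t :=
    match a with
    | 0 => if hi : i < m then
        (if ht : t < (S ⟨i, hi⟩).card then (e ⟨i, hi⟩ ⟨t, ht⟩ : F) else 0) else 0
    | 1 => if i = 0 then
        (if ht : t < ∏ i, (S i).card then (w (gridPoint e ⟨t, ht⟩)).1 else 0) else 0
    | _ => 0
  wgt a i t :=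
    match a with
    | 0 => if i = 0 then
        (if ht : t < ∏ i, (S i).card then ((w (gridPoint e ⟨t, ht⟩)).2 : ℝ) else 0) else 0
    | _ => 0

/-- The size of the input: the number of memory cells that it occupies. -/
def inputSize {F : Type u} {m : ℕ} (S : Fin m → Finset F) (D : Finset (Fin m →₀ ℕ)) : ℕ :=
  2 + m + m * D.card + ∑ i, (S i).card + 2 * ∏ i, (S i).card

/-- The output polynomial: the coefficient of the `j`-th monomial of `D` is read from the entry
`[0, j]` of the array of field elements with name `2`. -/
noncomputable def outputPoly {F : Type u} [Field F] {m : ℕ} {D : Finset (Fin m →₀ ℕ)}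
    (d : Fin D.card ≃ D) (σ : State F) : MvPolynomial (Fin m) F :=
  ∑ j : Fin D.card, MvPolynomial.monomial (d j : Fin m →₀ ℕ) (σ.fld 2 0 j)

/-- The output codeword: the function on the grid that the output polynomial represents. -/
noncomputable def outputWord {F : Type u} [Field F] {m : ℕ} (S : Fin m → Finset F)
    {D : Finset (Fin m →₀ ℕ)} (d : Fin D.card ≃ D) (σ : State F) : Grid S → F :=
  fun x => MvPolynomial.eval (fun i => (x i : F)) (outputPoly d σ)

end DownsetDecoding

/-! Every coefficient of the codeword is found as a leading coefficient. Order the monomials by the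
mixed radix number whose digits are the exponents, the last variable being the most significant, and
let `X^α` be the largest monomial that can still occur. On a strip (all coordinates but the last
fixed) the codeword is a polynomial of degree at most `j = α_k` in the last variable `X_k`, and its
coefficient of `X_k^j` is the value, at the fixed coordinates, of a polynomial in one variable
fewer.

Each strip, of length `n`, is decoded as a weighted Reed–Solomon word. If some `q` of degree at most
`j` has `2Δ(q) < n - j`, the answer is its coefficient of `X^j` with weight `2Δ(q)/(n - j)`;
otherwise it is `0` with weight `1`, an erasure. By the triangle inequality this answer lies within
`Δ(p)/(n - j)` of the coefficient of every `p` of degree at most `j` (`IsStripDecoding`). Summing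
over the strips, the new word is closer to the word of leading coefficients by the factor `n - j`.
Hence a distance below `∏ (n_i - α_i) / 2` becomes, after all coordinates, a distance below `1/2`
for a single symbol, and a wrong symbol costs at least `1/2`.

That much distance is available for each `α ∈ D`: a product of `α_i` linear factors in each variable
uses only factors of `X^α` and is nonzero at exactly `∏ (|S_i| - α_i)` points, so the minimum
distance is at most this product (`minDist_le_prod`). The converse bound is not needed. A known term
is subtracted from the received word and from the codeword, which preserves their distance, and the
next smaller monomial becomes the leading one.

A strip is decoded by generalized minimum distance decoding. Averaging over thresholds shows that
erasing the symbols whose weight exceeds one of the given weights leaves more than `2 · errors + j`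
symbols (`exists_threshold`). A Welch–Berlekamp step then maintains two pairs `(E, Q)` with `Q = f
E` at the kept points and of small weighted degree; one of them ends as a multiple of `(1, p)`, its
`E` vanishes at all errors (`LocatorInvariant.locates`), and Newton interpolation through `j + 1`
points with `E ≠ 0` recovers `p`. Every threshold is tried and every candidate is checked against
the bound `2Δ < n - j`, so unsuccessful thresholds do no harm.

The program consists of nested counting loops whose bounds do not exceed the input size. It
therefore halts in polynomial time on every input, decodable or not. -/

namespace DownsetDecoding

/-! ### Structured programs -/

/-- Programs whose only loops are counting loops: `loop v b c` runs `c` with the variable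
`v[0, 0]` equal to `0, 1, …, b - 1`. -/
inductive Block where
  | skip
  | setN (a : ℕ) (i j : NExp) (e : NExp)
  | setF (a : ℕ) (i j : NExp) (e : FExp)
  | setW (a : ℕ) (i j : NExp) (e : WExp)
  | seq (c d : Block)
  | cond (b : BExp) (c d : Block)
  | loop (v : ℕ) (b : NExp) (c : Block)

/-- The variable stored in the entry `[0, 0]` of the array `v`. -/
abbrev NExp.var (v : ℕ) : NExp := .get v (.lit 0) (.lit 0)

/-- The arrays of natural numbers read by an expression. -/
def NExp.reads : NExp → List ℕ
  | .lit _ => []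
  | .get a i j => a :: (i.reads ++ j.reads)
  | .add x y => x.reads ++ y.reads
  | .sub x y => x.reads ++ y.reads

theorem NExp.eval_congr {F : Type u} {σ τ : State F} (x : NExp)
    (h : ∀ a ∈ x.reads, τ.nat a = σ.nat a) : x.eval τ = x.eval σ := by
  induction x with
  | lit n => rfl
  | get a i j hi hj =>
    simp only [NExp.reads, List.mem_cons, List.mem_append] at h
    simp only [NExp.eval]
    rw [hi fun b hb => h b (by tauto), hj fun b hb => h b (by tauto), h a (by tauto)]
  | add x y hx hy =>
    simp only [NExp.reads, List.mem_append] at h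
    simp only [NExp.eval]
    rw [hx fun b hb => h b (by tauto), hy fun b hb => h b (by tauto)]
  | sub x y hx hy =>
    simp only [NExp.reads, List.mem_append] at h
    simp only [NExp.eval]
    rw [hx fun b hb => h b (by tauto), hy fun b hb => h b (by tauto)]

/-- Set the variable `v` to `k`. -/
def State.setVar {F : Type u} (σ : State F) (v k : ℕ) : State F :=
  { σ with nat := write σ.nat v 0 0 k }

@[simp] theorem State.setVar_nat {F : Type u} (σ : State F) (v k : ℕ) :
    (σ.setVar v k).nat = write σ.nat v 0 0 k := rfl

@[simp] theorem State.setVar_fld {F : Type u} (σ : State F) (v k : ℕ) :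
    (σ.setVar v k).fld = σ.fld := rfl

@[simp] theorem State.setVar_wgt {F : Type u} (σ : State F) (v k : ℕ) :
    (σ.setVar v k).wgt = σ.wgt := rfl

/-- The memory after `i` passes of a counting loop with body `f`. -/
def iterate {F : Type u} (v : ℕ) (f : State F → State F) (σ : State F) : ℕ → State F
  | 0 => σ.setVar v 0
  | i + 1 => (f (iterate v f σ i)).setVar v (i + 1)

namespace Block

/-- Translation into commands. -/
def toCom : Block → Com
  | .skip => .skip
  | .setN a i j e => .setN a i j e
  | .setF a i j e => .setF a i j e
  | .setW a i j e => .setW a i j e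
  | .seq c d => .seq c.toCom d.toCom
  | .cond b c d => .cond b c.toCom d.toCom
  | .loop v b c => .seq (.setN v (.lit 0) (.lit 0) (.lit 0))
      (.loop (.natLt (.var v) b)
        (.seq c.toCom (.setN v (.lit 0) (.lit 0) (.add (.var v) (.lit 1)))))

open Classical in
/-- The memory after a structured program. -/
noncomputable def run {F : Type u} [Field F] : Block → State F → State F
  | .skip, σ => σ
  | .setN a i j e, σ => { σ with nat := write σ.nat a (i.eval σ) (j.eval σ) (e.eval σ) }
  | .setF a i j e, σ => { σ with fld := write σ.fld a (i.eval σ) (j.eval σ) (e.eval σ) }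
  | .setW a i j e, σ => { σ with wgt := write σ.wgt a (i.eval σ) (j.eval σ) (e.eval σ) }
  | .seq c d, σ => d.run (c.run σ)
  | .cond b c d, σ => if b.Holds σ then c.run σ else d.run σ
  | .loop v b c, σ => iterate v c.run σ (b.eval σ)

section

variable {F : Type u} [Field F] (σ : State F)

@[simp] theorem run_skip : skip.run σ = σ := rfl

@[simp] theorem run_setN (a : ℕ) (i j e : NExp) : (setN a i j e).run σ =
    { σ with nat := write σ.nat a (i.eval σ) (j.eval σ) (e.eval σ) } := rfl

@[simp] theorem run_setF (a : ℕ) (i j : NExp) (e : FExp) : (setF a i j e).run σ =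
    { σ with fld := write σ.fld a (i.eval σ) (j.eval σ) (e.eval σ) } := rfl

@[simp] theorem run_setW (a : ℕ) (i j : NExp) (e : WExp) : (setW a i j e).run σ =
    { σ with wgt := write σ.wgt a (i.eval σ) (j.eval σ) (e.eval σ) } := rfl

@[simp] theorem run_seq (c d : Block) : (seq c d).run σ = d.run (c.run σ) := rfl

variable {σ}

theorem run_cond_pos {b : BExp} {c d : Block} (h : b.Holds σ) : (cond b c d).run σ = c.run σ :=
  if_pos h

theorem run_cond_neg {b : BExp} {c d : Block} (h : ¬ b.Holds σ) : (cond b c d).run σ = d.run σ :=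
  if_neg h

end

/-! ### Frames: what a program leaves unchanged -/

/-- The arrays of natural numbers written by a program. -/
def wN : Block → List ℕ
  | .setN a _ _ _ => [a]
  | .seq c d => c.wN ++ d.wN
  | .cond _ c d => c.wN ++ d.wN
  | .loop v _ c => v :: c.wN
  | _ => []

/-- The arrays of field elements written by a program. -/
def wF : Block → List ℕ
  | .setF a _ _ _ => [a]
  | .seq c d => c.wF ++ d.wF
  | .cond _ c d => c.wF ++ d.wF
  | .loop _ _ c => c.wF
  | _ => []

/-- The arrays of weights written by a program. -/
def wW : Block → List ℕ
  | .setW a _ _ _ => [a]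
  | .seq c d => c.wW ++ d.wW
  | .cond _ c d => c.wW ++ d.wW
  | .loop _ _ c => c.wW
  | _ => []

/-- Two memories agree outside the arrays written by `c`. -/
structure Frame {F : Type u} (c : Block) (σ τ : State F) : Prop where
  nat : ∀ a, a ∉ c.wN → τ.nat a = σ.nat a
  fld : ∀ a, a ∉ c.wF → τ.fld a = σ.fld a
  wgt : ∀ a, a ∉ c.wW → τ.wgt a = σ.wgt a

theorem write_ne {X : Type*} (M : ℕ → ℕ → ℕ → X) {a b : ℕ} (i j : ℕ) (v : X) (h : b ≠ a) :
    write M a i j v b = M b := by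
  funext i' j'
  simp [write, h]

theorem frame_iterate {F : Type u} [Field F] {v : ℕ} {b : NExp} {c : Block}
    (hc : ∀ σ : State F, c.Frame σ (c.run σ)) (σ : State F) (k : ℕ) :
    (loop v b c).Frame σ (iterate v c.run σ k) := by
  induction k with
  | zero =>
    refine ⟨fun a ha => ?_, fun _ _ => rfl, fun _ _ => rfl⟩
    simp only [wN, List.mem_cons, not_or] at ha
    simp [iterate, write_ne _ _ _ _ ha.1]
  | succ k ih =>
    have h := hc (iterate v c.run σ k)
    refine ⟨fun a ha => ?_, fun a ha => (h.fld a ha).trans (ih.fld a ha),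
      fun a ha => (h.wgt a ha).trans (ih.wgt a ha)⟩
    have ha' := ha
    simp only [wN, List.mem_cons, not_or] at ha
    simp only [iterate, State.setVar_nat, write_ne _ _ _ _ ha.1]
    exact (h.nat a ha.2).trans (ih.nat a ha')

/-- For a concrete program the written arrays form an explicit list of numerals, so that a cell is
unchanged is later settled by `decide`. -/
theorem frame_run {F : Type u} [Field F] (c : Block) (σ : State F) : c.Frame σ (c.run σ) := by
  induction c generalizing σ with
  | skip => exact ⟨fun _ _ => rfl, fun _ _ => rfl, fun _ _ => rfl⟩
  | setN a i j e =>
    refine ⟨fun b hb => ?_, fun _ _ => rfl, fun _ _ => rfl⟩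
    simp only [wN, List.mem_singleton] at hb
    simp [run, write_ne _ _ _ _ hb]
  | setF a i j e =>
    refine ⟨fun _ _ => rfl, fun b hb => ?_, fun _ _ => rfl⟩
    simp only [wF, List.mem_singleton] at hb
    simp [run, write_ne _ _ _ _ hb]
  | setW a i j e =>
    refine ⟨fun _ _ => rfl, fun _ _ => rfl, fun b hb => ?_⟩
    simp only [wW, List.mem_singleton] at hb
    simp [run, write_ne _ _ _ _ hb]
  | seq c d hc hd =>
    refine ⟨fun a ha => ?_, fun a ha => ?_, fun a ha => ?_⟩
    · simp only [wN, List.mem_append, not_or] at ha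
      exact ((hd _).nat a ha.2).trans ((hc _).nat a ha.1)
    · simp only [wF, List.mem_append, not_or] at ha
      exact ((hd _).fld a ha.2).trans ((hc _).fld a ha.1)
    · simp only [wW, List.mem_append, not_or] at ha
      exact ((hd _).wgt a ha.2).trans ((hc _).wgt a ha.1)
  | cond b c d hc hd =>
    refine ⟨fun a ha => ?_, fun a ha => ?_, fun a ha => ?_⟩
    · simp only [wN, List.mem_append, not_or] at ha
      simp only [run]
      split_ifs
      exacts [(hc _).nat a ha.1, (hd _).nat a ha.2]
    · simp only [wF, List.mem_append, not_or] at ha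
      simp only [run]
      split_ifs
      exacts [(hc _).fld a ha.1, (hd _).fld a ha.2]
    · simp only [wW, List.mem_append, not_or] at ha
      simp only [run]
      split_ifs
      exacts [(hc _).wgt a ha.1, (hd _).wgt a ha.2]
  | loop v b c hc => exact frame_iterate hc σ _

/-- Loop variables and loop bounds are not changed inside the loops. -/
def wf : Block → Bool
  | .seq c d => c.wf && d.wf
  | .cond _ c d => c.wf && d.wf
  | .loop v b c => c.wf && !(c.wN.contains v) && b.reads.all fun a => !((v :: c.wN).contains a)
  | _ => true

theorem iterate_var {F : Type u} (v : ℕ) (f : State F → State F) (σ : State F) (k : ℕ) :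
    (iterate v f σ k).nat v 0 0 = k := by
  cases k <;> simp [iterate, write]

/-- The invariant rule for counting loops. -/
theorem iterate_induction {F : Type u} [Field F] {v : ℕ} {b : NExp} {c : Block} {σ : State F}
    (I : ℕ → State F → Prop) (h0 : I 0 (σ.setVar v 0))
    (hs : ∀ i τ, i < b.eval σ → (loop v b c).Frame σ τ → τ.nat v 0 0 = i → I i τ →
      I (i + 1) ((c.run τ).setVar v (i + 1))) (k : ℕ) (hk : k ≤ b.eval σ) :
    I k (iterate v c.run σ k) := by
  induction k with
  | zero => exact h0
  | succ k ih =>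
    exact hs k _ (by omega) (frame_iterate (frame_run c) σ k) (iterate_var ..) (ih (by omega))

theorem loop_induction {F : Type u} [Field F] {v : ℕ} {b : NExp} {c : Block} {σ : State F}
    (I : ℕ → State F → Prop) (h0 : I 0 (σ.setVar v 0))
    (hs : ∀ i τ, i < b.eval σ → (loop v b c).Frame σ τ → τ.nat v 0 0 = i → I i τ →
      I (i + 1) ((c.run τ).setVar v (i + 1))) :
    I (b.eval σ) ((loop v b c).run σ) :=
  iterate_induction I h0 hs _ le_rfl

/-! ### Running time -/

/-- All loops met during the run have at most `M` passes. -/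
def Bounded {F : Type u} [Field F] (M : ℕ) : Block → State F → Prop
  | .seq c d, σ => c.Bounded M σ ∧ d.Bounded M (c.run σ)
  | .cond b c d, σ => (b.Holds σ → c.Bounded M σ) ∧ (¬ b.Holds σ → d.Bounded M σ)
  | .loop v b c, σ => b.eval σ ≤ M ∧ ∀ i < b.eval σ, c.Bounded M (iterate v c.run σ i)
  | _, _ => True

/-- A bound for the running time when all loops have at most `X` passes. -/
noncomputable def time : Block → Polynomial ℕ
  | .skip => 1
  | .setN _ i j e => .C (1 + i.cost + j.cost + e.cost)
  | .setF _ i j e => .C (1 + i.cost + j.cost + e.cost)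
  | .setW _ i j e => .C (1 + i.cost + j.cost + e.cost)
  | .seq c d => c.time + d.time
  | .cond b c d => .C (1 + b.cost) + c.time + d.time
  -- Initialising the variable costs 4, the final failing test `5 + b.cost`, and each pass that same
  -- test plus 8 for the increment, besides the body.
  | .loop _ b c => .C 4 + .C (5 + b.cost) + .X * (.C (13 + b.cost) + c.time)

/-- Well-formedness makes the two descriptions of a loop agree: the bound, re-evaluated at each
test, keeps its initial value, and the body leaves the variable at `k`, so that the increment yields
the `k + 1` prescribed by `iterate`. -/
theorem exec_toCom {F : Type u} [Field F] {procs : List Com} {M : ℕ} (c : Block) (σ : State F)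
    (hw : c.wf = true) (hb : c.Bounded M σ) :
    ∃ t ≤ c.time.eval M, Exec procs c.toCom σ (c.run σ) t := by
  induction c generalizing σ with
  | skip => exact ⟨1, by simp [time], .skip _⟩
  | setN a i j e => exact ⟨_, by simp only [time, Polynomial.eval_C]; exact le_rfl, .setN a i j e σ⟩
  | setF a i j e => exact ⟨_, by simp only [time, Polynomial.eval_C]; exact le_rfl, .setF a i j e σ⟩
  | setW a i j e => exact ⟨_, by simp only [time, Polynomial.eval_C]; exact le_rfl, .setW a i j e σ⟩
  | seq c d hc hd =>
    simp only [wf, Bool.and_eq_true] at hw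
    obtain ⟨t, ht, h⟩ := hc σ hw.1 hb.1
    obtain ⟨t', ht', h'⟩ := hd _ hw.2 hb.2
    exact ⟨t + t', by simp only [time, Polynomial.eval_add]; omega, .seq h h'⟩
  | cond b c d hc hd =>
    simp only [wf, Bool.and_eq_true] at hw
    simp only [run]
    split_ifs with hbσ
    · obtain ⟨t, ht, h⟩ := hc σ hw.1 (hb.1 hbσ)
      exact ⟨_, by simp only [time, Polynomial.eval_add, Polynomial.eval_C]; omega,
        .condTrue hbσ h⟩
    · obtain ⟨t, ht, h⟩ := hd σ hw.2 (hb.2 hbσ)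
      exact ⟨_, by simp only [time, Polynomial.eval_add, Polynomial.eval_C]; omega,
        .condFalse hbσ h⟩
  | loop v b c hc =>
    simp only [wf, Bool.and_eq_true, Bool.not_eq_true', List.contains_eq_mem,
      decide_eq_false_iff_not, List.all_eq_true] at hw
    obtain ⟨⟨hw, hv⟩, hr⟩ := hw
    have hbe : ∀ k, b.eval (iterate v c.run σ k) = b.eval σ := fun k =>
      b.eval_congr fun a ha => (frame_iterate (b := b) (frame_run c) σ k).nat a (hr a ha)
    -- Induction on the number `r` of passes that remain.
    have key : ∀ r k, k + r = b.eval σ → ∃ t ≤ (5 + b.cost) + r * (13 + b.cost + c.time.eval M),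
        Exec procs (.loop (.natLt (.var v) b)
          (.seq c.toCom (.setN v (.lit 0) (.lit 0) (.add (.var v) (.lit 1)))))
          (iterate v c.run σ k) (iterate v c.run σ (b.eval σ)) t := by
      intro r
      induction r with
      | zero =>
        intro k hk
        obtain rfl : k = b.eval σ := hk
        refine ⟨_, ?_, .loopDone ?_⟩
        · simp only [BExp.cost, NExp.cost]; omega
        · simp [BExp.Holds, NExp.eval, iterate_var, hbe]
      | succ r ih =>
        intro k hk
        obtain ⟨t, ht, h⟩ := ih (k + 1) (by omega)
        obtain ⟨t', ht', h'⟩ := hc (iterate v c.run σ k) hw (hb.2 k (by omega))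
        have hset : Exec procs (.setN v (.lit 0) (.lit 0) (.add (.var v) (.lit 1)))
            (c.run (iterate v c.run σ k)) (iterate v c.run σ (k + 1)) 8 := by
          have := Exec.setN (procs := procs) v (.lit 0) (.lit 0) (.add (.var v) (.lit 1))
            (c.run (iterate v c.run σ k))
          simpa [NExp.eval, NExp.cost, iterate, State.setVar,
            (frame_run c (iterate v c.run σ k)).nat v hv, iterate_var] using this
        refine ⟨_, ?_, .loopStep ?_ (.seq h' hset) h⟩
        · simp only [BExp.cost, NExp.cost]
          linarith
        · simp only [BExp.Holds, NExp.eval, iterate_var, hbe]; omega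
    obtain ⟨t, ht, h⟩ := key (b.eval σ) 0 (by omega)
    have hset : Exec procs (.setN v (.lit 0) (.lit 0) (.lit 0)) σ (iterate v c.run σ 0) 4 :=
      Exec.setN (procs := procs) v (.lit 0) (.lit 0) (.lit 0) σ
    refine ⟨_, ?_, .seq hset h⟩
    simp only [time, Polynomial.eval_add, Polynomial.eval_mul, Polynomial.eval_C, Polynomial.eval_X]
    have := Nat.mul_le_mul_right (13 + b.cost + c.time.eval M) hb.1
    omega

/-- All loop bounds are entries of the arrays in `L`. -/
def boundsIn (L : List ℕ) : Block → Bool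
  | .seq c d => c.boundsIn L && d.boundsIn L
  | .cond _ c d => c.boundsIn L && d.boundsIn L
  | .loop _ b c => (match b with | .get a _ _ => L.contains a | _ => false) && c.boundsIn L
  | _ => true

/-- When the bounds are read from arrays that are never written, bounding their initial contents
suffices, without any analysis of the run. -/
theorem bounded_of_boundsIn {F : Type u} [Field F] {M : ℕ} {L : List ℕ} (c : Block) (σ : State F)
    (hc : c.boundsIn L = true) (hL : ∀ a ∈ L, a ∉ c.wN)
    (hσ : ∀ a ∈ L, ∀ i j, σ.nat a i j ≤ M) : c.Bounded M σ := by
  induction c generalizing σ with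
  | skip => trivial
  | setN a i j e => trivial
  | setF a i j e => trivial
  | setW a i j e => trivial
  | seq c d ihc ihd =>
    simp only [boundsIn, Bool.and_eq_true] at hc
    simp only [wN, List.mem_append, not_or] at hL
    refine ⟨ihc σ hc.1 (fun a ha => (hL a ha).1) hσ, ihd _ hc.2 (fun a ha => (hL a ha).2) ?_⟩
    intro a ha
    rw [(frame_run c σ).nat a (hL a ha).1]
    exact hσ a ha
  | cond b c d ihc ihd =>
    simp only [boundsIn, Bool.and_eq_true] at hc
    simp only [wN, List.mem_append, not_or] at hL
    exact ⟨fun _ => ihc σ hc.1 (fun a ha => (hL a ha).1) hσ,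
      fun _ => ihd σ hc.2 (fun a ha => (hL a ha).2) hσ⟩
  | loop v b c ih =>
    simp only [boundsIn, Bool.and_eq_true] at hc
    refine ⟨?_, fun i _ => ih _ hc.2 (fun a ha h => hL a ha (List.mem_cons_of_mem _ h)) ?_⟩
    · cases b with
      | get a i j => exact hσ a (by simpa using hc.1) _ _
      | lit n => simp at hc
      | add x y => simp at hc
      | sub x y => simp at hc
    · intro a ha
      rw [(frame_iterate (b := b) (frame_run c) σ i).nat a (hL a ha)]
      exact hσ a ha

end Block

/-! ### Decoding weighted Reed–Solomon words -/

section ReedSolomon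

open Polynomial

variable {F : Type u} [Field F]

open Classical in
/-- The distance between the weighted word `(f, u)` and the word `g`, on the indices below `n`. -/
noncomputable def wdist (n : ℕ) (f : ℕ → F) (u : ℕ → ℝ) (g : ℕ → F) : ℝ :=
  ∑ s ∈ Finset.range n, if f s = g s then u s / 2 else 1 - u s / 2

theorem wdist_congr {n : ℕ} {f f' g g' : ℕ → F} {u u' : ℕ → ℝ} (hf : ∀ s < n, f s = f' s)
    (hu : ∀ s < n, u s = u' s) (hg : ∀ s < n, g s = g' s) :
    wdist n f u g = wdist n f' u' g' := by
  refine Finset.sum_congr rfl fun s hs => ?_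
  rw [Finset.mem_range] at hs
  rw [hf s hs, hu s hs, hg s hs]

theorem wdist_nonneg {n : ℕ} {f g : ℕ → F} {u : ℕ → ℝ} (hu0 : ∀ s < n, 0 ≤ u s)
    (hu1 : ∀ s < n, u s ≤ 1) : 0 ≤ wdist n f u g := by
  refine Finset.sum_nonneg fun s hs => ?_
  rw [Finset.mem_range] at hs
  have := hu0 s hs
  have := hu1 s hs
  split_ifs <;> linarith

open Classical in
-- A weighted triangle inequality: where `g` and `h` differ, `f` disagrees with one of them, and the
-- two contributions add up to `u/2 + (1 - u/2) = 1` or to `2 - u ≥ 1`.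
theorem card_ne_le_wdist_add {n : ℕ} {f g h : ℕ → F} {u : ℕ → ℝ} (hu0 : ∀ s < n, 0 ≤ u s)
    (hu1 : ∀ s < n, u s ≤ 1) :
    (((Finset.range n).filter fun s => g s ≠ h s).card : ℝ) ≤ wdist n f u g + wdist n f u h := by
  rw [Finset.card_filter, wdist, wdist, ← Finset.sum_add_distrib]
  push_cast
  refine Finset.sum_le_sum fun s hs => ?_
  rw [Finset.mem_range] at hs
  have := hu0 s hs
  have := hu1 s hs
  by_cases h1 : f s = g s
  · by_cases h2 : f s = h s
    · have : g s = h s := h1.symm.trans h2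
      simp [h1, this]; linarith
    · have : g s ≠ h s := fun h => h2 (h1.trans h)
      rw [if_pos h1, if_neg h2, if_pos this]
      linarith
  · by_cases h2 : f s = h s
    · have : g s ≠ h s := fun h => h1 (h2.trans h.symm)
      rw [if_neg h1, if_pos h2, if_pos this]
      linarith
    · simp only [h1, h2, if_false]
      split_ifs <;> linarith

open Classical in
theorem sub_le_card_eval_ne {n j : ℕ} {x : ℕ → F} (hx : Set.InjOn x (Finset.range n)) {p q : F[X]}
    (hp : p.natDegree ≤ j) (hq : q.natDegree ≤ j) (hpq : p ≠ q) :
    n ≤ j + ((Finset.range n).filter fun s => p.eval (x s) ≠ q.eval (x s)).card := by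
  by_contra! hlt
  have hc := Finset.card_filter_add_card_filter_not (s := Finset.range n)
    (fun s => p.eval (x s) = q.eval (x s))
  rw [Finset.card_range] at hc
  apply hpq
  rw [← sub_eq_zero]
  refine eq_zero_of_degree_lt_of_eval_index_eq_zero
    ((Finset.range n).filter fun s => p.eval (x s) = q.eval (x s)) (v := x)
    (hx.mono (Finset.coe_subset.2 (Finset.filter_subset _ _))) ?_ ?_
  · refine degree_le_natDegree.trans_lt ?_
    have := natDegree_sub_le p q
    have h2 : (p - q).natDegree ≤ j := this.trans (max_le hp hq)
    exact_mod_cast (by simp only [ne_eq] at hlt; omega)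
  · intro s hs
    simp only [Finset.mem_filter] at hs
    simp [hs.2]

/-- Distinct polynomials of degree at most `j` agree at no more than `j` of the points, so they
differ in at least `n - j` of them. -/
theorem sub_le_wdist_add_wdist {n j : ℕ} {x f : ℕ → F} {u : ℕ → ℝ}
    (hx : Set.InjOn x (Finset.range n)) (hu0 : ∀ s < n, 0 ≤ u s) (hu1 : ∀ s < n, u s ≤ 1)
    {p q : F[X]} (hp : p.natDegree ≤ j) (hq : q.natDegree ≤ j) (hpq : p ≠ q) :
    (n : ℝ) - j ≤ wdist n f u (fun s => p.eval (x s)) + wdist n f u (fun s => q.eval (x s)) := by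
  classical
  have h1 := sub_le_card_eval_ne hx hp hq hpq
  have h2 := card_ne_le_wdist_add (f := f) (g := fun s => p.eval (x s))
    (h := fun s => q.eval (x s)) hu0 hu1
  have h3 : (n : ℝ) ≤ j + (((Finset.range n).filter fun s => p.eval (x s) ≠ q.eval (x s)).card : ℝ) :=
    by exact_mod_cast h1
  linarith

/-- What the decoder returns for a weighted word `(f, u)` on the points `x 0, …, x (n - 1)` and for
the polynomials of degree at most `j`: a coefficient `g` of `X ^ j` and its weight `v`. -/
structure IsStripDecoding (n : ℕ) (x : ℕ → F) (j : ℕ) (f : ℕ → F) (u : ℕ → ℝ) (g : F) (v : ℝ) :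
    Prop where
  nonneg : 0 ≤ v
  le_one : v ≤ 1
  of_eq : ∀ p : F[X], p.natDegree ≤ j → g = p.coeff j →
    v / 2 ≤ wdist n f u (fun s => p.eval (x s)) / ((n : ℝ) - j)
  of_ne : ∀ p : F[X], p.natDegree ≤ j → g ≠ p.coeff j →
    1 - v / 2 ≤ wdist n f u (fun s => p.eval (x s)) / ((n : ℝ) - j)

/-- The result of a successful decoding. -/
def IsDecoded (n : ℕ) (x : ℕ → F) (j : ℕ) (f : ℕ → F) (u : ℕ → ℝ) (g : F) (v : ℝ) : Prop :=
  ∃ q : F[X], q.natDegree ≤ j ∧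
    wdist n f u (fun s => q.eval (x s)) + wdist n f u (fun s => q.eval (x s)) < (n : ℝ) - j ∧
    g = q.coeff j ∧ v = (wdist n f u (fun s => q.eval (x s)) +
      wdist n f u (fun s => q.eval (x s))) / ((n : ℝ) - j)

/-- Any `p ≠ q` satisfies `Δ(p) ≥ n - j - Δ(q) > Δ(q)`. The first inequality gives the bound for a
differing coefficient, the second the bound for an equal one. -/
theorem IsDecoded.isStripDecoding {n j : ℕ} {x f : ℕ → F} {u : ℕ → ℝ} {g : F} {v : ℝ}
    (hx : Set.InjOn x (Finset.range n)) (hj : j < n) (hu0 : ∀ s < n, 0 ≤ u s)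
    (hu1 : ∀ s < n, u s ≤ 1) (h : IsDecoded n x j f u g v) : IsStripDecoding n x j f u g v := by
  obtain ⟨q, hq, hlt, rfl, rfl⟩ := h
  have hpos : (0 : ℝ) < n - j := by
    have : (j : ℝ) < n := by exact_mod_cast hj
    linarith
  have h0 := wdist_nonneg (f := f) (g := fun s => q.eval (x s)) hu0 hu1
  refine ⟨by positivity, (div_le_one hpos).2 hlt.le, fun p hp hc => ?_, fun p hp hc => ?_⟩
  · rw [div_right_comm]
    apply div_le_div_of_nonneg_right _ hpos.le
    by_cases hpq : p = q
    · rw [hpq]; linarith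
    · have := sub_le_wdist_add_wdist (f := f) hx hu0 hu1 hp hq hpq
      linarith
  · have hpq : p ≠ q := by rintro rfl; exact hc rfl
    have := sub_le_wdist_add_wdist (f := f) hx hu0 hu1 hp hq hpq
    rw [le_div_iff₀ hpos, sub_mul, div_right_comm, div_mul_cancel₀ _ hpos.ne']
    linarith

/-- With weight `1` a symbol costs `1/2` whether it is right or wrong, and no polynomial is close
enough to make that too much. -/
theorem isStripDecoding_erasure {n j : ℕ} {x f : ℕ → F} {u : ℕ → ℝ} (hj : j < n)
    (h : ∀ p : F[X], p.natDegree ≤ j → (n : ℝ) - j ≤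
      wdist n f u (fun s => p.eval (x s)) + wdist n f u (fun s => p.eval (x s))) :
    IsStripDecoding n x j f u 0 1 := by
  have hpos : (0 : ℝ) < n - j := by
    have : (j : ℝ) < n := by exact_mod_cast hj
    linarith
  refine ⟨zero_le_one, le_rfl, fun p hp _ => ?_, fun p hp _ => ?_⟩ <;>
  · have := h p hp
    rw [le_div_iff₀ hpos]
    linarith

/-! #### Generalized minimum distance decoding -/

theorem intervalIntegrable_ite_lt (v : ℝ) (a b : ℝ) :
    IntervalIntegrable (fun τ : ℝ => if τ < v then a else b) MeasureTheory.volume 0 1 := by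
  rw [intervalIntegrable_iff]
  have : MeasureTheory.IsFiniteMeasure
      (MeasureTheory.volume.restrict (Set.uIoc (0 : ℝ) 1)) := by
    rw [Set.uIoc_of_le zero_le_one]; infer_instance
  have h : MeasureTheory.IntegrableOn (fun τ : ℝ => (Set.Iio v).indicator (fun _ => a - b) τ + b)
      (Set.uIoc 0 1) :=
    MeasureTheory.Integrable.add
      ((MeasureTheory.integrable_const _).indicator measurableSet_Iio)
      (MeasureTheory.integrable_const _)
  refine h.congr_fun (fun τ _ => ?_) measurableSet_uIoc
  by_cases hτ : τ < v <;> simp [Set.indicator, hτ]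

theorem integral_ite_lt {v : ℝ} (h0 : 0 ≤ v) (h1 : v ≤ 1) (a b : ℝ) :
    ∫ τ in (0 : ℝ)..1, (if τ < v then a else b) = v * a + (1 - v) * b := by
  have hf := intervalIntegrable_ite_lt v a b
  rw [← intervalIntegral.integral_add_adjacent_intervals (b := v)
    (hf.mono_set (by rw [Set.uIcc_of_le h0, Set.uIcc_of_le zero_le_one]; exact Set.Icc_subset_Icc_right h1))
    (hf.mono_set (by rw [Set.uIcc_of_le h1, Set.uIcc_of_le zero_le_one]; exact Set.Icc_subset_Icc_left h0))]
  -- At the endpoint `τ = v` the test fails, hence the passage to the open interval.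
  have e1 : ∫ τ in (0 : ℝ)..v, (if τ < v then a else b) = ∫ _ in (0 : ℝ)..v, a := by
    rw [intervalIntegral.integral_of_le h0, intervalIntegral.integral_of_le h0,
      MeasureTheory.integral_Ioc_eq_integral_Ioo, MeasureTheory.integral_Ioc_eq_integral_Ioo]
    exact MeasureTheory.setIntegral_congr_fun measurableSet_Ioo fun τ hτ => if_pos hτ.2
  have e2 : ∫ τ in v..(1 : ℝ), (if τ < v then a else b) = ∫ _ in v..(1 : ℝ), b := by
    refine intervalIntegral.integral_congr fun τ hτ => ?_
    rw [Set.uIcc_of_le h1] at hτ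
    exact if_neg (not_lt.2 hτ.1)
  rw [e1, e2]
  simp

open Classical in
/-- Some threshold makes erasing the less reliable symbols profitable. -/
theorem exists_threshold {n j : ℕ} {f g : ℕ → F} {u : ℕ → ℝ} (hu0 : ∀ s < n, 0 ≤ u s)
    (hu1 : ∀ s < n, u s ≤ 1) (h : wdist n f u g + wdist n f u g < (n : ℝ) - j) :
    ∃ s₀ < n, 2 * ((Finset.range n).filter fun s => ¬ u s₀ < u s ∧ f s ≠ g s).card + j <
      ((Finset.range n).filter fun s => ¬ u s₀ < u s).card := by
  -- Count `1` for an erased symbol and `2` for a wrong symbol that is kept. Averaged over `τ ∈ [0,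
  -- 1]`, a correct symbol contributes `u` and a wrong one `u + 2 (1 - u) = 2 - u`, in total `2Δ < n
  -- - j`.
  have hτ : ∃ τ : ℝ, ∑ s ∈ Finset.range n,
      (if τ < u s then (1 : ℝ) else if f s = g s then 0 else 2) < n - j := by
    by_contra! hcon
    have hint : ∀ s ∈ Finset.range n, IntervalIntegrable
        (fun τ => if τ < u s then (1 : ℝ) else if f s = g s then 0 else 2)
        MeasureTheory.volume 0 1 := fun s _ => intervalIntegrable_ite_lt _ _ _
    have h1 : ∫ _ in (0 : ℝ)..1, ((n : ℝ) - j) ≤ ∫ τ in (0 : ℝ)..1, ∑ s ∈ Finset.range n,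
        (if τ < u s then (1 : ℝ) else if f s = g s then 0 else 2) := by
      refine intervalIntegral.integral_mono_on zero_le_one (by simp) ?_ fun τ _ => hcon τ
      have := IntervalIntegrable.sum (Finset.range n) hint
      simpa [Finset.sum_fn] using this
    rw [intervalIntegral.integral_finsetSum hint] at h1
    have h2 : ∑ s ∈ Finset.range n, ∫ τ in (0 : ℝ)..1,
        (if τ < u s then (1 : ℝ) else if f s = g s then 0 else 2) =
        wdist n f u g + wdist n f u g := by
      rw [wdist, ← Finset.sum_add_distrib]
      refine Finset.sum_congr rfl fun s hs => ?_
      rw [Finset.mem_range] at hs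
      rw [integral_ite_lt (hu0 s hs) (hu1 s hs)]
      split_ifs <;> ring
    rw [h2] at h1
    simp at h1
    linarith
  obtain ⟨τ, hτ⟩ := hτ
  have hsplit : ∑ s ∈ Finset.range n, (if τ < u s then (1 : ℝ) else if f s = g s then 0 else 2) =
      n - ((Finset.range n).filter fun s => ¬ τ < u s).card +
      2 * ((Finset.range n).filter fun s => ¬ τ < u s ∧ f s ≠ g s).card := by
    rw [Finset.card_filter, Finset.card_filter]
    have hn : (n : ℝ) = ∑ s ∈ Finset.range n, 1 := by simp
    rw [hn]
    push_cast
    rw [← Finset.sum_sub_distrib, Finset.mul_sum, ← Finset.sum_add_distrib]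
    refine Finset.sum_congr rfl fun s _ => ?_
    by_cases h1 : τ < u s <;> by_cases h2 : f s = g s <;> simp [h1, h2]
  rw [hsplit] at hτ
  have hnat : 2 * ((Finset.range n).filter fun s => ¬ τ < u s ∧ f s ≠ g s).card + j <
      ((Finset.range n).filter fun s => ¬ τ < u s).card := by
    have : (2 * ((Finset.range n).filter fun s => ¬ τ < u s ∧ f s ≠ g s).card + j : ℝ) <
      ((Finset.range n).filter fun s => ¬ τ < u s).card := by linarith
    exact_mod_cast this
  -- Lowering `τ` to the largest kept weight changes no decision; some symbol is kept because the
  -- kept set has more than `2 · errors + j` elements.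
  obtain ⟨s₀, hs₀, hmax⟩ := Finset.exists_max_image
    ((Finset.range n).filter fun s => ¬ τ < u s) u (Finset.card_pos.1 (by omega))
  simp only [Finset.mem_filter, Finset.mem_range, not_lt] at hs₀ hmax
  have heq : ∀ s < n, (¬ u s₀ < u s ↔ ¬ τ < u s) := fun s hs => by
    rw [not_lt, not_lt]
    exact ⟨fun h => h.trans hs₀.2, fun h => hmax s ⟨hs, h⟩⟩
  refine ⟨s₀, hs₀.1, ?_⟩
  rw [Finset.filter_congr (q := fun s => ¬ τ < u s) fun s hs => heq s (Finset.mem_range.1 hs),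
    Finset.filter_congr (q := fun s => ¬ τ < u s ∧ f s ≠ g s)
      fun s hs => and_congr_left' (heq s (Finset.mem_range.1 hs))]
  exact hnat

/-! #### The error locator -/

/-- The invariant of the interpolation algorithm.  The rows `E b`, `R b` contain the values of `E_b`
and of `Q_b - f E_b` for a basis of the pairs of polynomials with `Q_b = f E_b` on the points indexed
by `A`, and `D b` is the weighted degree of `(E_b, Q_b)`. -/
structure LocatorInvariant (n : ℕ) (x : ℕ → F) (j : ℕ) (f : ℕ → F) (A : Finset ℕ)
    (E R : ℕ → ℕ → F) (D : ℕ → ℕ) (E₀ Q₀ E₁ Q₁ : F[X]) : Prop where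
  eval_E₀ : ∀ r < n, E 0 r = E₀.eval (x r)
  eval_E₁ : ∀ r < n, E 1 r = E₁.eval (x r)
  eval_R₀ : ∀ r < n, R 0 r = Q₀.eval (x r) - f r * E₀.eval (x r)
  eval_R₁ : ∀ r < n, R 1 r = Q₁.eval (x r) - f r * E₁.eval (x r)
  degree_Q₀ : Q₀.degree = D 0
  degree_E₀ : (E₀ * X ^ j).degree < (D 0 : WithBot ℕ)
  degree_Q₁ : Q₁.degree ≤ D 1
  degree_E₁ : (E₁ * X ^ j).degree = (D 1 : WithBot ℕ)
  sum_le : D 0 + D 1 ≤ j + A.card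
  zero₀ : ∀ s ∈ A, R 0 s = 0
  zero₁ : ∀ s ∈ A, R 1 s = 0

/-- With no conditions imposed, the pairs `(E, Q)` are generated by `(0, 1)` and `(1, 0)`, of
weighted degrees `0` and `j`. -/
theorem locatorInvariant_init {n : ℕ} {x : ℕ → F} {j : ℕ} {f : ℕ → F} {E R : ℕ → ℕ → F}
    {D : ℕ → ℕ} (hE₀ : ∀ r < n, E 0 r = 0) (hR₀ : ∀ r < n, R 0 r = 1) (hE₁ : ∀ r < n, E 1 r = 1)
    (hR₁ : ∀ r < n, R 1 r = 0 - f r) (hD₀ : D 0 = 0) (hD₁ : D 1 = j) :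
    LocatorInvariant n x j f ∅ E R D 0 1 1 0 where
  eval_E₀ r hr := by simp [hE₀ r hr]
  eval_E₁ r hr := by simp [hE₁ r hr]
  eval_R₀ r hr := by simp [hR₀ r hr]
  eval_R₁ r hr := by simp [hR₁ r hr]
  degree_Q₀ := by simp [hD₀]
  degree_E₀ := by simp [hD₀]
  degree_Q₁ := by simp
  degree_E₁ := by simp [hD₁]
  sum_le := by simp [hD₀, hD₁]
  zero₀ := by simp
  zero₁ := by simp

theorem degree_mul_X_sub_C (p : F[X]) (a : F) : (p * (X - C a)).degree = p.degree + 1 := by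
  rw [degree_mul, degree_X_sub_C]

theorem degree_mul_X_sub_C_eq {p : F[X]} {d : ℕ} (a : F) (h : p.degree = d) :
    (p * (X - C a)).degree = ((d + 1 : ℕ) : WithBot ℕ) := by
  rw [degree_mul_X_sub_C, h]; rfl

theorem degree_mul_X_sub_C_le {p : F[X]} {d : ℕ} (a : F) (h : p.degree ≤ d) :
    (p * (X - C a)).degree ≤ ((d + 1 : ℕ) : WithBot ℕ) := by
  rw [degree_mul_X_sub_C]
  exact_mod_cast add_le_add_left h 1

theorem degree_mul_X_sub_C_lt {p : F[X]} {d : ℕ} (a : F) (h : p.degree < d) :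
    (p * (X - C a)).degree < ((d + 1 : ℕ) : WithBot ℕ) := by
  rw [degree_mul_X_sub_C]
  by_cases hp : p = 0
  · simp [hp]
  · rw [degree_eq_natDegree hp] at h ⊢
    exact_mod_cast Nat.succ_lt_succ (by exact_mod_cast h)

theorem degree_C_mul_lt {p : F[X]} {d : ℕ} (c : F) (h : p.degree < d) : (C c * p).degree < (d : WithBot ℕ) := by
  refine lt_of_le_of_lt ?_ h
  by_cases hc : c = 0
  · simp [hc]
  · rw [degree_C_mul hc]

theorem degree_C_mul_le' {p : F[X]} {d : WithBot ℕ} (c : F) (h : p.degree ≤ d) :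
    (C c * p).degree ≤ d := by
  refine le_trans ?_ h
  by_cases hc : c = 0
  · simp [hc]
  · rw [degree_C_mul hc]

section Pivot

variable {n : ℕ} {x : ℕ → F} {j : ℕ} {f : ℕ → F} {A : Finset ℕ} {E R E' R' : ℕ → ℕ → F}
  {D D' : ℕ → ℕ} {E₀ Q₀ E₁ Q₁ : F[X]} {s : ℕ} {c : F}

/-- The other row is cleared at `s` by subtracting a multiple of row `0`, and row `0` by the factor
`X - x s`. Only row `0` gains a degree: either the multiple subtracted has no larger weighted
degree, or `R 1 s = 0` and `c = 0`. The strict inequality `degree_E₀` keeps the leading term of row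
`1` in its `E` component. -/
theorem LocatorInvariant.pivot_zero (h : LocatorInvariant n x j f A E R D E₀ Q₀ E₁ Q₁)
    (hA : ∀ a ∈ A, a < n) (hs : s < n) (hsA : s ∉ A) (h0 : R 0 s ≠ 0)
    (hD : D 0 ≤ D 1 ∨ R 1 s = 0) (hc : c = R 1 s * (R 0 s)⁻¹)
    (hE₁ : ∀ r < n, E' 1 r = E 1 r - c * E 0 r) (hR₁ : ∀ r < n, R' 1 r = R 1 r - c * R 0 r)
    (hE₀ : ∀ r < n, E' 0 r = E 0 r * (x r - x s)) (hR₀ : ∀ r < n, R' 0 r = R 0 r * (x r - x s))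
    (hD₀ : D' 0 = D 0 + 1) (hD₁ : D' 1 = D 1) :
    LocatorInvariant n x j f (insert s A) E' R' D' (E₀ * (X - C (x s))) (Q₀ * (X - C (x s)))
      (E₁ - C c * E₀) (Q₁ - C c * Q₀) where
  eval_E₀ r hr := by simp [hE₀ r hr, h.eval_E₀ r hr]
  eval_E₁ r hr := by simp [hE₁ r hr, h.eval_E₀ r hr, h.eval_E₁ r hr]
  eval_R₀ r hr := by simp [hR₀ r hr, h.eval_R₀ r hr]; ring
  eval_R₁ r hr := by simp [hR₁ r hr, h.eval_R₀ r hr, h.eval_R₁ r hr]; ring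
  degree_Q₀ := by rw [hD₀]; exact degree_mul_X_sub_C_eq _ h.degree_Q₀
  degree_E₀ := by
    rw [hD₀, mul_right_comm]; exact degree_mul_X_sub_C_lt _ h.degree_E₀
  degree_Q₁ := by
    rw [hD₁]
    rcases hD with hD | hD
    · refine (degree_sub_le _ _).trans (max_le h.degree_Q₁ (degree_C_mul_le' _ ?_))
      rw [h.degree_Q₀]; exact_mod_cast hD
    · simpa [hc, hD] using h.degree_Q₁
  degree_E₁ := by
    rw [hD₁]
    rcases hD with hD | hD
    · rw [sub_mul, mul_assoc, degree_sub_eq_left_of_degree_lt, h.degree_E₁]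
      rw [h.degree_E₁]
      exact degree_C_mul_lt _ (h.degree_E₀.trans_le (by exact_mod_cast hD))
    · simpa [hc, hD] using h.degree_E₁
  sum_le := by
    have := h.sum_le
    rw [hD₀, hD₁, Finset.card_insert_of_notMem hsA]; omega
  zero₀ a ha := by
    rcases Finset.mem_insert.1 ha with rfl | ha
    · simp [hR₀ _ hs]
    · simp [hR₀ _ (hA a ha), h.zero₀ a ha]
  zero₁ a ha := by
    rcases Finset.mem_insert.1 ha with rfl | ha
    · rw [hR₁ _ hs, hc, inv_mul_cancel_right₀ h0, sub_self]
    · simp [hR₁ _ (hA a ha), h.zero₀ a ha, h.zero₁ a ha]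

/-- Here strictness `D 1 < D 0` is needed, because row `0` must keep its leading term in `Q`, while
both components of row `1` may attain the degree `D 1`. -/
theorem LocatorInvariant.pivot_one (h : LocatorInvariant n x j f A E R D E₀ Q₀ E₁ Q₁)
    (hA : ∀ a ∈ A, a < n) (hs : s < n) (hsA : s ∉ A) (h1 : R 1 s ≠ 0)
    (hD : D 1 < D 0 ∨ R 0 s = 0) (hc : c = R 0 s * (R 1 s)⁻¹)
    (hE₀ : ∀ r < n, E' 0 r = E 0 r - c * E 1 r) (hR₀ : ∀ r < n, R' 0 r = R 0 r - c * R 1 r)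
    (hE₁ : ∀ r < n, E' 1 r = E 1 r * (x r - x s)) (hR₁ : ∀ r < n, R' 1 r = R 1 r * (x r - x s))
    (hD₁ : D' 1 = D 1 + 1) (hD₀ : D' 0 = D 0) :
    LocatorInvariant n x j f (insert s A) E' R' D' (E₀ - C c * E₁) (Q₀ - C c * Q₁)
      (E₁ * (X - C (x s))) (Q₁ * (X - C (x s))) where
  eval_E₁ r hr := by simp [hE₁ r hr, h.eval_E₁ r hr]
  eval_E₀ r hr := by simp [hE₀ r hr, h.eval_E₀ r hr, h.eval_E₁ r hr]
  eval_R₁ r hr := by simp [hR₁ r hr, h.eval_R₁ r hr]; ring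
  eval_R₀ r hr := by simp [hR₀ r hr, h.eval_R₀ r hr, h.eval_R₁ r hr]; ring
  degree_Q₁ := by rw [hD₁]; exact degree_mul_X_sub_C_le _ h.degree_Q₁
  degree_E₁ := by
    rw [hD₁, mul_right_comm]; exact degree_mul_X_sub_C_eq _ h.degree_E₁
  degree_Q₀ := by
    rw [hD₀]
    rcases hD with hD | hD
    · rw [degree_sub_eq_left_of_degree_lt, h.degree_Q₀]
      rw [h.degree_Q₀]
      exact degree_C_mul_lt _ (h.degree_Q₁.trans_lt (by exact_mod_cast hD))
    · simpa [hc, hD] using h.degree_Q₀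
  degree_E₀ := by
    rw [hD₀]
    rcases hD with hD | hD
    · rw [sub_mul, mul_assoc]
      refine (degree_sub_le _ _).trans_lt (max_lt h.degree_E₀ (degree_C_mul_lt _ ?_))
      rw [h.degree_E₁]; exact_mod_cast hD
    · simpa [hc, hD] using h.degree_E₀
  sum_le := by
    have := h.sum_le
    rw [hD₀, hD₁, Finset.card_insert_of_notMem hsA]; omega
  zero₁ a ha := by
    rcases Finset.mem_insert.1 ha with rfl | ha
    · simp [hR₁ _ hs]
    · simp [hR₁ _ (hA a ha), h.zero₁ a ha]
  zero₀ a ha := by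
    rcases Finset.mem_insert.1 ha with rfl | ha
    · rw [hR₀ _ hs, hc, inv_mul_cancel_right₀ h1, sub_self]
    · simp [hR₀ _ (hA a ha), h.zero₀ a ha, h.zero₁ a ha]

/-- A new point already satisfied by both rows costs no degree; this is why `sum_le` is only an
inequality. -/
theorem LocatorInvariant.insert_of_zero (h : LocatorInvariant n x j f A E R D E₀ Q₀ E₁ Q₁)
    (hsA : s ∉ A) (h0 : R 0 s = 0) (h1 : R 1 s = 0) :
    LocatorInvariant n x j f (insert s A) E R D E₀ Q₀ E₁ Q₁ :=
  { h with
    sum_le := by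
      have := h.sum_le
      rw [Finset.card_insert_of_notMem hsA]; omega
    zero₀ := fun a ha => by
      rcases Finset.mem_insert.1 ha with rfl | ha
      exacts [h0, h.zero₀ a ha]
    zero₁ := fun a ha => by
      rcases Finset.mem_insert.1 ha with rfl | ha
      exacts [h1, h.zero₁ a ha] }

end Pivot

open Classical in
/-- A pair of small weighted degree is a multiple of `(1, p)`. -/
theorem eq_mul_of_interpolates {x f : ℕ → F} {j d : ℕ} {A : Finset ℕ} (hx : Set.InjOn x A)
    {E Q p : F[X]} (hp : p.natDegree ≤ j) (hE : (E * X ^ j).degree ≤ (d : WithBot ℕ)) (hQ : Q.degree ≤ d)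
    (hd : 2 * d ≤ j + A.card) (herr : 2 * (A.filter fun s => f s ≠ p.eval (x s)).card + j < A.card)
    (hA : ∀ s ∈ A, Q.eval (x s) - f s * E.eval (x s) = 0) : Q = p * E := by
  rw [← sub_eq_zero]
  have hc := Finset.card_filter_add_card_filter_not (s := A) (fun s => f s = p.eval (x s))
  refine eq_zero_of_degree_lt_of_eval_index_eq_zero (A.filter fun s => f s = p.eval (x s))
    (v := x) (hx.mono (Finset.coe_subset.2 (Finset.filter_subset _ _))) ?_ ?_
  · have hpE : (p * E).degree ≤ d := by
      refine le_trans ?_ hE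
      rw [degree_mul, degree_mul, degree_X_pow, add_comm]
      exact add_le_add_right (degree_le_of_natDegree_le hp) _
    -- With `e` errors, `2 d ≤ j + |A| < 2 (|A| - e)`, so the degree is below the number of correct
    -- points, at all of which `Q - p E` vanishes.
    refine (degree_sub_le _ _).trans_lt ((max_le hQ hpE).trans_lt ?_)
    exact_mod_cast (by simp only [ne_eq] at herr; omega)
  · intro s hs
    simp only [Finset.mem_filter] at hs
    have := hA s hs.1
    rw [hs.2] at this
    simpa using this

open Classical in
/-- The second component of the final basis locates the errors. -/
theorem LocatorInvariant.locates {n : ℕ} {x f : ℕ → F} {j : ℕ} {A : Finset ℕ} {E R : ℕ → ℕ → F}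
    {D : ℕ → ℕ} {E₀ Q₀ E₁ Q₁ p : F[X]} (h : LocatorInvariant n x j f A E R D E₀ Q₀ E₁ Q₁)
    (hx : Set.InjOn x (Finset.range n)) (hA : ∀ a ∈ A, a < n) (hp : p.natDegree ≤ j)
    (herr : 2 * (A.filter fun s => f s ≠ p.eval (x s)).card + j < A.card) :
    j + 1 ≤ (A.filter fun s => E 1 s ≠ 0).card ∧ ∀ s ∈ A, E 1 s ≠ 0 → f s = p.eval (x s) := by
  have hxA : Set.InjOn x A := hx.mono fun a ha => by simpa using hA a ha
  have hsum := h.sum_le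
  -- Otherwise row `0` has weighted degree at most `(j + |A|) / 2`, whence `Q₀ = p E₀`. This
  -- contradicts `deg Q₀ > deg E₀ + j`.
  have hlt : D 1 < D 0 := by
    by_contra! hle
    have hQ := eq_mul_of_interpolates hxA hp h.degree_E₀.le h.degree_Q₀.le (by omega) herr
      fun s hs => by rw [← h.eval_R₀ s (hA s hs)]; exact h.zero₀ s hs
    have h1 := h.degree_Q₀
    have h2 := h.degree_E₀
    rw [hQ, degree_mul] at h1
    rw [degree_mul, degree_X_pow, ← h1, add_comm] at h2
    exact absurd h2 (not_lt.2 (add_le_add_left (degree_le_of_natDegree_le hp) _))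
  have hQ := eq_mul_of_interpolates hxA hp h.degree_E₁.le h.degree_Q₁ (by omega) herr
    fun s hs => by rw [← h.eval_R₁ s (hA s hs)]; exact h.zero₁ s hs
  constructor
  -- From `2 D 1 < j + |A| < 2 |A|` follows `deg E₁ = D 1 - j < |A| - j`, but with at most `j`
  -- nonzero values `E₁` would have `|A| - j` zeros in `A`.
  · by_contra! hcard
    have hE₁ : E₁ ≠ 0 := by
      rintro rfl
      have := h.degree_E₁
      simp at this
    have hdeg : E₁.natDegree + j = D 1 := by
      have := h.degree_E₁
      rw [degree_mul, degree_X_pow, degree_eq_natDegree hE₁] at this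
      exact_mod_cast this
    have hc := Finset.card_filter_add_card_filter_not (s := A) (fun s => E 1 s = 0)
    refine hE₁ (eq_zero_of_degree_lt_of_eval_index_eq_zero (A.filter fun s => E 1 s = 0)
      (v := x) (hxA.mono (Finset.coe_subset.2 (Finset.filter_subset _ _))) ?_ ?_)
    · rw [degree_eq_natDegree hE₁]
      exact_mod_cast (by simp only [ne_eq] at hcard; omega)
    · intro s hs
      simp only [Finset.mem_filter] at hs
      rw [← h.eval_E₁ s (hA s hs.1)]
      exact hs.2
  · intro s hs hE
    have h0 := h.zero₁ s hs
    rw [h.eval_R₁ s (hA s hs), hQ, eval_mul, ← sub_mul] at h0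
    rw [h.eval_E₁ s (hA s hs)] at hE
    exact (sub_eq_zero.1 ((mul_eq_zero.1 h0).resolve_right hE)).symm

/-! #### Newton interpolation -/

/-- The invariant of Newton interpolation: `G` and `W` contain the values of the interpolating
polynomial `g` through the points indexed by `B` and of the nodal polynomial of these points. -/
structure NewtonInvariant (n : ℕ) (x : ℕ → F) (j : ℕ) (f : ℕ → F) (B : Finset ℕ) (G W : ℕ → F)
    (a : F) (g : F[X]) : Prop where
  eval_G : ∀ r < n, G r = g.eval (x r)
  eval_W : ∀ r < n, W r = (∏ s ∈ B, (X - C (x s))).eval (x r)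
  degree_lt : g.degree < B.card
  card_le : B.card ≤ j + 1
  coeff_eq : a = g.coeff j
  interpolates : ∀ s ∈ B, g.eval (x s) = f s

theorem newtonInvariant_init {n : ℕ} {x : ℕ → F} {j : ℕ} {f : ℕ → F} {G W : ℕ → F}
    (hG : ∀ r < n, G r = 0) (hW : ∀ r < n, W r = 1) : NewtonInvariant n x j f ∅ G W 0 0 where
  eval_G r hr := by simp [hG r hr]
  eval_W r hr := by simp [hW r hr]
  degree_lt := by simp
  card_le := by simp
  coeff_eq := by simp
  interpolates := by simp

/-- The nodal polynomial is monic of degree `|B|`. Hence the coefficient of `X ^ j` stays `0` while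
`|B| < j`, and the step with `|B| = j`, the last one allowed, sets it to `c`. -/
theorem NewtonInvariant.insert {n : ℕ} {x : ℕ → F} {j : ℕ} {f : ℕ → F} {B : Finset ℕ}
    {G W G' W' : ℕ → F} {a a' c : F} {g : F[X]} {s : ℕ} (h : NewtonInvariant n x j f B G W a g)
    (hx : Set.InjOn x (Finset.range n)) (hB : ∀ b ∈ B, b < n) (hs : s < n) (hsB : s ∉ B)
    (hcard : B.card < j + 1) (hc : c = (f s - G s) * (W s)⁻¹)
    (hG : ∀ r < n, G' r = G r + c * W r) (hW : ∀ r < n, W' r = W r * (x r - x s))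
    (ha : a' = if B.card = j then c else a) :
    NewtonInvariant n x j f (Insert.insert s B) G' W' a'
      (g + C c * ∏ b ∈ B, (X - C (x b))) := by
  have hmonic : (∏ b ∈ B, (X - C (x b))).Monic := monic_prod_of_monic _ _ fun b _ => monic_X_sub_C _
  have hdeg : (∏ b ∈ B, (X - C (x b))).natDegree = B.card := by
    rw [natDegree_prod_of_monic _ _ fun b _ => monic_X_sub_C _]
    simp
  have hzero : ∀ b ∈ B, (∏ b ∈ B, (X - C (x b))).eval (x b) = 0 := fun b hb => by
    rw [eval_prod]
    exact Finset.prod_eq_zero hb (by simp)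
  refine ⟨fun r hr => ?_, fun r hr => ?_, ?_, ?_, ?_, ?_⟩
  · simp [hG r hr, h.eval_G r hr, h.eval_W r hr]
  · rw [hW r hr, h.eval_W r hr, Finset.prod_insert hsB, eval_mul, mul_comm]
    simp
  · rw [Finset.card_insert_of_notMem hsB]
    refine (degree_add_le _ _).trans_lt (max_lt (h.degree_lt.trans (by exact_mod_cast B.card.lt_succ_self))
      (degree_C_mul_lt _ ?_))
    rw [degree_eq_natDegree hmonic.ne_zero, hdeg]
    exact_mod_cast B.card.lt_succ_self
  · rw [Finset.card_insert_of_notMem hsB]; omega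
  · rw [coeff_add, coeff_C_mul, ha]
    split_ifs with hj
    · rw [← hj, coeff_eq_zero_of_degree_lt h.degree_lt, ← hdeg, hmonic.coeff_natDegree]
      simp
    · rw [h.coeff_eq, coeff_eq_zero_of_natDegree_lt (p := ∏ b ∈ B, (X - C (x b)))]
      · simp
      · omega
  · intro b hb
    rcases Finset.mem_insert.1 hb with rfl | hb
    · have hne : W b ≠ 0 := by
        rw [h.eval_W b hs, eval_prod, Finset.prod_ne_zero_iff]
        intro b' hb'
        rw [eval_sub, eval_X, eval_C, sub_ne_zero]
        intro heq
        exact hsB (hx (by simpa using hs) (by simpa using hB b' hb') heq ▸ hb')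
      rw [eval_add, eval_mul, eval_C, ← h.eval_W b hs, ← h.eval_G b hs, hc,
        inv_mul_cancel_right₀ hne]
      ring
    · rw [eval_add, eval_mul, hzero b hb, mul_zero, add_zero, h.interpolates b hb]

theorem NewtonInvariant.natDegree_le {n : ℕ} {x : ℕ → F} {j : ℕ} {f : ℕ → F} {B : Finset ℕ}
    {G W : ℕ → F} {a : F} {g : F[X]} (h : NewtonInvariant n x j f B G W a g) : g.natDegree ≤ j := by
  refine natDegree_le_iff_coeff_eq_zero.2 fun N hN => coeff_eq_zero_of_degree_lt
    (h.degree_lt.trans_le ?_)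
  have := h.card_le
  exact_mod_cast (by omega)

theorem NewtonInvariant.eq {n : ℕ} {x : ℕ → F} {j : ℕ} {f : ℕ → F} {B : Finset ℕ}
    {G W : ℕ → F} {a : F} {g p : F[X]} (h : NewtonInvariant n x j f B G W a g)
    (hx : Set.InjOn x (Finset.range n)) (hB : ∀ b ∈ B, b < n) (hcard : B.card = j + 1)
    (hp : p.natDegree ≤ j) (hf : ∀ s ∈ B, f s = p.eval (x s)) : g = p := by
  rw [← sub_eq_zero]
  refine eq_zero_of_degree_lt_of_eval_index_eq_zero B (v := x)
    (hx.mono fun b hb => by simpa using hB b hb) ?_ ?_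
  · refine (degree_sub_le _ _).trans_lt (max_lt h.degree_lt ?_)
    refine (degree_le_of_natDegree_le hp).trans_lt ?_
    rw [hcard]; exact_mod_cast j.lt_succ_self
  · intro s hs
    rw [eval_sub, h.interpolates s hs, hf s hs, sub_self]

end ReedSolomon

/-! ### The decoder for one strip

The memory is used as follows.  Natural numbers: `0`, `1`, `2` input; `3[i, t]` the `i`-th digit of
`t`; `4[0, k]` the number of points of the grid in the first `k` coordinates; `5` and `9` counters;
`6` the index of the current monomial; `7` its candidate position in the list; `8` the outcome of a
comparison; `10` the current coordinate; `11` the current strip; `12` a position; `13` a counter;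
`14` the symbol whose weight is the threshold; `15`, `16` symbols; `17[0, b]` weighted degrees;
`18`, `19` the rows for and against which a pivot is made; `20` the number of interpolation points;
`21` the degree; `22`, `23`, `24` counters.
Field elements: `0` input; `1` the received word minus the known terms; `2` output; `3[k, t]` the
word at level `k`; `4` the strip; `5[b, r]`, `6[b, r]` the rows of the error locator; `7` a scalar;
`8`, `9` the interpolating and the nodal polynomial; `10` its leading coefficient; `11` the decoded
coefficient; `12` a monomial.
Weights: `0` input; `1[k, t]` the weights at level `k`; `2` those of the strip; `3` a distance;
`4` the weight of the decoded coefficient. -/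

infixr:60 " ;; " => Block.seq

/-- The field element stored in the entry `[0, 0]`. -/
abbrev FExp.var (v : ℕ) : FExp := .get v (.lit 0) (.lit 0)

/-- The weight stored in the entry `[0, 0]`. -/
abbrev WExp.var (v : ℕ) : WExp := .get v (.lit 0) (.lit 0)

/-- The length of the current strip. -/
abbrev stripLength : NExp := .get 1 (.lit 0) (.var 10)

/-- The evaluation point with the given index in the current strip. -/
abbrev stripPoint (r : NExp) : FExp := .get 0 (.var 10) r

/-- The given symbol of the strip is not erased. -/
abbrev kept (s : NExp) : BExp := .not (.weightLt (.get 2 (.lit 0) (.var 14)) (.get 2 (.lit 0) s))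

/-- The other row is updated first, since it needs the old values of the pivot row. -/
def pivotPass : Block :=
  .setF 5 (.var 19) (.var 16)
    (.sub (.get 5 (.var 19) (.var 16)) (.mul (.var 7) (.get 5 (.var 18) (.var 16)))) ;;
  .setF 6 (.var 19) (.var 16)
    (.sub (.get 6 (.var 19) (.var 16)) (.mul (.var 7) (.get 6 (.var 18) (.var 16)))) ;;
  .setF 5 (.var 18) (.var 16)
    (.mul (.get 5 (.var 18) (.var 16)) (.sub (stripPoint (.var 16)) (stripPoint (.var 15)))) ;;
  .setF 6 (.var 18) (.var 16)
    (.mul (.get 6 (.var 18) (.var 16)) (.sub (stripPoint (.var 16)) (stripPoint (.var 15))))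

/-- The scalar is fixed before the loop, which overwrites the two discrepancies at the current
symbol. -/
def pivot : Block :=
  .setF 7 (.lit 0) (.lit 0)
    (.mul (.get 6 (.var 19) (.var 15)) (.inv (.get 6 (.var 18) (.var 15)))) ;;
  .loop 16 stripLength pivotPass ;;
  .setN 17 (.lit 0) (.var 18) (.add (.get 17 (.lit 0) (.var 18)) (.lit 1))

def pivotOn (p o : ℕ) : Block :=
  .setN 18 (.lit 0) (.lit 0) (.lit p) ;; .setN 19 (.lit 0) (.lit 0) (.lit o) ;; pivot

/-- The pivot is the row of smaller weighted degree among those not vanishing at the new point; ties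
go to row `0`, as the asymmetry of `pivot_zero` and `pivot_one` requires. -/
def locatorPass : Block :=
  .cond (kept (.var 15))
    (.cond (.and (.not (.fieldEq (.get 6 (.lit 0) (.var 15)) .zero))
        (.not (.and (.natLt (.get 17 (.lit 0) (.lit 1)) (.get 17 (.lit 0) (.lit 0)))
          (.not (.fieldEq (.get 6 (.lit 1) (.var 15)) .zero)))))
      (pivotOn 0 1)
      (.cond (.not (.fieldEq (.get 6 (.lit 1) (.var 15)) .zero)) (pivotOn 1 0) .skip))
    .skip

def locatorInitPass : Block :=
  .setF 5 (.lit 0) (.var 16) .zero ;; .setF 6 (.lit 0) (.var 16) .one ;;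
  .setF 5 (.lit 1) (.var 16) .one ;;
  .setF 6 (.lit 1) (.var 16) (.sub .zero (.get 4 (.lit 0) (.var 16)))

def locator : Block :=
  .setN 17 (.lit 0) (.lit 0) (.lit 0) ;; .setN 17 (.lit 0) (.lit 1) (.var 21) ;;
  .loop 16 stripLength locatorInitPass ;; .loop 15 stripLength locatorPass

def newtonUpdatePass : Block :=
  .setF 8 (.lit 0) (.var 16)
    (.add (.get 8 (.lit 0) (.var 16)) (.mul (.var 7) (.get 9 (.lit 0) (.var 16)))) ;;
  .setF 9 (.lit 0) (.var 16) (.mul (.get 9 (.lit 0) (.var 16))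
    (.sub (stripPoint (.var 16)) (stripPoint (.var 15))))

def newtonUpdate : Block :=
  .setF 7 (.lit 0) (.lit 0) (.mul (.sub (.get 4 (.lit 0) (.var 15)) (.get 8 (.lit 0) (.var 15)))
    (.inv (.get 9 (.lit 0) (.var 15)))) ;;
  .loop 16 stripLength newtonUpdatePass ;;
  .cond (.natEq (.var 20) (.var 21)) (.setF 10 (.lit 0) (.lit 0) (.var 7)) .skip ;;
  .setN 20 (.lit 0) (.lit 0) (.add (.var 20) (.lit 1))

def newtonPass : Block :=
  .cond (.and (kept (.var 15)) (.and (.not (.fieldEq (.get 5 (.lit 1) (.var 15)) .zero))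
      (.natLt (.var 20) (.add (.var 21) (.lit 1))))) newtonUpdate .skip

def newtonInitPass : Block :=
  .setF 8 (.lit 0) (.var 16) .zero ;; .setF 9 (.lit 0) (.var 16) .one

def newton : Block :=
  .setN 20 (.lit 0) (.lit 0) (.lit 0) ;; .setF 10 (.lit 0) (.lit 0) .zero ;;
  .loop 16 stripLength newtonInitPass ;; .loop 15 stripLength newtonPass

def scorePass : Block :=
  .cond (.fieldEq (.get 4 (.lit 0) (.var 15)) (.get 8 (.lit 0) (.var 15)))
    (.setW 3 (.lit 0) (.lit 0)
      (.add (.var 3) (.divNat (.get 2 (.lit 0) (.var 15)) (.lit 2))))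
    (.setW 3 (.lit 0) (.lit 0)
      (.add (.var 3) (.sub (.ofNat (.lit 1)) (.divNat (.get 2 (.lit 0) (.var 15)) (.lit 2)))))

def score : Block :=
  .setW 3 (.lit 0) (.lit 0) (.ofNat (.lit 0)) ;; .loop 15 stripLength scorePass

/-- Any candidate passing this test is a correct answer, so a later threshold may overwrite an
earlier result. -/
def record : Block :=
  .cond (.weightLt (.add (.var 3) (.var 3)) (.ofNat (.sub stripLength (.var 21))))
    (.setF 11 (.lit 0) (.lit 0) (.var 10) ;;
      .setW 4 (.lit 0) (.lit 0) (.divNat (.add (.var 3) (.var 3)) (.sub stripLength (.var 21))))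
    .skip

/-- The initial answer, `0` with weight `1`, is the erasure that stands if no threshold succeeds. -/
def strip : Block :=
  .setF 11 (.lit 0) (.lit 0) .zero ;; .setW 4 (.lit 0) (.lit 0) (.ofNat (.lit 1)) ;;
  .loop 14 stripLength (locator ;; newton ;; score ;; record)

/-! ### Correctness of the error locator -/

section

open Block

variable {F : Type u} [Field F]

/-- Pass `i` touches only column `i`, so a single column `r` can be followed through the loop. -/
theorem run_pivotLoop (σ : State F) {p o : ℕ} (hp : σ.nat 18 0 0 = p) (ho : σ.nat 19 0 0 = o)
    (hpo : p ≠ o) (r : ℕ) :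
    ((loop 16 stripLength pivotPass).run σ).fld 5 p r = (if r < σ.nat 1 0 (σ.nat 10 0 0) then
        σ.fld 5 p r * (σ.fld 0 (σ.nat 10 0 0) r - σ.fld 0 (σ.nat 10 0 0) (σ.nat 15 0 0))
        else σ.fld 5 p r) ∧
    ((loop 16 stripLength pivotPass).run σ).fld 6 p r = (if r < σ.nat 1 0 (σ.nat 10 0 0) then
        σ.fld 6 p r * (σ.fld 0 (σ.nat 10 0 0) r - σ.fld 0 (σ.nat 10 0 0) (σ.nat 15 0 0))
        else σ.fld 6 p r) ∧
    ((loop 16 stripLength pivotPass).run σ).fld 5 o r = (if r < σ.nat 1 0 (σ.nat 10 0 0) then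
        σ.fld 5 o r - σ.fld 7 0 0 * σ.fld 5 p r else σ.fld 5 o r) ∧
    ((loop 16 stripLength pivotPass).run σ).fld 6 o r = (if r < σ.nat 1 0 (σ.nat 10 0 0) then
        σ.fld 6 o r - σ.fld 7 0 0 * σ.fld 6 p r else σ.fld 6 o r) := by
  refine loop_induction (v := 16) (b := stripLength) (c := pivotPass) (σ := σ) (fun i τ =>
    τ.fld 5 p r = (if r < i then
        σ.fld 5 p r * (σ.fld 0 (σ.nat 10 0 0) r - σ.fld 0 (σ.nat 10 0 0) (σ.nat 15 0 0))
        else σ.fld 5 p r) ∧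
    τ.fld 6 p r = (if r < i then
        σ.fld 6 p r * (σ.fld 0 (σ.nat 10 0 0) r - σ.fld 0 (σ.nat 10 0 0) (σ.nat 15 0 0))
        else σ.fld 6 p r) ∧
    τ.fld 5 o r = (if r < i then
        σ.fld 5 o r - σ.fld 7 0 0 * σ.fld 5 p r else σ.fld 5 o r) ∧
    τ.fld 6 o r = (if r < i then
        σ.fld 6 o r - σ.fld 7 0 0 * σ.fld 6 p r else σ.fld 6 o r)) ?_ ?_
  · simp
  · intro i τ hi hF hv ⟨h1, h2, h3, h4⟩
    have e10 := hF.nat 10 (by decide)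
    have e15 := hF.nat 15 (by decide)
    have e18 := hF.nat 18 (by decide)
    have e19 := hF.nat 19 (by decide)
    have f7 := hF.fld 7 (by decide)
    have f0 := hF.fld 0 (by decide)
    by_cases hr : r = i
    · subst hr
      simp only [lt_irrefl, if_false] at h1 h2 h3 h4
      simp [pivotPass, NExp.eval, FExp.eval, write, e10, e15, e18, e19, f7, f0, hv, hp, ho,
        hpo, hpo.symm, h1, h2, h3, h4]
    · have : (r < i + 1) = (r < i) := by simp only [eq_iff_iff]; omega
      simp [pivotPass, NExp.eval, FExp.eval, write, e10, e15, e18, e19, f7, f0, hv, hp, ho,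
        hpo, hpo.symm, h1, h2, h3, h4, hr, this]

theorem run_pivotOn (σ : State F) {p o : ℕ} (hpo : p ≠ o) :
    ((pivotOn p o).run σ).nat 17 0 p = σ.nat 17 0 p + 1 ∧
    ((pivotOn p o).run σ).nat 17 0 o = σ.nat 17 0 o ∧
    ∀ r < σ.nat 1 0 (σ.nat 10 0 0),
      ((pivotOn p o).run σ).fld 5 p r = σ.fld 5 p r *
        (σ.fld 0 (σ.nat 10 0 0) r - σ.fld 0 (σ.nat 10 0 0) (σ.nat 15 0 0)) ∧
      ((pivotOn p o).run σ).fld 6 p r = σ.fld 6 p r *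
        (σ.fld 0 (σ.nat 10 0 0) r - σ.fld 0 (σ.nat 10 0 0) (σ.nat 15 0 0)) ∧
      ((pivotOn p o).run σ).fld 5 o r = σ.fld 5 o r -
        σ.fld 6 o (σ.nat 15 0 0) * (σ.fld 6 p (σ.nat 15 0 0))⁻¹ * σ.fld 5 p r ∧
      ((pivotOn p o).run σ).fld 6 o r = σ.fld 6 o r -
        σ.fld 6 o (σ.nat 15 0 0) * (σ.fld 6 p (σ.nat 15 0 0))⁻¹ * σ.fld 6 p r := by
  obtain ⟨σ₁, h₁⟩ : ∃ σ₁, σ₁ = (setN 18 (.lit 0) (.lit 0) (.lit p) ;;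
    setN 19 (.lit 0) (.lit 0) (.lit o) ;; setF 7 (.lit 0) (.lit 0)
    (.mul (.get 6 (.var 19) (.var 15)) (.inv (.get 6 (.var 18) (.var 15))))).run σ := ⟨_, rfl⟩
  have hrun : (pivotOn p o).run σ = (setN 17 (.lit 0) (.var 18)
      (.add (.get 17 (.lit 0) (.var 18)) (.lit 1))).run
        ((loop 16 stripLength pivotPass).run σ₁) := by
    rw [h₁]; rfl
  have hL := run_pivotLoop σ₁ (p := p) (o := o) (by simp [h₁, NExp.eval, write])
    (by simp [h₁, NExp.eval, write]) hpo
  have e17 := (frame_run (loop 16 stripLength pivotPass) σ₁).nat 17 (by decide)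
  have e18 := (frame_run (loop 16 stripLength pivotPass) σ₁).nat 18 (by decide)
  have g18 : σ₁.nat 18 0 0 = p := by simp [h₁, NExp.eval, write]
  have g17 : σ₁.nat 17 = σ.nat 17 := by
    funext i j; simp [h₁, NExp.eval, write]
  have g10 : σ₁.nat 10 0 0 = σ.nat 10 0 0 := by simp [h₁, NExp.eval, write]
  have g15 : σ₁.nat 15 0 0 = σ.nat 15 0 0 := by simp [h₁, NExp.eval, write]
  have g1 : σ₁.nat 1 = σ.nat 1 := by funext i j; simp [h₁, NExp.eval, write]
  have g0 : σ₁.fld 0 = σ.fld 0 := by funext i j; simp [h₁, NExp.eval, write]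
  have g5 : σ₁.fld 5 = σ.fld 5 := by funext i j; simp [h₁, NExp.eval, write]
  have g6 : σ₁.fld 6 = σ.fld 6 := by funext i j; simp [h₁, NExp.eval, write]
  have g7 : σ₁.fld 7 0 0 = σ.fld 6 o (σ.nat 15 0 0) * (σ.fld 6 p (σ.nat 15 0 0))⁻¹ := by
    simp [h₁, NExp.eval, FExp.eval, write]
  refine ⟨?_, ?_, fun r hr => ?_⟩
  · simp [hrun, NExp.eval, write, e17, e18, g17, g18]
  · simp [hrun, NExp.eval, write, e17, e18, g17, g18, hpo.symm]
  · have := hL r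
    rw [g1, g10, g0, g5, g6, g7, g15] at this
    simp only [if_pos hr] at this
    simpa only [hrun, run_setN] using this

/-- Some basis satisfies the invariant of the interpolation algorithm. -/
def HasLocator (n : ℕ) (x : ℕ → F) (j : ℕ) (f : ℕ → F) (A : Finset ℕ) (E R : ℕ → ℕ → F)
    (D : ℕ → ℕ) : Prop :=
  ∃ E₀ Q₀ E₁ Q₁, LocatorInvariant n x j f A E R D E₀ Q₀ E₁ Q₁

/-- The three branches are `pivot_zero`, `pivot_one` and `insert_of_zero`; an erased symbol leaves
the point set unchanged. -/
theorem run_locatorPass (σ : State F) {A : Finset ℕ} {x f : ℕ → F} {n j s : ℕ}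
    (hx : x = σ.fld 0 (σ.nat 10 0 0)) (hn : n = σ.nat 1 0 (σ.nat 10 0 0))
    (hs : s = σ.nat 15 0 0) (hsn : s < n) (hA : ∀ a ∈ A, a < s)
    (h : HasLocator n x j f A (σ.fld 5) (σ.fld 6) (σ.nat 17 0)) :
    HasLocator n x j f (if σ.wgt 2 0 (σ.nat 14 0 0) < σ.wgt 2 0 s then A else insert s A)
      ((locatorPass.run σ).fld 5) ((locatorPass.run σ).fld 6) ((locatorPass.run σ).nat 17 0) := by
  have hsA : s ∉ A := fun h => (hA s h).false
  have hAn : ∀ a ∈ A, a < n := fun a ha => (hA a ha).trans hsn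
  obtain ⟨E₀, Q₀, E₁, Q₁, h⟩ := h
  subst hs
  by_cases hw : σ.wgt 2 0 (σ.nat 14 0 0) < σ.wgt 2 0 (σ.nat 15 0 0)
  · rw [if_pos hw, locatorPass, run_cond_neg]
    swap
    · exact fun h' => h' hw
    exact ⟨_, _, _, _, h⟩
  rw [if_neg hw, locatorPass, run_cond_pos]
  swap
  · exact hw
  by_cases h1 : σ.fld 6 0 (σ.nat 15 0 0) ≠ 0 ∧
      ¬ (σ.nat 17 0 1 < σ.nat 17 0 0 ∧ σ.fld 6 1 (σ.nat 15 0 0) ≠ 0)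
  · rw [run_cond_pos]
    swap
    · exact h1
    obtain ⟨d0, d1, hp⟩ := run_pivotOn σ (p := 0) (o := 1) (by decide)
    rw [← hn, ← hx] at hp
    have hD : σ.nat 17 0 0 ≤ σ.nat 17 0 1 ∨ σ.fld 6 1 (σ.nat 15 0 0) = 0 := by
      by_cases h0 : σ.fld 6 1 (σ.nat 15 0 0) = 0
      · exact Or.inr h0
      · exact Or.inl (not_lt.1 fun hlt => h1.2 ⟨hlt, h0⟩)
    exact ⟨_, _, _, _, h.pivot_zero hAn hsn hsA h1.1 hD rfl (fun r hr => (hp r hr).2.2.1)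
      (fun r hr => (hp r hr).2.2.2) (fun r hr => (hp r hr).1) (fun r hr => (hp r hr).2.1) d0 d1⟩
  rw [run_cond_neg]
  swap
  · exact h1
  by_cases h2 : σ.fld 6 1 (σ.nat 15 0 0) = 0
  · rw [run_cond_neg]
    swap
    · exact fun h' => h' h2
    have h0 : σ.fld 6 0 (σ.nat 15 0 0) = 0 := by
      by_contra h0
      exact h1 ⟨h0, fun h' => h'.2 h2⟩
    exact ⟨_, _, _, _, h.insert_of_zero hsA h0 h2⟩
  · rw [run_cond_pos]
    swap
    · exact h2
    obtain ⟨d1, d0, hp⟩ := run_pivotOn σ (p := 1) (o := 0) (by decide)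
    rw [← hn, ← hx] at hp
    have hD : σ.nat 17 0 1 < σ.nat 17 0 0 ∨ σ.fld 6 0 (σ.nat 15 0 0) = 0 := by
      by_cases h0 : σ.fld 6 0 (σ.nat 15 0 0) = 0
      · exact Or.inr h0
      · exact Or.inl (not_le.1 fun hle => h1 ⟨h0, fun h' => (not_lt.2 hle) h'.1⟩)
    exact ⟨_, _, _, _, h.pivot_one hAn hsn hsA h2 hD rfl (fun r hr => (hp r hr).2.2.1)
      (fun r hr => (hp r hr).2.2.2) (fun r hr => (hp r hr).1) (fun r hr => (hp r hr).2.1) d1 d0⟩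

theorem run_locatorInit (σ : State F) (r : ℕ) (hr : r < σ.nat 1 0 (σ.nat 10 0 0)) :
    ((loop 16 stripLength locatorInitPass).run σ).fld 5 0 r = 0 ∧
    ((loop 16 stripLength locatorInitPass).run σ).fld 6 0 r = 1 ∧
    ((loop 16 stripLength locatorInitPass).run σ).fld 5 1 r = 1 ∧
    ((loop 16 stripLength locatorInitPass).run σ).fld 6 1 r = 0 - σ.fld 4 0 r := by
  refine loop_induction (v := 16) (b := stripLength) (c := locatorInitPass) (σ := σ) (fun i τ =>
    r < i → τ.fld 5 0 r = 0 ∧ τ.fld 6 0 r = 1 ∧ τ.fld 5 1 r = 1 ∧ τ.fld 6 1 r = 0 - σ.fld 4 0 r)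
    (by simp) ?_ hr
  intro i τ hi hF hv h hri
  have f4 := hF.fld 4 (by decide)
  by_cases hr' : r = i
  · subst hr'
    simp [locatorInitPass, NExp.eval, FExp.eval, write, f4, hv]
  · simpa [locatorInitPass, NExp.eval, FExp.eval, write, f4, hv, hr'] using h (by omega)

open Classical in
theorem run_locator (σ : State F) {x f : ℕ → F} {u : ℕ → ℝ} {n j : ℕ}
    (hx : x = σ.fld 0 (σ.nat 10 0 0)) (hn : n = σ.nat 1 0 (σ.nat 10 0 0)) (hf : f = σ.fld 4 0)
    (hu : u = σ.wgt 2 0) (hj : j = σ.nat 21 0 0) :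
    HasLocator n x j f ((Finset.range n).filter fun s => ¬ u (σ.nat 14 0 0) < u s)
      ((locator.run σ).fld 5) ((locator.run σ).fld 6) ((locator.run σ).nat 17 0) := by
  obtain ⟨σ₁, h₁⟩ : ∃ σ₁, σ₁ = (setN 17 (.lit 0) (.lit 0) (.lit 0) ;;
    setN 17 (.lit 0) (.lit 1) (.var 21)).run σ := ⟨_, rfl⟩
  obtain ⟨σ₂, h₂⟩ : ∃ σ₂, σ₂ = (loop 16 stripLength locatorInitPass).run σ₁ := ⟨_, rfl⟩
  have hrun : locator.run σ = (loop 15 stripLength locatorPass).run σ₂ := by rw [h₂, h₁]; rfl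
  have hF₁ := frame_run (setN 17 (.lit 0) (.lit 0) (.lit 0) ;;
    setN 17 (.lit 0) (.lit 1) (.var 21)) σ
  rw [← h₁] at hF₁
  have hF₂ := frame_run (loop 16 stripLength locatorInitPass) σ₁
  rw [← h₂] at hF₂
  have e10 : σ₂.nat 10 = σ.nat 10 := (hF₂.nat 10 (by decide)).trans (hF₁.nat 10 (by decide))
  have e14 : σ₂.nat 14 = σ.nat 14 := (hF₂.nat 14 (by decide)).trans (hF₁.nat 14 (by decide))
  have e1 : σ₂.nat 1 = σ.nat 1 := (hF₂.nat 1 (by decide)).trans (hF₁.nat 1 (by decide))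
  have f0 : σ₂.fld 0 = σ.fld 0 := (hF₂.fld 0 (by decide)).trans (hF₁.fld 0 (by decide))
  have w2 : σ₂.wgt 2 = σ.wgt 2 := (hF₂.wgt 2 (by decide)).trans (hF₁.wgt 2 (by decide))
  have hb : n = stripLength.eval σ₂ := by simp [NExp.eval, e1, e10, hn]
  rw [hrun]
  -- The invariant is indexed by the loop counter, so the goal must show the loop bound in the place
  -- of `n`.
  conv in Finset.range n => rw [hb]
  refine loop_induction (v := 15) (b := stripLength) (c := locatorPass) (σ := σ₂) (fun i τ =>
    HasLocator n x j f ((Finset.range i).filter fun s => ¬ u (σ.nat 14 0 0) < u s)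
      (τ.fld 5) (τ.fld 6) (τ.nat 17 0)) ?_ ?_
  · have hinit := run_locatorInit σ₁
    rw [← h₂, hF₁.nat 1 (by decide), hF₁.nat 10 (by decide), ← hn, hF₁.fld 4 (by decide), ← hf]
      at hinit
    have e17 := hF₂.nat 17 (by decide)
    refine ⟨_, _, _, _, locatorInvariant_init (fun r hr => (hinit r hr).1)
      (fun r hr => (hinit r hr).2.1) (fun r hr => (hinit r hr).2.2.1)
      (fun r hr => (hinit r hr).2.2.2) ?_ ?_⟩
    · simp [write, e17, h₁, NExp.eval]
    · simp [write, e17, h₁, NExp.eval, hj]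
  · intro i τ hi hF hv h
    have key := run_locatorPass τ (A := (Finset.range i).filter fun s => ¬ u (σ.nat 14 0 0) < u s)
      (x := x) (f := f) (n := n) (j := j) (s := i)
      (by rw [hF.fld 0 (by decide), hF.nat 10 (by decide), e10, f0, hx])
      (by rw [hF.nat 1 (by decide), hF.nat 10 (by decide), e10, e1, hn]) hv.symm
      (hb ▸ hi) (by simp +contextual) h
    rw [hF.wgt 2 (by decide), w2, ← hu, hF.nat 14 (by decide), e14] at key
    rw [Finset.range_add_one, Finset.filter_insert, ite_not]
    rw [State.setVar_nat, write_ne _ _ _ _ (by decide)]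
    exact key

end

/-! ### Correctness of interpolation, scoring and the strip decoder -/

section

open Block

variable {F : Type u} [Field F]

theorem run_newtonUpdateLoop (σ : State F) (r : ℕ) :
    ((loop 16 stripLength newtonUpdatePass).run σ).fld 8 0 r =
      (if r < σ.nat 1 0 (σ.nat 10 0 0) then σ.fld 8 0 r + σ.fld 7 0 0 * σ.fld 9 0 r
        else σ.fld 8 0 r) ∧
    ((loop 16 stripLength newtonUpdatePass).run σ).fld 9 0 r =
      (if r < σ.nat 1 0 (σ.nat 10 0 0) then σ.fld 9 0 r *
        (σ.fld 0 (σ.nat 10 0 0) r - σ.fld 0 (σ.nat 10 0 0) (σ.nat 15 0 0)) else σ.fld 9 0 r) := by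
  refine loop_induction (v := 16) (b := stripLength) (c := newtonUpdatePass) (σ := σ) (fun i τ =>
    τ.fld 8 0 r = (if r < i then σ.fld 8 0 r + σ.fld 7 0 0 * σ.fld 9 0 r else σ.fld 8 0 r) ∧
    τ.fld 9 0 r = (if r < i then σ.fld 9 0 r *
      (σ.fld 0 (σ.nat 10 0 0) r - σ.fld 0 (σ.nat 10 0 0) (σ.nat 15 0 0)) else σ.fld 9 0 r)) ?_ ?_
  · simp
  · intro i τ hi hF hv ⟨h1, h2⟩
    have e10 := hF.nat 10 (by decide)
    have e15 := hF.nat 15 (by decide)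
    have f7 := hF.fld 7 (by decide)
    have f0 := hF.fld 0 (by decide)
    by_cases hr : r = i
    · subst hr
      simp only [lt_irrefl, if_false] at h1 h2
      simp [newtonUpdatePass, NExp.eval, FExp.eval, write, e10, e15, f7, f0, hv, h1, h2]
    · have : (r < i + 1) = (r < i) := by simp only [eq_iff_iff]; omega
      simp [newtonUpdatePass, NExp.eval, FExp.eval, write, e10, e15, f7, f0, hv, h1, h2, hr, this]

theorem run_newtonUpdate (σ : State F) {c : F} (hc : c = (σ.fld 4 0 (σ.nat 15 0 0) -
      σ.fld 8 0 (σ.nat 15 0 0)) * (σ.fld 9 0 (σ.nat 15 0 0))⁻¹) :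
    (newtonUpdate.run σ).nat 20 0 0 = σ.nat 20 0 0 + 1 ∧
    (newtonUpdate.run σ).fld 10 0 0 =
      (if σ.nat 20 0 0 = σ.nat 21 0 0 then c else σ.fld 10 0 0) ∧
    ∀ r < σ.nat 1 0 (σ.nat 10 0 0),
      (newtonUpdate.run σ).fld 8 0 r = σ.fld 8 0 r + c * σ.fld 9 0 r ∧
      (newtonUpdate.run σ).fld 9 0 r = σ.fld 9 0 r *
        (σ.fld 0 (σ.nat 10 0 0) r - σ.fld 0 (σ.nat 10 0 0) (σ.nat 15 0 0)) := by
  obtain ⟨σ₁, h₁⟩ : ∃ σ₁, σ₁ = (setF 7 (.lit 0) (.lit 0)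
    (.mul (.sub (.get 4 (.lit 0) (.var 15)) (.get 8 (.lit 0) (.var 15)))
    (.inv (.get 9 (.lit 0) (.var 15))))).run σ := ⟨_, rfl⟩
  obtain ⟨σ₂, h₂⟩ : ∃ σ₂, σ₂ = (loop 16 stripLength newtonUpdatePass).run σ₁ := ⟨_, rfl⟩
  have hrun : newtonUpdate.run σ = (setN 20 (.lit 0) (.lit 0) (.add (.var 20) (.lit 1))).run
      ((cond (.natEq (.var 20) (.var 21)) (.setF 10 (.lit 0) (.lit 0) (.var 7)) .skip).run σ₂) := by
    rw [h₂, h₁]; rfl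
  have hL := run_newtonUpdateLoop σ₁
  have hF := frame_run (loop 16 stripLength newtonUpdatePass) σ₁
  rw [← h₂] at hF hL
  have e20 : σ₂.nat 20 = σ.nat 20 := (hF.nat 20 (by decide)).trans (by rw [h₁]; rfl)
  have e21 : σ₂.nat 21 = σ.nat 21 := (hF.nat 21 (by decide)).trans (by rw [h₁]; rfl)
  have f7 : σ₂.fld 7 0 0 = c := by
    rw [hF.fld 7 (by decide), h₁, hc]
    simp [NExp.eval, FExp.eval, write]
  have f10 : σ₂.fld 10 = σ.fld 10 := by
    rw [hF.fld 10 (by decide), h₁]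
    funext a b
    simp [write]
  have hσ₂ : ∀ r < σ.nat 1 0 (σ.nat 10 0 0),
      σ₂.fld 8 0 r = σ.fld 8 0 r + c * σ.fld 9 0 r ∧
      σ₂.fld 9 0 r = σ.fld 9 0 r *
        (σ.fld 0 (σ.nat 10 0 0) r - σ.fld 0 (σ.nat 10 0 0) (σ.nat 15 0 0)) := by
    intro r hr
    have := hL r
    simp only [h₁, run_setF] at this
    simp only [if_pos hr] at this
    simpa [NExp.eval, FExp.eval, write, hc] using this
  by_cases hj : σ.nat 20 0 0 = σ.nat 21 0 0
  · rw [hrun, run_cond_pos]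
    swap
    · simp [BExp.Holds, NExp.eval, e20, e21, hj]
    refine ⟨by simp [NExp.eval, write, e20], by simp [FExp.eval, NExp.eval, write, f7, hj],
      fun r hr => ?_⟩
    simpa [write] using hσ₂ r hr
  · rw [hrun, run_cond_neg]
    swap
    · simp [BExp.Holds, NExp.eval, e20, e21, hj]
    exact ⟨by simp [NExp.eval, write, e20], by simp [f10, hj], fun r hr => hσ₂ r hr⟩

theorem run_newtonInit (σ : State F) (r : ℕ) (hr : r < σ.nat 1 0 (σ.nat 10 0 0)) :
    ((loop 16 stripLength newtonInitPass).run σ).fld 8 0 r = 0 ∧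
    ((loop 16 stripLength newtonInitPass).run σ).fld 9 0 r = 1 := by
  refine loop_induction (v := 16) (b := stripLength) (c := newtonInitPass) (σ := σ) (fun i τ =>
    r < i → τ.fld 8 0 r = 0 ∧ τ.fld 9 0 r = 1) (by simp) ?_ hr
  intro i τ hi hF hv h hri
  by_cases hr' : r = i
  · subst hr'
    simp [newtonInitPass, NExp.eval, FExp.eval, write, hv]
  · simpa [newtonInitPass, NExp.eval, FExp.eval, write, hv, hr'] using h (by omega)

open Classical in
-- The points are taken greedily among the kept ones with nonzero locator value, up to `j + 1`. If
-- there are fewer, `g` is still some polynomial of degree at most `j`, which the score will judge.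
theorem run_newton (σ : State F) {x f e : ℕ → F} {u : ℕ → ℝ} {n j : ℕ}
    (hx : x = σ.fld 0 (σ.nat 10 0 0)) (hn : n = σ.nat 1 0 (σ.nat 10 0 0)) (hf : f = σ.fld 4 0)
    (hu : u = σ.wgt 2 0) (hj : j = σ.nat 21 0 0) (he : e = σ.fld 5 1)
    (hinj : Set.InjOn x (Finset.range n)) :
    ∃ B g, NewtonInvariant n x j f B ((newton.run σ).fld 8 0) ((newton.run σ).fld 9 0)
        ((newton.run σ).fld 10 0 0) g ∧
      B ⊆ (Finset.range n).filter (fun s => ¬ u (σ.nat 14 0 0) < u s ∧ e s ≠ 0) ∧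
      (B = (Finset.range n).filter (fun s => ¬ u (σ.nat 14 0 0) < u s ∧ e s ≠ 0) ∨
        B.card = j + 1) := by
  obtain ⟨σ₁, h₁⟩ : ∃ σ₁, σ₁ = (setN 20 (.lit 0) (.lit 0) (.lit 0) ;;
    setF 10 (.lit 0) (.lit 0) .zero).run σ := ⟨_, rfl⟩
  obtain ⟨σ₂, h₂⟩ : ∃ σ₂, σ₂ = (loop 16 stripLength newtonInitPass).run σ₁ := ⟨_, rfl⟩
  have hrun : newton.run σ = (loop 15 stripLength newtonPass).run σ₂ := by rw [h₂, h₁]; rfl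
  have hF₁ := frame_run (setN 20 (.lit 0) (.lit 0) (.lit 0) ;;
    setF 10 (.lit 0) (.lit 0) .zero) σ
  rw [← h₁] at hF₁
  have hF₂ := frame_run (loop 16 stripLength newtonInitPass) σ₁
  rw [← h₂] at hF₂
  have e10 : σ₂.nat 10 = σ.nat 10 := (hF₂.nat 10 (by decide)).trans (hF₁.nat 10 (by decide))
  have e14 : σ₂.nat 14 = σ.nat 14 := (hF₂.nat 14 (by decide)).trans (hF₁.nat 14 (by decide))
  have e21 : σ₂.nat 21 = σ.nat 21 := (hF₂.nat 21 (by decide)).trans (hF₁.nat 21 (by decide))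
  have e1 : σ₂.nat 1 = σ.nat 1 := (hF₂.nat 1 (by decide)).trans (hF₁.nat 1 (by decide))
  have f0 : σ₂.fld 0 = σ.fld 0 := (hF₂.fld 0 (by decide)).trans (hF₁.fld 0 (by decide))
  have f4 : σ₂.fld 4 = σ.fld 4 := (hF₂.fld 4 (by decide)).trans (hF₁.fld 4 (by decide))
  have f5 : σ₂.fld 5 = σ.fld 5 := (hF₂.fld 5 (by decide)).trans (hF₁.fld 5 (by decide))
  have w2 : σ₂.wgt 2 = σ.wgt 2 := (hF₂.wgt 2 (by decide)).trans (hF₁.wgt 2 (by decide))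
  have hb : n = stripLength.eval σ₂ := by simp [NExp.eval, e1, e10, hn]
  rw [hrun]
  -- The induction must also know that the counter holds the number of points taken.
  suffices h : ∃ B g, NewtonInvariant n x j f B
      (((loop 15 stripLength newtonPass).run σ₂).fld 8 0)
      (((loop 15 stripLength newtonPass).run σ₂).fld 9 0)
      (((loop 15 stripLength newtonPass).run σ₂).fld 10 0 0) g ∧
      ((loop 15 stripLength newtonPass).run σ₂).nat 20 0 0 = B.card ∧
      B ⊆ (Finset.range n).filter (fun s => ¬ u (σ.nat 14 0 0) < u s ∧ e s ≠ 0) ∧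
      (B = (Finset.range n).filter (fun s => ¬ u (σ.nat 14 0 0) < u s ∧ e s ≠ 0) ∨
        B.card = j + 1) by
    obtain ⟨B, g, h, -, h'⟩ := h
    exact ⟨B, g, h, h'⟩
  conv in (occs := *) Finset.range n => all_goals rw [hb]
  refine loop_induction (v := 15) (b := stripLength) (c := newtonPass) (σ := σ₂) (fun i τ =>
    ∃ B g, NewtonInvariant n x j f B (τ.fld 8 0) (τ.fld 9 0) (τ.fld 10 0 0) g ∧
      τ.nat 20 0 0 = B.card ∧
      B ⊆ (Finset.range i).filter (fun s => ¬ u (σ.nat 14 0 0) < u s ∧ e s ≠ 0) ∧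
      (B = (Finset.range i).filter (fun s => ¬ u (σ.nat 14 0 0) < u s ∧ e s ≠ 0) ∨
        B.card = j + 1)) ?_ ?_
  · have hinit := run_newtonInit σ₁
    rw [← h₂, hF₁.nat 1 (by decide), hF₁.nat 10 (by decide), ← hn] at hinit
    refine ⟨∅, 0, ?_, ?_, by simp, by simp⟩
    · rw [State.setVar_fld, hF₂.fld 10 (by decide), h₁]
      simpa [FExp.eval, NExp.eval, write] using newtonInvariant_init (j := j) (x := x) (f := f)
        (fun r hr => (hinit r hr).1) (fun r hr => (hinit r hr).2)
    · rw [State.setVar_nat, write_ne _ _ _ _ (by decide), hF₂.nat 20 (by decide), h₁]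
      simp [NExp.eval, write]
  · rintro i τ hi hF hv ⟨B, g, hN, hcnt, hsub, hmax⟩
    rw [← hb] at hi
    have d10 : τ.nat 10 = σ.nat 10 := (hF.nat 10 (by decide)).trans e10
    have d1 : τ.nat 1 = σ.nat 1 := (hF.nat 1 (by decide)).trans e1
    have d0 : τ.fld 0 = σ.fld 0 := (hF.fld 0 (by decide)).trans f0
    have d4 : τ.fld 4 0 = f := by rw [hF.fld 4 (by decide), f4, hf]
    have d5 : τ.fld 5 1 = e := by rw [hF.fld 5 (by decide), f5, he]
    have d21 : τ.nat 21 0 0 = j := by rw [hF.nat 21 (by decide), e21, hj]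
    have dw : τ.wgt 2 0 = u := by rw [hF.wgt 2 (by decide), w2, hu]
    have d14 : τ.nat 14 = σ.nat 14 := (hF.nat 14 (by decide)).trans e14
    have hBi : ∀ b ∈ B, b < i := fun b hb =>
      Finset.mem_range.1 (Finset.mem_filter.1 (hsub hb)).1
    simp only [State.setVar_nat, State.setVar_fld, write_ne _ _ _ _ (show 20 ≠ 15 by decide),
      Finset.range_add_one, Finset.filter_insert]
    by_cases hcond : (¬ u (σ.nat 14 0 0) < u i) ∧ e i ≠ 0 ∧ B.card < j + 1
    · rw [newtonPass, run_cond_pos]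
      swap
      · simp only [BExp.Holds, WExp.eval, NExp.eval, FExp.eval, hv, dw, d14, d5, d21, hcnt]
        exact hcond
      rw [if_pos ⟨hcond.1, hcond.2.1⟩]
      obtain ⟨k1, k2, k3⟩ := run_newtonUpdate τ rfl
      simp only [hv, d10, d1, d0, d4, d21, ← hx, ← hn, hcnt] at k1 k2 k3
      have hiB : i ∉ B := fun h => (hBi i h).false
      refine ⟨insert i B, _, hN.insert hinj (fun b hb => (hBi b hb).trans hi) hi hiB hcond.2.2
        rfl (fun r hr => (k3 r hr).1) (fun r hr => (k3 r hr).2) k2, ?_,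
        Finset.insert_subset_insert _ hsub, ?_⟩
      · rw [k1, Finset.card_insert_of_notMem hiB]
      · left
        rcases hmax with h | h
        · rw [h]
        · exact absurd h hcond.2.2.ne
    · rw [newtonPass, run_cond_neg]
      swap
      · simp only [BExp.Holds, WExp.eval, NExp.eval, FExp.eval, hv, dw, d14, d5, d21, hcnt]
        exact hcond
      refine ⟨B, g, hN, hcnt, ?_, ?_⟩
      · split_ifs
        · exact hsub.trans (Finset.subset_insert _ _)
        · exact hsub
      · by_cases hc : B.card = j + 1
        · exact Or.inr hc
        · have := hN.card_le
          rw [if_neg fun h => hcond ⟨h.1, h.2, by omega⟩]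
          exact hmax

theorem run_score (σ : State F) :
    (score.run σ).wgt 3 0 0 =
      wdist (σ.nat 1 0 (σ.nat 10 0 0)) (σ.fld 4 0) (σ.wgt 2 0) (σ.fld 8 0) := by
  obtain ⟨σ₁, h₁⟩ : ∃ σ₁, σ₁ = (setW 3 (.lit 0) (.lit 0) (.ofNat (.lit 0))).run σ := ⟨_, rfl⟩
  have hrun : score.run σ = (loop 15 stripLength scorePass).run σ₁ := by rw [h₁]; rfl
  have hF₁ := frame_run (setW 3 (.lit 0) (.lit 0) (.ofNat (.lit 0))) σ
  rw [← h₁] at hF₁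
  rw [hrun, ← hF₁.nat 1 (by decide), ← hF₁.nat 10 (by decide), ← hF₁.fld 4 (by decide),
    ← hF₁.fld 8 (by decide), ← hF₁.wgt 2 (by decide)]
  refine loop_induction (v := 15) (b := stripLength) (c := scorePass) (σ := σ₁) (fun i τ =>
    τ.wgt 3 0 0 = wdist i (σ₁.fld 4 0) (σ₁.wgt 2 0) (σ₁.fld 8 0)) ?_ ?_
  · simp [h₁, WExp.eval, NExp.eval, write, wdist]
  · intro i τ hi hF hv h
    have d4 := hF.fld 4 (by decide)
    have d8 := hF.fld 8 (by decide)
    have d2 := hF.wgt 2 (by decide)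
    rw [State.setVar_wgt, wdist, Finset.sum_range_succ, ← wdist, ← h]
    by_cases hc : σ₁.fld 4 0 i = σ₁.fld 8 0 i
    · rw [scorePass, run_cond_pos, if_pos hc]
      · simp [WExp.eval, NExp.eval, write, d2, hv]
      · simp [BExp.Holds, FExp.eval, NExp.eval, d4, d8, hv, hc]
    · rw [scorePass, run_cond_neg, if_neg hc]
      · simp [WExp.eval, NExp.eval, write, d2, hv]
      · simp [BExp.Holds, FExp.eval, NExp.eval, d4, d8, hv, hc]

open Classical in
/-- One threshold: a coefficient that is already decoded stays decoded, and a polynomial that is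
close for this threshold is found. -/
theorem run_threshold (σ : State F) {x f : ℕ → F} {u : ℕ → ℝ} {n j : ℕ}
    (hx : x = σ.fld 0 (σ.nat 10 0 0)) (hn : n = σ.nat 1 0 (σ.nat 10 0 0)) (hf : f = σ.fld 4 0)
    (hu : u = σ.wgt 2 0) (hj : j = σ.nat 21 0 0) (hjn : j < n)
    (hinj : Set.InjOn x (Finset.range n)) :
    let τ := (locator ;; newton ;; score ;; record).run σ
    IsDecoded n x j f u (τ.fld 11 0 0) (τ.wgt 4 0 0) ∨
    (τ.fld 11 0 0 = σ.fld 11 0 0 ∧ τ.wgt 4 0 0 = σ.wgt 4 0 0 ∧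
      ∀ p : Polynomial F, p.natDegree ≤ j →
        wdist n f u (fun s => p.eval (x s)) + wdist n f u (fun s => p.eval (x s)) < (n : ℝ) - j →
        ¬ 2 * ((Finset.range n).filter fun s => ¬ u (σ.nat 14 0 0) < u s ∧
            f s ≠ p.eval (x s)).card + j <
          ((Finset.range n).filter fun s => ¬ u (σ.nat 14 0 0) < u s).card) := by
  intro τ
  obtain ⟨σ₁, h₁⟩ : ∃ σ₁, σ₁ = locator.run σ := ⟨_, rfl⟩
  obtain ⟨σ₂, h₂⟩ : ∃ σ₂, σ₂ = newton.run σ₁ := ⟨_, rfl⟩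
  obtain ⟨σ₃, h₃⟩ : ∃ σ₃, σ₃ = score.run σ₂ := ⟨_, rfl⟩
  have hτ : τ = record.run σ₃ := by rw [h₃, h₂, h₁]; rfl
  have hF₁ : locator.Frame σ σ₁ := h₁ ▸ frame_run _ _
  have hF₂ : newton.Frame σ₁ σ₂ := h₂ ▸ frame_run _ _
  have hF₃ : score.Frame σ₂ σ₃ := h₃ ▸ frame_run _ _
  obtain ⟨E₀, Q₀, E₁, Q₁, hL⟩ := run_locator σ hx hn hf hu hj
  rw [← h₁] at hL
  obtain ⟨B, g, hN, hsub, hmax⟩ := run_newton σ₁ (x := x) (n := n) (f := f) (u := u) (j := j)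
    (by rw [hF₁.fld 0 (by decide), hF₁.nat 10 (by decide), hx])
    (by rw [hF₁.nat 1 (by decide), hF₁.nat 10 (by decide), hn])
    (by rw [hF₁.fld 4 (by decide), hf]) (by rw [hF₁.wgt 2 (by decide), hu])
    (by rw [hF₁.nat 21 (by decide), hj]) rfl hinj
  rw [← h₂] at hN
  rw [hF₁.nat 14 (by decide)] at hsub hmax
  have hΔ : σ₃.wgt 3 0 0 = wdist n f u (fun s => g.eval (x s)) := by
    rw [h₃, run_score, hF₂.nat 1 (by decide), hF₂.nat 10 (by decide), hF₂.fld 4 (by decide),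
      hF₂.wgt 2 (by decide), hF₁.nat 1 (by decide), hF₁.nat 10 (by decide), hF₁.fld 4 (by decide),
      hF₁.wgt 2 (by decide), ← hn, ← hf, ← hu]
    exact wdist_congr (fun _ _ => rfl) (fun _ _ => rfl) hN.eval_G
  have d1 : σ₃.nat 1 0 (σ₃.nat 10 0 0) = n := by
    rw [hF₃.nat 1 (by decide), hF₃.nat 10 (by decide), hF₂.nat 1 (by decide),
      hF₂.nat 10 (by decide), hF₁.nat 1 (by decide), hF₁.nat 10 (by decide), hn]
  have d21 : σ₃.nat 21 0 0 = j := by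
    rw [hF₃.nat 21 (by decide), hF₂.nat 21 (by decide), hF₁.nat 21 (by decide), hj]
  have hcast : ((n - j : ℕ) : ℝ) = (n : ℝ) - j := Nat.cast_sub hjn.le
  by_cases hlt : wdist n f u (fun s => g.eval (x s)) + wdist n f u (fun s => g.eval (x s)) <
      (n : ℝ) - j
  · left
    rw [hτ, record, run_cond_pos]
    swap
    · simp [BExp.Holds, WExp.eval, NExp.eval, d1, d21, hcast, hΔ, hlt]
    refine ⟨g, hN.natDegree_le, hlt, ?_, ?_⟩
    · rw [← hN.coeff_eq, ← hF₃.fld 10 (by decide)]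
      simp [FExp.eval, NExp.eval, write]
    · simp [WExp.eval, NExp.eval, write, d1, d21, hcast, hΔ]
  · right
    rw [hτ, record, run_cond_neg]
    swap
    · simp [BExp.Holds, WExp.eval, NExp.eval, d1, d21, hcast, hΔ, not_lt.1 hlt]
    refine ⟨?_, ?_, fun p hp hpd herr => ?_⟩
    · rw [run_skip, hF₃.fld 11 (by decide), hF₂.fld 11 (by decide), hF₁.fld 11 (by decide)]
    · rw [run_skip, hF₃.wgt 4 (by decide), hF₂.wgt 4 (by decide), hF₁.wgt 4 (by decide)]
    -- A good threshold supplies `j + 1` correct points, so the interpolating polynomial is `p` and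
    -- could not have failed the test.
    · obtain ⟨hcard, hfp⟩ := hL.locates hinj (by simp +contextual) hp
        (by rwa [Finset.filter_filter])
      rw [Finset.filter_filter] at hcard
      have hBn : ∀ b ∈ B, b < n := fun b hb =>
        Finset.mem_range.1 (Finset.mem_filter.1 (hsub hb)).1
      have hBc : B.card = j + 1 := by
        rcases hmax with h | h
        · exact le_antisymm hN.card_le (h ▸ hcard)
        · exact h
      have hgp : g = p := hN.eq hinj hBn hBc hp fun s hs => by
        have := Finset.mem_filter.1 (hsub hs)
        exact hfp s (Finset.mem_filter.2 ⟨this.1, this.2.1⟩) this.2.2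
      exact hlt (hgp ▸ hpd)

/-- After all thresholds, either some candidate was recorded, or every threshold failed for every
close polynomial. In the second case `exists_threshold` shows that there is no close polynomial, and
the initial erasure is a valid answer. -/
theorem run_strip (σ : State F) {x f : ℕ → F} {u : ℕ → ℝ} {n j : ℕ}
    (hx : x = σ.fld 0 (σ.nat 10 0 0)) (hn : n = σ.nat 1 0 (σ.nat 10 0 0)) (hf : f = σ.fld 4 0)
    (hu : u = σ.wgt 2 0) (hj : j = σ.nat 21 0 0) (hjn : j < n)
    (hinj : Set.InjOn x (Finset.range n)) (hu0 : ∀ s < n, 0 ≤ u s) (hu1 : ∀ s < n, u s ≤ 1) :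
    IsStripDecoding n x j f u ((strip.run σ).fld 11 0 0) ((strip.run σ).wgt 4 0 0) := by
  classical
  obtain ⟨σ₁, h₁⟩ : ∃ σ₁, σ₁ = (setF 11 (.lit 0) (.lit 0) .zero ;;
    setW 4 (.lit 0) (.lit 0) (.ofNat (.lit 1))).run σ := ⟨_, rfl⟩
  have hrun : strip.run σ =
      (loop 14 stripLength (locator ;; newton ;; score ;; record)).run σ₁ := by rw [h₁]; rfl
  have hF₁ := frame_run (setF 11 (.lit 0) (.lit 0) .zero ;;
    setW 4 (.lit 0) (.lit 0) (.ofNat (.lit 1))) σ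
  rw [← h₁] at hF₁
  have hb : n = stripLength.eval σ₁ := by
    simp only [NExp.eval]
    rw [hF₁.nat 1 (by decide), hF₁.nat 10 (by decide), hn]
  have key : IsDecoded n x j f u ((strip.run σ).fld 11 0 0) ((strip.run σ).wgt 4 0 0) ∨
      ((strip.run σ).fld 11 0 0 = 0 ∧ (strip.run σ).wgt 4 0 0 = 1 ∧
      ∀ s₀ < stripLength.eval σ₁, ∀ p : Polynomial F, p.natDegree ≤ j →
        wdist n f u (fun s => p.eval (x s)) + wdist n f u (fun s => p.eval (x s)) < (n : ℝ) - j →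
        ¬ 2 * ((Finset.range n).filter fun s => ¬ u s₀ < u s ∧
            f s ≠ p.eval (x s)).card + j <
          ((Finset.range n).filter fun s => ¬ u s₀ < u s).card) := by
    rw [hrun]
    refine loop_induction (v := 14) (b := stripLength)
      (c := locator ;; newton ;; score ;; record) (σ := σ₁) (fun i τ =>
      IsDecoded n x j f u (τ.fld 11 0 0) (τ.wgt 4 0 0) ∨
      (τ.fld 11 0 0 = 0 ∧ τ.wgt 4 0 0 = 1 ∧
      ∀ s₀ < i, ∀ p : Polynomial F, p.natDegree ≤ j →
        wdist n f u (fun s => p.eval (x s)) + wdist n f u (fun s => p.eval (x s)) < (n : ℝ) - j →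
        ¬ 2 * ((Finset.range n).filter fun s => ¬ u s₀ < u s ∧
            f s ≠ p.eval (x s)).card + j <
          ((Finset.range n).filter fun s => ¬ u s₀ < u s).card)) ?_ ?_
    · right
      simp [h₁, FExp.eval, WExp.eval, NExp.eval, write]
    · intro i τ hi hF hv h
      have ht := run_threshold τ (x := x) (n := n) (f := f) (u := u) (j := j)
        (by rw [hF.fld 0 (by decide), hF.nat 10 (by decide), hF₁.fld 0 (by decide),
          hF₁.nat 10 (by decide), hx])
        (by rw [hF.nat 1 (by decide), hF.nat 10 (by decide), hF₁.nat 1 (by decide),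
          hF₁.nat 10 (by decide), hn])
        (by rw [hF.fld 4 (by decide), hF₁.fld 4 (by decide), hf])
        (by rw [hF.wgt 2 (by decide), hF₁.wgt 2 (by decide), hu])
        (by rw [hF.nat 21 (by decide), hF₁.nat 21 (by decide), hj]) hjn hinj
      rw [hv] at ht
      rcases ht with ht | ⟨hg, hw, ht⟩
      · exact Or.inl ht
      rcases h with h | ⟨h0, h1, h⟩
      · left
        simpa only [State.setVar_fld, State.setVar_wgt, hg, hw] using h
      · right
        refine ⟨hg.trans h0, hw.trans h1, fun s₀ hs₀ => ?_⟩
        rcases (Nat.lt_succ_iff_lt_or_eq.1 hs₀) with hs | rfl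
        exacts [h s₀ hs, ht]
  rcases key with h | ⟨hg, hw, h⟩
  · exact h.isStripDecoding hinj hjn hu0 hu1
  · rw [hg, hw]
    refine isStripDecoding_erasure hjn fun p hp => ?_
    by_contra! hlt
    obtain ⟨s₀, hs₀, herr⟩ := exists_threshold hu0 hu1 hlt
    exact h s₀ (hb ▸ hs₀) p hp hlt herr

end

/-! ### Peeling off one coordinate -/

section Levels

open Polynomial

/-- The number of points of the grid in the first `k` coordinates. -/
def gridCard (n : ℕ → ℕ) (k : ℕ) : ℕ := ∏ i ∈ Finset.range k, n i

/-- The `i`-th digit of `t` in the mixed radix system with bases `n 0, n 1, …`. -/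
def digit (n : ℕ → ℕ) (i t : ℕ) : ℕ := t / gridCard n i % n i

@[simp] theorem gridCard_zero (n : ℕ → ℕ) : gridCard n 0 = 1 := rfl

theorem gridCard_succ (n : ℕ → ℕ) (k : ℕ) : gridCard n (k + 1) = gridCard n k * n k :=
  Finset.prod_range_succ _ _

theorem gridCard_pos {n : ℕ → ℕ} {k : ℕ} (hn : ∀ i < k, 0 < n i) : 0 < gridCard n k :=
  Finset.prod_pos fun i hi => hn i (Finset.mem_range.1 hi)

theorem gridCard_dvd (n : ℕ → ℕ) {i k : ℕ} (h : i ≤ k) : gridCard n i ∣ gridCard n k :=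
  Finset.prod_dvd_prod_of_subset _ _ _ (Finset.range_mono h)

theorem gridCard_le {n : ℕ → ℕ} {i k : ℕ} (hn : ∀ i < k, 0 < n i) (h : i ≤ k) :
    gridCard n i ≤ gridCard n k :=
  Nat.le_of_dvd (gridCard_pos hn) (gridCard_dvd n h)

theorem digit_lt {n : ℕ → ℕ} {i : ℕ} (hn : 0 < n i) (t : ℕ) : digit n i t < n i := Nat.mod_lt _ hn

theorem digit_add_mul {n : ℕ → ℕ} {i k : ℕ} (h : i < k) (hn : ∀ i < k, 0 < n i) (t s : ℕ) :
    digit n i (t + gridCard n k * s) = digit n i t := by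
  obtain ⟨c, hc⟩ := gridCard_dvd n (Nat.succ_le_of_lt h)
  have hpos := gridCard_pos fun l hl => hn l (hl.trans h)
  rw [digit, digit, hc, gridCard_succ, mul_assoc, mul_assoc, Nat.add_mul_div_left _ _ hpos,
    Nat.add_mul_mod_self_left]

theorem digit_top {n : ℕ → ℕ} {k t s : ℕ} (ht : t < gridCard n k) (hs : s < n k) :
    digit n k (t + gridCard n k * s) = s := by
  rw [digit, Nat.add_mul_div_left _ _ (by omega), Nat.div_eq_of_lt ht, zero_add,
    Nat.mod_eq_of_lt hs]

theorem digit_eq_mod_div (n : ℕ → ℕ) (k a : ℕ) :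
    digit n k a = a % gridCard n (k + 1) / gridCard n k := by
  rw [digit, gridCard_succ, Nat.mod_mul_right_div_self]

theorem add_mul_lt_gridCard {n : ℕ → ℕ} {k t s : ℕ} (ht : t < gridCard n k) (hs : s < n k) :
    t + gridCard n k * s < gridCard n (k + 1) := by
  rw [gridCard_succ]
  calc t + gridCard n k * s < gridCard n k + gridCard n k * s := by omega
    _ = gridCard n k * (s + 1) := by ring
    _ ≤ _ := Nat.mul_le_mul_left _ hs

theorem sum_range_mul {M : Type*} [AddCommMonoid M] (N n : ℕ) (g : ℕ → M) :
    ∑ b ∈ Finset.range (N * n), g b =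
      ∑ s ∈ Finset.range n, ∑ t ∈ Finset.range N, g (t + N * s) := by
  induction n with
  | zero => simp
  | succ n ih =>
    rw [Nat.mul_succ, Finset.sum_range_add, ih, Finset.sum_range_succ]
    simp_rw [add_comm]

variable {F : Type u} [Field F]

/-- The monomial with index `b` at the point with index `t`, in the first `k` variables. -/
def gridMonomial (n : ℕ → ℕ) (x : ℕ → ℕ → F) (k b t : ℕ) : F :=
  ∏ i ∈ Finset.range k, x i (digit n i t) ^ digit n i b

/-- The value of the polynomial with coefficients `c` at the point with index `t`. -/
def gridEval (n : ℕ → ℕ) (x : ℕ → ℕ → F) (k : ℕ) (c : ℕ → F) (t : ℕ) : F :=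
  ∑ b ∈ Finset.range (gridCard n k), c b * gridMonomial n x k b t

/-- The top digit of a point selects the value of the last variable, the top digit of a monomial its
exponent. -/
theorem gridEval_succ {n : ℕ → ℕ} (x : ℕ → ℕ → F) {k t s : ℕ} (hn : ∀ i < k, 0 < n i) (c : ℕ → F)
    (ht : t < gridCard n k) (hs : s < n k) :
    gridEval n x (k + 1) c (t + gridCard n k * s) = ∑ j ∈ Finset.range (n k),
      gridEval n x k (fun b => c (b + gridCard n k * j)) t * x k s ^ j := by
  rw [gridEval, gridCard_succ, sum_range_mul]
  refine Finset.sum_congr rfl fun j hj => ?_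
  rw [gridEval, Finset.sum_mul]
  refine Finset.sum_congr rfl fun b hb => ?_
  rw [Finset.mem_range] at hj hb
  rw [mul_assoc, gridMonomial, Finset.prod_range_succ, digit_top ht hs, digit_top hb hj,
    gridMonomial]
  congr 2
  refine Finset.prod_congr rfl fun i hi => ?_
  rw [Finset.mem_range] at hi
  rw [digit_add_mul hi hn, digit_add_mul hi hn]

theorem wdist_gridCard_succ (n : ℕ → ℕ) (k : ℕ) (f g : ℕ → F) (u : ℕ → ℝ) :
    wdist (gridCard n (k + 1)) f u g = ∑ t ∈ Finset.range (gridCard n k),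
      wdist (n k) (fun s => f (t + gridCard n k * s)) (fun s => u (t + gridCard n k * s))
        fun s => g (t + gridCard n k * s) := by
  simp only [wdist]
  rw [gridCard_succ, sum_range_mul, Finset.sum_comm]

/-- On the strip over `t` the codeword is a polynomial of degree at most `j`, since a monomial with
larger top digit has index above `a`. Its coefficient of `X ^ j` is the value at `t` of the
lower-dimensional polynomial, so the strip bounds can be added up. -/
theorem wdist_le_of_isStripDecoding {n : ℕ → ℕ} {x : ℕ → ℕ → F} {k j a : ℕ} {f f' c : ℕ → F}
    {u u' : ℕ → ℝ} (hn : ∀ i < k, 0 < n i) (hj : j < n k) (haj : a / gridCard n k = j)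
    (hc : ∀ b < gridCard n (k + 1), a < b → c b = 0)
    (hdec : ∀ t < gridCard n k, IsStripDecoding (n k) (x k) j
      (fun s => f (t + gridCard n k * s)) (fun s => u (t + gridCard n k * s)) (f' t) (u' t)) :
    wdist (gridCard n k) f' u' (gridEval n x k fun b => c (b + gridCard n k * j)) ≤
      wdist (gridCard n (k + 1)) f u (gridEval n x (k + 1) c) / ((n k : ℝ) - j) := by
  rw [wdist_gridCard_succ, Finset.sum_div]
  refine Finset.sum_le_sum fun t ht => ?_
  rw [Finset.mem_range] at ht
  set g : ℕ → F := fun i => gridEval n x k (fun b => c (b + gridCard n k * i)) t with hg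
  have hzero : ∀ i < n k, j < i → g i = 0 := fun i hi hji => by
    refine Finset.sum_eq_zero fun b hb => ?_
    rw [Finset.mem_range] at hb
    dsimp only
    rw [hc _ (add_mul_lt_gridCard hb hi) ?_, zero_mul]
    have h1 := Nat.lt_mul_div_succ a (show 0 < gridCard n k by omega)
    rw [haj] at h1
    have h2 : gridCard n k * (j + 1) ≤ gridCard n k * i := Nat.mul_le_mul_left _ hji
    omega
  have hcoeff : (∑ i ∈ Finset.range (j + 1), C (g i) * X ^ i).coeff j = g j := by
    simp [finsetSum_coeff, coeff_C_mul, coeff_X_pow]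
  have hdeg : (∑ i ∈ Finset.range (j + 1), C (g i) * X ^ i).natDegree ≤ j := by
    refine natDegree_sum_le_of_forall_le _ _ fun i hi => ?_
    exact (natDegree_C_mul_X_pow_le _ _).trans (Nat.lt_succ_iff.1 (Finset.mem_range.1 hi))
  have heval : wdist (n k) (fun s => f (t + gridCard n k * s)) (fun s => u (t + gridCard n k * s))
      (fun s => gridEval n x (k + 1) c (t + gridCard n k * s)) =
      wdist (n k) (fun s => f (t + gridCard n k * s)) (fun s => u (t + gridCard n k * s))
      (fun s => (∑ i ∈ Finset.range (j + 1), C (g i) * X ^ i).eval (x k s)) := by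
    refine wdist_congr (fun _ _ => rfl) (fun _ _ => rfl) fun s hs => ?_
    rw [gridEval_succ x hn c ht hs, eval_finsetSum]
    simp only [eval_mul, eval_C, eval_pow, eval_X]
    symm
    refine Finset.sum_subset (fun i hi => ?_) fun i hi hi' => ?_
    · simp only [Finset.mem_range] at hi ⊢; omega
    · simp only [Finset.mem_range] at hi hi'
      change g i * _ = 0
      rw [hzero i hi (by omega), zero_mul]
  rw [heval]
  split_ifs with h
  · exact (hdec t ht).of_eq _ hdeg (h.trans hcoeff.symm)
  · exact (hdec t ht).of_ne _ hdeg fun h' => h (h'.trans hcoeff)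

/-- The decoding condition is inherited by the word of leading coefficients. -/
theorem wdist_lt_of_isStripDecoding {n : ℕ → ℕ} {x : ℕ → ℕ → F} {k a : ℕ} {f f' c : ℕ → F}
    {u u' : ℕ → ℝ} (hn : ∀ i < k + 1, 0 < n i) (hc : ∀ b, a < b → c b = 0)
    (hdec : ∀ t < gridCard n k, IsStripDecoding (n k) (x k) (digit n k a)
      (fun s => f (t + gridCard n k * s)) (fun s => u (t + gridCard n k * s)) (f' t) (u' t))
    (h : wdist (gridCard n (k + 1)) f u
        (gridEval n x (k + 1) fun b => c (b + gridCard n (k + 1) * (a / gridCard n (k + 1)))) <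
      (∏ i ∈ Finset.range (k + 1), ((n i : ℝ) - digit n i a)) / 2) :
    wdist (gridCard n k) f' u' (gridEval n x k fun b => c (b + gridCard n k * (a / gridCard n k))) <
      (∏ i ∈ Finset.range k, ((n i : ℝ) - digit n i a)) / 2 := by
  have hn' : ∀ i < k, 0 < n i := fun i hi => hn i (by omega)
  have hlt := digit_lt (hn k (by omega)) a
  have hpos : (0 : ℝ) < (n k : ℝ) - digit n k a := by
    have : (digit n k a : ℝ) < n k := by exact_mod_cast hlt
    linarith
  -- Only the block of coefficients sharing the higher digits of `a` is left. Within it, the last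
  -- index that can carry a nonzero coefficient is `a % gridCard n (k + 1)`, whose top digit is
  -- `digit n k a`.
  have key := wdist_le_of_isStripDecoding (x := x) (a := a % gridCard n (k + 1))
    (c := fun b => c (b + gridCard n (k + 1) * (a / gridCard n (k + 1)))) hn' hlt
    (digit_eq_mod_div n k a).symm (fun b _ hb => hc _ (by
      have := Nat.mod_add_div a (gridCard n (k + 1)); omega)) hdec
  have hidx : gridCard n k * digit n k a + gridCard n (k + 1) * (a / gridCard n (k + 1)) =
      gridCard n k * (a / gridCard n k) := by
    rw [gridCard_succ, mul_assoc, ← mul_add, digit, ← Nat.div_div_eq_div_mul, Nat.mod_add_div]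
  simp only [add_assoc, hidx] at key
  refine key.trans_lt ?_
  rw [div_lt_iff₀ hpos]
  rw [Finset.prod_range_succ] at h
  linarith

/-- For a single point a wrong symbol costs `1 - u/2 ≥ 1/2`. -/
theorem eq_of_wdist_one_lt {n : ℕ → ℕ} {x : ℕ → ℕ → F} {f c : ℕ → F} {u : ℕ → ℝ} (hu1 : u 0 ≤ 1)
    (h : wdist 1 f u (gridEval n x 0 c) < 1 / 2) : f 0 = c 0 := by
  by_contra hne
  have : gridEval n x 0 c 0 = c 0 := by simp [gridEval, gridMonomial]
  rw [wdist, Finset.sum_range_one, this, if_neg hne] at h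
  linarith

end Levels

/-! ### The tables of digits -/

/-- The number of variables. -/
abbrev numVars : NExp := .get 0 (.lit 0) (.lit 0)

def copyDigitPass : Block :=
  .setN 3 (.var 22) (.add (.var 12) (.var 13)) (.get 3 (.var 22) (.var 13))

/-- There is no division on natural numbers, so the digits of `gridCard n k * s + t` are copied from
those of `t`, with the `k`-th replaced by `s`. -/
def digitPass : Block :=
  .loop 22 numVars copyDigitPass ;; .setN 3 (.var 5) (.add (.var 12) (.var 13)) (.var 9)

def digitBlock : Block :=
  .loop 13 (.get 4 (.lit 0) (.var 5)) digitPass ;;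
  .setN 12 (.lit 0) (.lit 0) (.add (.var 12) (.get 4 (.lit 0) (.var 5)))

/-- The running offset grows by `gridCard n k` in each of `n k` passes; its final value is the next
product, obtained without multiplication. -/
def tablePass : Block :=
  .setN 12 (.lit 0) (.lit 0) (.lit 0) ;; .loop 9 (.get 1 (.lit 0) (.var 5)) digitBlock ;;
  .setN 4 (.lit 0) (.add (.var 5) (.lit 1)) (.var 12)

def tables : Block :=
  .setN 4 (.lit 0) (.lit 0) (.lit 1) ;; .loop 5 numVars tablePass

/-! ### Correctness and running time of the tables -/

section

open Block

variable {F : Type u} [Field F]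

theorem digit_eq_zero {n : ℕ → ℕ} {i t : ℕ} (h : t < gridCard n i) : digit n i t = 0 := by
  rw [digit, Nat.div_eq_of_lt h, Nat.zero_mod]

/-- The digits of the indices satisfying `P` are tabulated. -/
def HasDigits (n : ℕ → ℕ) (m : ℕ) (P : ℕ → Prop) (τ : State F) : Prop :=
  ∀ b, P b → ∀ i < m, τ.nat 3 i b = digit n i b

theorem run_digitPass (τ : State F) {n : ℕ → ℕ} {m k s t : ℕ} {P : ℕ → Prop}
    (hn : ∀ i < m, 0 < n i) (hk : k < m) (hs : s < n k) (ht : t < gridCard n k)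
    (hm : τ.nat 0 0 0 = m) (h5 : τ.nat 5 0 0 = k) (h9 : τ.nat 9 0 0 = s)
    (h12 : τ.nat 12 0 0 = gridCard n k * s) (h13 : τ.nat 13 0 0 = t) (hP : P t)
    (h : HasDigits n m P τ) :
    HasDigits n m (fun b => P b ∨ b = gridCard n k * s + t) (digitPass.run τ) := by
  obtain ⟨τ₁, h₁⟩ : ∃ τ₁, τ₁ = (loop 22 numVars copyDigitPass).run τ := ⟨_, rfl⟩
  have hF₁ : (loop 22 numVars copyDigitPass).Frame τ τ₁ := h₁ ▸ frame_run _ _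
  have hdig : ∀ i < m, i ≠ k → digit n i t = digit n i (gridCard n k * s + t) := by
    intro i hi hik
    rw [add_comm]
    rcases lt_or_gt_of_ne hik with hlt | hgt
    · rw [digit_add_mul hlt fun i hi => hn i (hi.trans hk)]
    · have hle : gridCard n (k + 1) ≤ gridCard n i :=
        gridCard_le (fun l hl => hn l (hl.trans hi)) hgt
      have h2 := add_mul_lt_gridCard ht hs
      rw [digit_eq_zero (by omega), digit_eq_zero (by omega)]
  have key : ∀ i < m, (∀ b, P b → b ≠ gridCard n k * s + t → τ₁.nat 3 i b = digit n i b) ∧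
      (i ≠ k → τ₁.nat 3 i (gridCard n k * s + t) = digit n i (gridCard n k * s + t)) := by
    suffices hI : ∀ i < m,
        (∀ b, P b → b ≠ gridCard n k * s + t → τ₁.nat 3 i b = digit n i b) ∧
        (τ₁.nat 3 i t = digit n i t ∨ i = k) ∧ (i < numVars.eval τ → i ≠ k →
          τ₁.nat 3 i (gridCard n k * s + t) = digit n i (gridCard n k * s + t)) by
      exact fun i hi => ⟨(hI i hi).1, (hI i hi).2.2 (by simp [NExp.eval, hm, hi])⟩
    rw [h₁]
    refine loop_induction (v := 22) (b := numVars) (c := copyDigitPass) (σ := τ) (fun l ρ =>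
      ∀ i < m, (∀ b, P b → b ≠ gridCard n k * s + t → ρ.nat 3 i b = digit n i b) ∧
        (ρ.nat 3 i t = digit n i t ∨ i = k) ∧ (i < l → i ≠ k →
          ρ.nat 3 i (gridCard n k * s + t) = digit n i (gridCard n k * s + t))) ?_ ?_
    · intro i hi
      refine ⟨fun b hb _ => ?_, Or.inl ?_, by simp⟩
      · simpa [write] using h b hb i hi
      · simpa [write] using h t hP i hi
    · intro l ρ hl hF hv hρ i hi
      have e12 := hF.nat 12 (by decide)
      have e13 := hF.nat 13 (by decide)
      obtain ⟨p1, p2, p3⟩ := hρ i hi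
      refine ⟨fun b hb hne => ?_, ?_, fun hil hik => ?_⟩
      · simpa [copyDigitPass, NExp.eval, write, e12, e13, h12, h13, hv, hne] using p1 b hb hne
      · by_cases hik : i = k
        · exact Or.inr hik
        left
        have p2' := p2.resolve_right hik
        -- For `s = 0` source and target coincide, and the copy changes nothing.
        by_cases hc : i = l ∧ t = gridCard n k * s + t
        · obtain ⟨rfl, hc⟩ := hc
          simpa [copyDigitPass, NExp.eval, write, e12, e13, h12, h13, hv] using p2'
        · have hif : (copyDigitPass.run ρ).nat 3 i t =
              if i = l ∧ t = gridCard n k * s + t then ρ.nat 3 l t else ρ.nat 3 i t := by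
            simp [copyDigitPass, NExp.eval, write, e12, e13, h12, h13, hv]
          rw [State.setVar_nat, write_ne _ _ _ _ (by decide), hif, if_neg hc, p2']
      · have p2' := p2.resolve_right hik
        by_cases hc : i = l
        · subst hc
          simpa [copyDigitPass, NExp.eval, write, e12, e13, h12, h13, hv, p2'] using hdig i hi hik
        · simpa [copyDigitPass, NExp.eval, write, e12, e13, h12, h13, hv, hc] using
            p3 (by omega) hik
  have hrun : digitPass.run τ =
    (setN 3 (.var 5) (.add (.var 12) (.var 13)) (.var 9)).run τ₁ := by rw [h₁]; rfl
  have e5 := hF₁.nat 5 (by decide)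
  have e9 := hF₁.nat 9 (by decide)
  have e12 := hF₁.nat 12 (by decide)
  have e13 := hF₁.nat 13 (by decide)
  intro b hb i hi
  by_cases hbt : b = gridCard n k * s + t
  · subst hbt
    by_cases hik : i = k
    · subst hik
      rw [add_comm, digit_top ht hs, add_comm]
      simp [hrun, NExp.eval, write, e5, e9, e12, e13, h5, h9, h12, h13]
    · simpa [hrun, NExp.eval, write, e5, e9, e12, e13, h5, h9, h12, h13, hik] using
        (key i hi).2 hik
  · simpa [hrun, NExp.eval, write, e5, e9, e12, e13, h5, h9, h12, h13, hbt] using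
      (key i hi).1 b (hb.resolve_right hbt) hbt

theorem run_digitBlock (τ : State F) {n : ℕ → ℕ} {m k s : ℕ}
    (hn : ∀ i < m, 0 < n i) (hk : k < m) (hs : s < n k)
    (hm : τ.nat 0 0 0 = m) (h5 : τ.nat 5 0 0 = k) (h9 : τ.nat 9 0 0 = s)
    (h4 : τ.nat 4 0 k = gridCard n k) (h12 : τ.nat 12 0 0 = gridCard n k * s)
    (h : HasDigits n m (fun b => b < gridCard n k ∨ b < gridCard n k * s) τ) :
    HasDigits n m (fun b => b < gridCard n k ∨ b < gridCard n k * (s + 1)) (digitBlock.run τ) ∧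
      (digitBlock.run τ).nat 12 0 0 = gridCard n k * (s + 1) := by
  obtain ⟨τ₁, h₁⟩ : ∃ τ₁, τ₁ = (loop 13 (.get 4 (.lit 0) (.var 5)) digitPass).run τ := ⟨_, rfl⟩
  have hF₁ : (loop 13 (.get 4 (.lit 0) (.var 5)) digitPass).Frame τ τ₁ := h₁ ▸ frame_run _ _
  have hrun : digitBlock.run τ = (setN 12 (.lit 0) (.lit 0)
    (.add (.var 12) (.get 4 (.lit 0) (.var 5)))).run τ₁ := by rw [h₁]; rfl
  have hb : (NExp.get 4 (.lit 0) (.var 5)).eval τ = gridCard n k := by simp [NExp.eval, h5, h4]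
  constructor
  · have key : HasDigits n m (fun b => b < gridCard n k ∨
        b < gridCard n k * s + (NExp.get 4 (.lit 0) (.var 5)).eval τ) τ₁ := by
      rw [h₁]
      refine loop_induction (v := 13) (b := .get 4 (.lit 0) (.var 5)) (c := digitPass) (σ := τ)
        (fun t ρ => HasDigits n m (fun b => b < gridCard n k ∨ b < gridCard n k * s + t) ρ) ?_ ?_
      · intro b hb i hi
        simpa [write] using h b hb i hi
      · intro t ρ ht hF hv hρ
        rw [hb] at ht
        have := run_digitPass ρ hn hk hs ht (by rw [hF.nat 0 (by decide), hm])
          (by rw [hF.nat 5 (by decide), h5]) (by rw [hF.nat 9 (by decide), h9])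
          (by rw [hF.nat 12 (by decide), h12]) hv (Or.inl ht) hρ
        intro b hb i hi
        rw [State.setVar_nat, write_ne _ _ _ _ (by decide)]
        exact this b (by omega) i hi
    intro b hbb i hi
    rw [hb] at key
    rw [hrun, run_setN]
    simpa [write] using key b (by rwa [Nat.mul_succ] at hbb) i hi
  · rw [hrun]
    simp [NExp.eval, write, hF₁.nat 12 (by decide), hF₁.nat 4 (by decide), hF₁.nat 5 (by decide),
      h12, h5, h4, Nat.mul_succ]

/-- The tables contain the sizes and digits for the first `k` coordinates. -/
structure HasTables (n : ℕ → ℕ) (m k : ℕ) (τ : State F) : Prop where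
  card_eq : ∀ l ≤ k, τ.nat 4 0 l = gridCard n l
  card_zero : ∀ i l, i ≠ 0 ∨ k < l → τ.nat 4 i l = 0
  digit_eq : HasDigits n m (fun b => b < gridCard n k) τ

theorem run_tablePass (τ : State F) {n : ℕ → ℕ} {m k : ℕ} (hn : ∀ i < m, 0 < n i) (hk : k < m)
    (hm : τ.nat 0 0 0 = m) (h1 : τ.nat 1 0 = n) (h5 : τ.nat 5 0 0 = k) (h : HasTables n m k τ) :
    HasTables n m (k + 1) (tablePass.run τ) := by
  obtain ⟨τ₀, h₀⟩ : ∃ τ₀, τ₀ = (setN 12 (.lit 0) (.lit 0) (.lit 0)).run τ := ⟨_, rfl⟩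
  obtain ⟨τ₁, h₁⟩ : ∃ τ₁, τ₁ = (loop 9 (.get 1 (.lit 0) (.var 5)) digitBlock).run τ₀ := ⟨_, rfl⟩
  have hF₀ : (setN 12 (.lit 0) (.lit 0) (.lit 0)).Frame τ τ₀ := h₀ ▸ frame_run _ _
  have hF₁ : (loop 9 (.get 1 (.lit 0) (.var 5)) digitBlock).Frame τ₀ τ₁ := h₁ ▸ frame_run _ _
  have hrun : tablePass.run τ =
    (setN 4 (.lit 0) (.add (.var 5) (.lit 1)) (.var 12)).run τ₁ := by rw [h₁, h₀]; rfl
  have hb : (NExp.get 1 (.lit 0) (.var 5)).eval τ₀ = n k := by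
    simp only [NExp.eval]
    rw [hF₀.nat 5 (by decide), hF₀.nat 1 (by decide), h5, h1]
  have key : HasDigits n m (fun b => b < gridCard n k ∨
      b < gridCard n k * (NExp.get 1 (.lit 0) (.var 5)).eval τ₀) τ₁ ∧
      τ₁.nat 12 0 0 = gridCard n k * (NExp.get 1 (.lit 0) (.var 5)).eval τ₀ := by
    rw [h₁]
    refine loop_induction (v := 9) (b := .get 1 (.lit 0) (.var 5)) (c := digitBlock) (σ := τ₀)
      (fun s ρ => HasDigits n m (fun b => b < gridCard n k ∨ b < gridCard n k * s) ρ ∧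
        ρ.nat 12 0 0 = gridCard n k * s) ?_ ?_
    · refine ⟨fun b hb i hi => ?_, ?_⟩
      · rw [State.setVar_nat, write_ne _ _ _ _ (by decide), hF₀.nat 3 (by decide)]
        exact h.digit_eq b (by simpa using hb) i hi
      · simp [h₀, NExp.eval, write]
    · rintro s ρ hs hF hv ⟨hd, h12⟩
      rw [hb] at hs
      have := run_digitBlock ρ hn hk hs
        (by rw [hF.nat 0 (by decide), hF₀.nat 0 (by decide), hm])
        (by rw [hF.nat 5 (by decide), hF₀.nat 5 (by decide), h5]) hv
        (by rw [hF.nat 4 (by decide), hF₀.nat 4 (by decide), h.card_eq k le_rfl]) h12 hd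
      refine ⟨fun b hb i hi => ?_, ?_⟩
      · rw [State.setVar_nat, write_ne _ _ _ _ (by decide)]
        exact this.1 b hb i hi
      · rw [State.setVar_nat, write_ne _ _ _ _ (by decide)]
        exact this.2
  rw [hb, ← gridCard_succ] at key
  have e5 : τ₁.nat 5 0 0 = k := by rw [hF₁.nat 5 (by decide), hF₀.nat 5 (by decide), h5]
  have e4 : τ₁.nat 4 = τ.nat 4 := (hF₁.nat 4 (by decide)).trans (hF₀.nat 4 (by decide))
  refine ⟨fun l hl => ?_, fun i l hil => ?_, fun b hb i hi => ?_⟩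
  · by_cases hlk : l = k + 1
    · simp [hrun, NExp.eval, write, e5, hlk, key.2]
    · simpa [hrun, NExp.eval, write, e5, e4, hlk] using h.card_eq l (by omega)
  · have : ¬ (i = 0 ∧ l = k + 1) := by omega
    simpa [hrun, NExp.eval, write, e5, e4, this] using h.card_zero i l (by omega)
  · simpa [hrun, NExp.eval, write] using key.1 b (Or.inr hb) i hi

/-- Stated for every intermediate pass, because the running time needs the loop bounds met on the
way. -/
theorem hasTables_iterate (σ : State F) {n : ℕ → ℕ} {m : ℕ} (hn : ∀ i < m, 0 < n i)
    (hm : σ.nat 0 0 0 = m) (h1 : σ.nat 1 0 = n) (h3 : ∀ i j, σ.nat 3 i j = 0)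
    (h4 : ∀ i j, σ.nat 4 i j = 0) (k : ℕ) (hk : k ≤ m) :
    HasTables n m k
      (iterate 5 tablePass.run ((setN 4 (.lit 0) (.lit 0) (.lit 1)).run σ) k) := by
  have hb : numVars.eval ((setN 4 (.lit 0) (.lit 0) (.lit 1)).run σ) = m := by
    simp [NExp.eval, write, hm]
  refine iterate_induction (v := 5) (b := numVars) (c := tablePass)
    (σ := (setN 4 (.lit 0) (.lit 0) (.lit 1)).run σ) (fun k τ => HasTables n m k τ) ?_ ?_ k
    (hb.symm ▸ hk)
  · refine ⟨fun l hl => ?_, fun i l hil => ?_, fun b hb i hi => ?_⟩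
    · obtain rfl : l = 0 := by omega
      simp [NExp.eval, write]
    · have : ¬ (i = 0 ∧ l = 0) := by omega
      simp [NExp.eval, write, this, h4]
    · obtain rfl : b = 0 := by simpa using hb
      simp [NExp.eval, write, h3, digit]
  · intro i τ hi hF hv h
    rw [hb] at hi
    have hF₀ := frame_run (setN 4 (.lit 0) (.lit 0) (.lit 1)) σ
    have := run_tablePass τ hn hi (by rw [hF.nat 0 (by decide), hF₀.nat 0 (by decide), hm])
      (by rw [hF.nat 1 (by decide), hF₀.nat 1 (by decide), h1]) hv h
    refine ⟨fun l hl => ?_, fun i l hil => ?_, fun b hb i hi => ?_⟩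
    · simpa [write] using this.card_eq l hl
    · simpa [write] using this.card_zero i l hil
    · simpa [write] using this.digit_eq b hb i hi

theorem run_tables (σ : State F) {n : ℕ → ℕ} {m : ℕ} (hn : ∀ i < m, 0 < n i)
    (hm : σ.nat 0 0 0 = m) (h1 : σ.nat 1 0 = n) (h3 : ∀ i j, σ.nat 3 i j = 0)
    (h4 : ∀ i j, σ.nat 4 i j = 0) : HasTables n m m (tables.run σ) := by
  have h := hasTables_iterate σ hn hm h1 h3 h4 m le_rfl
  have hb : numVars.eval ((setN 4 (.lit 0) (.lit 0) (.lit 1)).run σ) = m := by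
    simp [NExp.eval, write, hm]
  have hrun : tables.run σ = iterate 5 tablePass.run ((setN 4 (.lit 0) (.lit 0) (.lit 1)).run σ)
    (numVars.eval ((setN 4 (.lit 0) (.lit 0) (.lit 1)).run σ)) := rfl
  rw [hrun, hb]
  exact h

/-- The bound covers the entries not yet filled, which are zero; `bounded_of_boundsIn` asks for
whole arrays. -/
theorem HasTables.card_le {n : ℕ → ℕ} {m k : ℕ} {τ : State F} (h : HasTables n m k τ)
    (hn : ∀ i < m, 0 < n i) (hk : k ≤ m) (i l : ℕ) : τ.nat 4 i l ≤ gridCard n m := by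
  by_cases hil : i ≠ 0 ∨ k < l
  · rw [h.card_zero i l hil]; exact Nat.zero_le _
  · obtain rfl : i = 0 := by omega
    rw [h.card_eq l (by omega)]
    exact gridCard_le hn (by omega)

/-- The outer loop writes array `4`, from which inner bounds are read, so `bounded_of_boundsIn`
applies only to the inner loop of a single pass. -/
theorem bounded_tables (σ : State F) {n : ℕ → ℕ} {m M : ℕ} (hn : ∀ i < m, 0 < n i)
    (hm : σ.nat 0 0 0 = m) (h1 : σ.nat 1 0 = n) (h3 : ∀ i j, σ.nat 3 i j = 0)
    (h4 : ∀ i j, σ.nat 4 i j = 0) (hM : gridCard n m ≤ M) (h0M : ∀ i j, σ.nat 0 i j ≤ M)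
    (h1M : ∀ i j, σ.nat 1 i j ≤ M) : tables.Bounded M σ := by
  have hb : numVars.eval ((setN 4 (.lit 0) (.lit 0) (.lit 1)).run σ) = m := by
    simp [NExp.eval, write, hm]
  refine ⟨trivial, ?_, fun k hk => ?_⟩
  · rw [hb, ← hm]; exact h0M 0 0
  rw [hb] at hk
  have hT := hasTables_iterate σ hn hm h1 h3 h4 k hk.le
  have hF₀ := frame_run (setN 4 (.lit 0) (.lit 0) (.lit 1)) σ
  have hF := frame_iterate (v := 5) (b := numVars) (frame_run tablePass)
    ((setN 4 (.lit 0) (.lit 0) (.lit 1)).run σ) k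
  refine ⟨trivial, bounded_of_boundsIn (L := [0, 1, 4]) _ _ (by decide) (by decide) ?_, trivial⟩
  intro a ha i j
  have hF' := frame_run (setN 12 (.lit 0) (.lit 0) (.lit 0))
    (iterate 5 tablePass.run ((setN 4 (.lit 0) (.lit 0) (.lit 1)).run σ) k)
  simp only [List.mem_cons, List.not_mem_nil, or_false] at ha
  rcases ha with rfl | rfl | rfl
  · rw [hF'.nat 0 (by decide), hF.nat 0 (by decide), hF₀.nat 0 (by decide)]
    exact h0M i j
  · rw [hF'.nat 1 (by decide), hF.nat 1 (by decide), hF₀.nat 1 (by decide)]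
    exact h1M i j
  · rw [hF'.nat 4 (by decide)]
    exact (hT.card_le hn hk.le i j).trans hM

end

/-! ### The decoder -/

/-- The number of points in the coordinates before the current one. -/
abbrev stripCount : NExp := .get 4 (.lit 0) (.var 10)

/-- The number of points of the grid. -/
abbrev numPoints : NExp := .get 4 (.lit 0) numVars

/-- The coordinate after the current one. -/
abbrev nextCoord : NExp := .add (.var 10) (.lit 1)

def copyStripPass : Block :=
  .setF 4 (.lit 0) (.var 13) (.get 3 nextCoord (.var 12)) ;;
  .setW 2 (.lit 0) (.var 13) (.get 1 nextCoord (.var 12)) ;;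
  .setN 12 (.lit 0) (.lit 0) (.add (.var 12) stripCount)

def copyStrip : Block :=
  .setN 12 (.lit 0) (.lit 0) (.var 11) ;; .loop 13 stripLength copyStripPass

def stripPass : Block :=
  copyStrip ;; strip ;; .setF 3 (.var 10) (.var 11) (.var 11) ;;
  .setW 1 (.var 10) (.var 11) (.var 4)

/-- The counter goes up while the coordinate goes down from the last to the first. -/
def level : Block :=
  .setN 10 (.lit 0) (.lit 0) (.sub numVars (.add (.lit 1) (.var 23))) ;;
  .setN 21 (.lit 0) (.lit 0) (.get 2 (.var 7) (.var 10)) ;;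
  .loop 11 stripCount stripPass

def copyWordPass : Block :=
  .setF 3 numVars (.var 22) (.get 1 (.lit 0) (.var 22)) ;;
  .setW 1 numVars (.var 22) (.get 0 (.lit 0) (.var 22))

def descend : Block := .loop 22 numPoints copyWordPass ;; .loop 23 numVars level

def powerPass : Block :=
  .setF 12 (.lit 0) (.lit 0)
    (.mul (.var 12) (.get 0 (.var 9) (.get 3 (.var 9) (.var 22))))

def monomialAt : Block :=
  .setF 12 (.lit 0) (.lit 0) .one ;;
  .loop 9 numVars (.loop 24 (.get 2 (.var 7) (.var 9)) powerPass)

def subtractPass : Block :=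
  monomialAt ;; .setF 1 (.lit 0) (.var 22)
    (.sub (.get 1 (.lit 0) (.var 22)) (.mul (.get 2 (.lit 0) (.var 7)) (.var 12)))

def process : Block :=
  descend ;; .setF 2 (.lit 0) (.var 7) (.get 3 (.lit 0) (.lit 0)) ;;
  .loop 22 numPoints subtractPass

def matchPass : Block :=
  .cond (.natEq (.get 2 (.var 7) (.var 9)) (.get 3 (.var 9) (.var 6))) .skip
    (.setN 8 (.lit 0) (.lit 0) (.lit 0))

def matchBlock : Block := .setN 8 (.lit 0) (.lit 0) (.lit 1) ;; .loop 9 numVars matchPass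

def candidatePass : Block := matchBlock ;; .cond (.natEq (.var 8) (.lit 1)) process .skip

/-- All indices are visited in decreasing order, and for each of them the whole list is searched.
This treats the monomials in the right order without sorting the list. -/
def indexPass : Block :=
  .setN 6 (.lit 0) (.lit 0) (.sub numPoints (.add (.lit 1) (.var 5))) ;;
  .loop 7 (.get 0 (.lit 0) (.lit 1)) candidatePass

def indexLoop : Block := .loop 5 numPoints indexPass

/-- The decoder for downset codes. -/
def decoder : Block := tables ;; indexLoop

/-! ### Correctness of the descent and removal of the leading term -/

section

open Block

variable {F : Type u} [Field F]

/-- The hypotheses on the sizes, the points and the weights. -/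
structure IsGrid (n : ℕ → ℕ) (m : ℕ) (x : ℕ → ℕ → F) (u : ℕ → ℝ) : Prop where
  pos : ∀ i < m, 0 < n i
  injOn : ∀ i < m, Set.InjOn (x i) (Finset.range (n i))
  nonneg : ∀ t < gridCard n m, 0 ≤ u t
  le_one : ∀ t < gridCard n m, u t ≤ 1

/-- The memory contains the sizes, the points, the weights and the tables. -/
structure HoldsGrid (n : ℕ → ℕ) (m : ℕ) (x : ℕ → ℕ → F) (u : ℕ → ℝ) (τ : State F) : Prop where
  numVars : τ.nat 0 0 0 = m
  sizes : τ.nat 1 0 = n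
  points : τ.fld 0 = x
  weights : τ.wgt 0 0 = u
  tables : HasTables n m m τ

theorem HoldsGrid.of_frame {n : ℕ → ℕ} {m : ℕ} {x : ℕ → ℕ → F} {u : ℕ → ℝ} {σ τ : State F}
    {c : Block} (h : HoldsGrid n m x u σ) (hF : c.Frame σ τ)
    (hN : ∀ a ∈ [0, 1, 3, 4], a ∉ c.wN) (hf : 0 ∉ c.wF) (hw : 0 ∉ c.wW) :
    HoldsGrid n m x u τ where
  numVars := by rw [hF.nat 0 (hN 0 (by simp)), h.numVars]
  sizes := by rw [hF.nat 1 (hN 1 (by simp)), h.sizes]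
  points := by rw [hF.fld 0 hf, h.points]
  weights := by rw [hF.wgt 0 hw, h.weights]
  tables :=
    { card_eq := by rw [hF.nat 4 (hN 4 (by simp))]; exact h.tables.card_eq
      card_zero := by rw [hF.nat 4 (hN 4 (by simp))]; exact h.tables.card_zero
      digit_eq := by
        have := h.tables.digit_eq
        unfold HasDigits at this ⊢
        rwa [hF.nat 3 (hN 3 (by simp))] }

theorem IsStripDecoding.congr {n j : ℕ} {x f f' : ℕ → F} {u u' : ℕ → ℝ} {g : F} {v : ℝ}
    (h : IsStripDecoding n x j f u g v) (hf : ∀ s < n, f s = f' s) (hu : ∀ s < n, u s = u' s) :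
    IsStripDecoding n x j f' u' g v := by
  refine ⟨h.nonneg, h.le_one, fun p hp hg => ?_, fun p hp hg => ?_⟩
  · rw [← wdist_congr hf hu fun _ _ => rfl]
    exact h.of_eq p hp hg
  · rw [← wdist_congr hf hu fun _ _ => rfl]
    exact h.of_ne p hp hg

theorem run_copyStrip (σ : State F) (s : ℕ) (hs : s < σ.nat 1 0 (σ.nat 10 0 0)) :
    (copyStrip.run σ).fld 4 0 s = σ.fld 3 (σ.nat 10 0 0 + 1)
      (σ.nat 11 0 0 + σ.nat 4 0 (σ.nat 10 0 0) * s) ∧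
    (copyStrip.run σ).wgt 2 0 s = σ.wgt 1 (σ.nat 10 0 0 + 1)
      (σ.nat 11 0 0 + σ.nat 4 0 (σ.nat 10 0 0) * s) := by
  obtain ⟨σ₁, h₁⟩ : ∃ σ₁, σ₁ = (setN 12 (.lit 0) (.lit 0) (.var 11)).run σ := ⟨_, rfl⟩
  have hF₁ : (setN 12 (.lit 0) (.lit 0) (.var 11)).Frame σ σ₁ := h₁ ▸ frame_run _ _
  have hrun : copyStrip.run σ = (loop 13 stripLength copyStripPass).run σ₁ := by rw [h₁]; rfl
  have hb : stripLength.eval σ₁ = σ.nat 1 0 (σ.nat 10 0 0) := by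
    simp only [NExp.eval]
    rw [hF₁.nat 1 (by decide), hF₁.nat 10 (by decide)]
  have key : s < stripLength.eval σ₁ →
      (copyStrip.run σ).fld 4 0 s = σ.fld 3 (σ.nat 10 0 0 + 1)
        (σ.nat 11 0 0 + σ.nat 4 0 (σ.nat 10 0 0) * s) ∧
      (copyStrip.run σ).wgt 2 0 s = σ.wgt 1 (σ.nat 10 0 0 + 1)
        (σ.nat 11 0 0 + σ.nat 4 0 (σ.nat 10 0 0) * s) := by
    rw [hrun]
    refine (loop_induction (v := 13) (b := stripLength) (c := copyStripPass) (σ := σ₁) (fun i τ =>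
      τ.nat 12 0 0 = σ.nat 11 0 0 + σ.nat 4 0 (σ.nat 10 0 0) * i ∧
      (s < i → τ.fld 4 0 s = σ.fld 3 (σ.nat 10 0 0 + 1)
        (σ.nat 11 0 0 + σ.nat 4 0 (σ.nat 10 0 0) * s) ∧
      τ.wgt 2 0 s = σ.wgt 1 (σ.nat 10 0 0 + 1)
        (σ.nat 11 0 0 + σ.nat 4 0 (σ.nat 10 0 0) * s))) ?_ ?_).2
    · simp [h₁, NExp.eval, write]
    · rintro i τ hi hF hv ⟨h12, h⟩
      have e10 := (hF.nat 10 (by decide)).trans (hF₁.nat 10 (by decide))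
      have e4 := (hF.nat 4 (by decide)).trans (hF₁.nat 4 (by decide))
      have f3 := (hF.fld 3 (by decide)).trans (hF₁.fld 3 (by decide))
      have w1 := (hF.wgt 1 (by decide)).trans (hF₁.wgt 1 (by decide))
      refine ⟨by simp [copyStripPass, NExp.eval, write, h12, e10, e4, mul_add, add_assoc],
        fun hsi => ?_⟩
      by_cases his : s = i
      · subst his
        simp [copyStripPass, NExp.eval, FExp.eval, WExp.eval, write, h12, e10, f3, w1, hv]
      · simpa [copyStripPass, NExp.eval, FExp.eval, WExp.eval, write, h12, e10, f3, w1, hv, his]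
          using h (by omega)
  exact key (hb.symm ▸ hs)

variable {n : ℕ → ℕ} {m : ℕ} {x : ℕ → ℕ → F} {u : ℕ → ℝ}

/-- The second clause says that a strip writes just one cell of level `k`, so neither level `k + 1`
nor earlier results are disturbed. -/
theorem run_stripPass (hG : IsGrid n m x u) (σ : State F) (hσ : HoldsGrid n m x u σ) {k t j : ℕ}
    (hk : k < m) (h10 : σ.nat 10 0 0 = k) (h11 : σ.nat 11 0 0 = t) (h21 : σ.nat 21 0 0 = j)
    (hj : j < n k) (hw0 : ∀ s < n k, 0 ≤ σ.wgt 1 (k + 1) (t + gridCard n k * s))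
    (hw1 : ∀ s < n k, σ.wgt 1 (k + 1) (t + gridCard n k * s) ≤ 1) :
    IsStripDecoding (n k) (x k) j (fun s => σ.fld 3 (k + 1) (t + gridCard n k * s))
      (fun s => σ.wgt 1 (k + 1) (t + gridCard n k * s))
      ((stripPass.run σ).fld 3 k t) ((stripPass.run σ).wgt 1 k t) ∧
    (∀ i l, i ≠ k ∨ l ≠ t → (stripPass.run σ).fld 3 i l = σ.fld 3 i l ∧
      (stripPass.run σ).wgt 1 i l = σ.wgt 1 i l) := by
  obtain ⟨σ₁, h₁⟩ : ∃ σ₁, σ₁ = copyStrip.run σ := ⟨_, rfl⟩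
  obtain ⟨σ₂, h₂⟩ : ∃ σ₂, σ₂ = strip.run σ₁ := ⟨_, rfl⟩
  have hF₁ : copyStrip.Frame σ σ₁ := h₁ ▸ frame_run _ _
  have hF₂ : strip.Frame σ₁ σ₂ := h₂ ▸ frame_run _ _
  have hrun : stripPass.run σ = (setF 3 (.var 10) (.var 11) (.var 11) ;;
    setW 1 (.var 10) (.var 11) (.var 4)).run σ₂ := by rw [h₂, h₁]; rfl
  have hσ₁ := hσ.of_frame hF₁ (by decide) (by decide) (by decide)
  have e10 : σ₂.nat 10 0 0 = k := by
    rw [hF₂.nat 10 (by decide), hF₁.nat 10 (by decide), h10]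
  have e11 : σ₂.nat 11 0 0 = t := by
    rw [hF₂.nat 11 (by decide), hF₁.nat 11 (by decide), h11]
  have hcopy := run_copyStrip σ
  rw [h10, h11, hσ.sizes, hσ.tables.card_eq k hk.le, ← h₁] at hcopy
  have g10 : σ₁.nat 10 0 0 = k := by rw [hF₁.nat 10 (by decide), h10]
  have hdec := run_strip σ₁ (x := x k) (n := n k) (j := j)
    (by rw [g10, hσ₁.points]) (by rw [g10, hσ₁.sizes]) rfl rfl
    (by rw [hF₁.nat 21 (by decide), h21]) hj (hG.injOn k hk)
    (fun s hs => by rw [(hcopy s hs).2]; exact hw0 s hs)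
    (fun s hs => by rw [(hcopy s hs).2]; exact hw1 s hs)
  rw [← h₂] at hdec
  have f3 := (hF₂.fld 3 (by decide)).trans (hF₁.fld 3 (by decide))
  have w1 := (hF₂.wgt 1 (by decide)).trans (hF₁.wgt 1 (by decide))
  constructor
  · have := hdec.congr (fun s hs => (hcopy s hs).1) (fun s hs => (hcopy s hs).2)
    simpa [hrun, FExp.eval, WExp.eval, NExp.eval, write, e10, e11] using this
  · intro i l hil
    have : ¬ (i = k ∧ l = t) := by tauto
    simp [hrun, FExp.eval, WExp.eval, NExp.eval, write, e10, e11, this, f3, w1]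

theorem run_level (hG : IsGrid n m x u) (σ : State F) (hσ : HoldsGrid n m x u σ) {k j : ℕ}
    (hk : k < m) (h23 : σ.nat 23 0 0 = m - (k + 1)) (h2 : σ.nat 2 (σ.nat 7 0 0) k = j)
    (hj : j < n k) (hw0 : ∀ t < gridCard n (k + 1), 0 ≤ σ.wgt 1 (k + 1) t)
    (hw1 : ∀ t < gridCard n (k + 1), σ.wgt 1 (k + 1) t ≤ 1) (t : ℕ) (ht : t < gridCard n k) :
    IsStripDecoding (n k) (x k) j (fun s => σ.fld 3 (k + 1) (t + gridCard n k * s))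
      (fun s => σ.wgt 1 (k + 1) (t + gridCard n k * s))
      ((level.run σ).fld 3 k t) ((level.run σ).wgt 1 k t) := by
  obtain ⟨σ₁, h₁⟩ : ∃ σ₁, σ₁ = (setN 10 (.lit 0) (.lit 0) (.sub numVars (.add (.lit 1) (.var 23))) ;;
    setN 21 (.lit 0) (.lit 0) (.get 2 (.var 7) (.var 10))).run σ := ⟨_, rfl⟩
  have hF₁ := frame_run (setN 10 (.lit 0) (.lit 0) (.sub numVars (.add (.lit 1) (.var 23))) ;;
    setN 21 (.lit 0) (.lit 0) (.get 2 (.var 7) (.var 10))) σ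
  rw [← h₁] at hF₁
  have hrun : level.run σ = (loop 11 stripCount stripPass).run σ₁ := by rw [h₁]; rfl
  have hσ₁ := hσ.of_frame hF₁ (by decide) (by decide) (by decide)
  have hsub : m - (1 + (m - (k + 1))) = k := by omega
  have e10 : σ₁.nat 10 0 0 = k := by simp [h₁, NExp.eval, write, hσ.numVars, h23, hsub]
  have e21 : σ₁.nat 21 0 0 = j := by
    simp [h₁, NExp.eval, write, hσ.numVars, h23, hsub, h2]
  have hb : stripCount.eval σ₁ = gridCard n k := by
    simp only [NExp.eval]
    rw [e10, hσ₁.tables.card_eq k hk.le]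
  rw [hrun]
  suffices h : ∀ t < stripCount.eval σ₁,
      IsStripDecoding (n k) (x k) j (fun s => σ.fld 3 (k + 1) (t + gridCard n k * s))
      (fun s => σ.wgt 1 (k + 1) (t + gridCard n k * s))
      (((loop 11 stripCount stripPass).run σ₁).fld 3 k t)
      (((loop 11 stripCount stripPass).run σ₁).wgt 1 k t) from h t (hb.symm ▸ ht)
  refine (loop_induction (v := 11) (b := stripCount) (c := stripPass) (σ := σ₁) (fun i τ =>
    (∀ l, τ.fld 3 (k + 1) l = σ.fld 3 (k + 1) l ∧ τ.wgt 1 (k + 1) l = σ.wgt 1 (k + 1) l) ∧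
    ∀ t < i, IsStripDecoding (n k) (x k) j (fun s => σ.fld 3 (k + 1) (t + gridCard n k * s))
      (fun s => σ.wgt 1 (k + 1) (t + gridCard n k * s)) (τ.fld 3 k t) (τ.wgt 1 k t)) ?_ ?_).2
  · refine ⟨fun l => ⟨?_, ?_⟩, by simp⟩
    · rw [State.setVar_fld, hF₁.fld 3 (by decide)]
    · rw [State.setVar_wgt, hF₁.wgt 1 (by decide)]
  · rintro i τ hi hF hv ⟨hup, hdec⟩
    rw [hb] at hi
    obtain ⟨hnew, hold⟩ := run_stripPass hG τ
      (hσ₁.of_frame hF (by decide) (by decide) (by decide)) hk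
      (by rw [hF.nat 10 (by decide), e10]) hv (by rw [hF.nat 21 (by decide), e21]) hj
      (fun s hs => by rw [(hup _).2]; exact hw0 _ (add_mul_lt_gridCard hi hs))
      (fun s hs => by rw [(hup _).2]; exact hw1 _ (add_mul_lt_gridCard hi hs))
    simp only [State.setVar_fld, State.setVar_wgt]
    refine ⟨fun l => ?_, fun t ht => ?_⟩
    · have := hold (k + 1) l (Or.inl (by omega))
      rw [this.1, this.2]
      exact hup l
    · by_cases hti : t = i
      · subst hti
        exact hnew.congr (fun s _ => (hup _).1) (fun s _ => (hup _).2)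
      · have := hold k t (Or.inr hti)
        rw [this.1, this.2]
        exact hdec t (by omega)

theorem run_copyWord (σ : State F) (hσ : HoldsGrid n m x u σ) (t : ℕ) (ht : t < gridCard n m) :
    ((loop 22 numPoints copyWordPass).run σ).fld 3 m t = σ.fld 1 0 t ∧
    ((loop 22 numPoints copyWordPass).run σ).wgt 1 m t = u t := by
  have hb : numPoints.eval σ = gridCard n m := by
    simp only [NExp.eval]
    rw [hσ.numVars, hσ.tables.card_eq m le_rfl]
  suffices h : t < numPoints.eval σ →
      ((loop 22 numPoints copyWordPass).run σ).fld 3 m t = σ.fld 1 0 t ∧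
      ((loop 22 numPoints copyWordPass).run σ).wgt 1 m t = u t from h (hb.symm ▸ ht)
  refine loop_induction (v := 22) (b := numPoints) (c := copyWordPass) (σ := σ) (fun i τ =>
    t < i → τ.fld 3 m t = σ.fld 1 0 t ∧ τ.wgt 1 m t = u t) (by simp) ?_
  intro i τ hi hF hv h hti
  have e0 := hF.nat 0 (by decide)
  have f1 := hF.fld 1 (by decide)
  have w0 := hF.wgt 0 (by decide)
  by_cases hit : t = i
  · subst hit
    simp [copyWordPass, NExp.eval, FExp.eval, WExp.eval, write, e0, f1, w0, hv, hσ.numVars,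
      hσ.weights]
  · simpa [copyWordPass, NExp.eval, FExp.eval, WExp.eval, write, e0, hv, hσ.numVars, hit] using
      h (by omega)

/-- `wdist_lt_of_isStripDecoding` carries the distance condition from each level to the next, and
`eq_of_wdist_one_lt` reads off the coefficient at level `0`. -/
theorem run_descend (hG : IsGrid n m x u) (σ : State F) (hσ : HoldsGrid n m x u σ) {a : ℕ}
    (ha : a < gridCard n m) (h2 : ∀ i < m, σ.nat 2 (σ.nat 7 0 0) i = digit n i a) {c : ℕ → F}
    (hc : ∀ b, a < b → c b = 0)
    (hd : wdist (gridCard n m) (σ.fld 1 0) u (gridEval n x m c) <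
      (∏ i ∈ Finset.range m, ((n i : ℝ) - digit n i a)) / 2) :
    (descend.run σ).fld 3 0 0 = c a := by
  obtain ⟨σ₁, h₁⟩ : ∃ σ₁, σ₁ = (loop 22 numPoints copyWordPass).run σ := ⟨_, rfl⟩
  have hF₁ : (loop 22 numPoints copyWordPass).Frame σ σ₁ := h₁ ▸ frame_run _ _
  have hrun : descend.run σ = (loop 23 numVars level).run σ₁ := by rw [h₁]; rfl
  have hσ₁ := hσ.of_frame hF₁ (by decide) (by decide) (by decide)
  have hcopy := run_copyWord σ hσ
  rw [← h₁] at hcopy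
  have hb : numVars.eval σ₁ = m := hσ₁.numVars
  rw [hrun]
  have key : (fun k (τ : State F) => (∀ t < gridCard n k, 0 ≤ τ.wgt 1 k t) ∧
      (∀ t < gridCard n k, τ.wgt 1 k t ≤ 1) ∧
      wdist (gridCard n k) (τ.fld 3 k) (τ.wgt 1 k)
        (gridEval n x k fun b => c (b + gridCard n k * (a / gridCard n k))) <
      (∏ i ∈ Finset.range k, ((n i : ℝ) - digit n i a)) / 2)
      (m - numVars.eval σ₁) ((loop 23 numVars level).run σ₁) := by
    refine loop_induction (v := 23) (b := numVars) (c := level) (σ := σ₁) (fun i τ =>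
      (fun k (τ : State F) => (∀ t < gridCard n k, 0 ≤ τ.wgt 1 k t) ∧
      (∀ t < gridCard n k, τ.wgt 1 k t ≤ 1) ∧
      wdist (gridCard n k) (τ.fld 3 k) (τ.wgt 1 k)
        (gridEval n x k fun b => c (b + gridCard n k * (a / gridCard n k))) <
      (∏ i ∈ Finset.range k, ((n i : ℝ) - digit n i a)) / 2) (m - i) τ) ?_ ?_
    · simp only [State.setVar_fld, State.setVar_wgt, Nat.sub_zero]
      refine ⟨fun t ht => ?_, fun t ht => ?_, ?_⟩
      · rw [(hcopy t ht).2]; exact hG.nonneg t ht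
      · rw [(hcopy t ht).2]; exact hG.le_one t ht
      · simp only [Nat.div_eq_of_lt ha, mul_zero, add_zero]
        rw [wdist_congr (fun t ht => (hcopy t ht).1) (fun t ht => (hcopy t ht).2) fun _ _ => rfl]
        exact hd
    · rintro i τ hi hF hv ⟨hw0, hw1, hlt⟩
      rw [hb] at hi
      obtain ⟨k, hk⟩ : ∃ k, m - i = k + 1 := ⟨m - i - 1, by omega⟩
      have hk' : m - (i + 1) = k := by omega
      rw [hk] at hw0 hw1 hlt
      rw [hk']
      have hkm : k < m := by omega
      have hdec := run_level hG τ (hσ₁.of_frame hF (by decide) (by decide) (by decide)) hkm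
        (by rw [hv]; omega)
        (by rw [hF.nat 2 (by decide), hF.nat 7 (by decide), hF₁.nat 2 (by decide),
          hF₁.nat 7 (by decide), h2 k hkm]) (digit_lt (hG.pos k hkm) a) hw0 hw1
      simp only [State.setVar_fld, State.setVar_wgt]
      exact ⟨fun t ht => (hdec t ht).nonneg, fun t ht => (hdec t ht).le_one,
        wdist_lt_of_isStripDecoding (fun i hi => hG.pos i (by omega)) hc hdec hlt⟩
  rw [hb, Nat.sub_self] at key
  obtain ⟨-, hw1, hlt⟩ := key
  have := eq_of_wdist_one_lt (hw1 0 (by simp)) (by simpa using hlt)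
  simpa using this

theorem run_monomialAt (σ : State F) (hσ : HoldsGrid n m x u σ) {a : ℕ}
    (h2 : ∀ i < m, σ.nat 2 (σ.nat 7 0 0) i = digit n i a) (ht : σ.nat 22 0 0 < gridCard n m) :
    (monomialAt.run σ).fld 12 0 0 = gridMonomial n x m a (σ.nat 22 0 0) := by
  obtain ⟨σ₁, h₁⟩ : ∃ σ₁, σ₁ = (setF 12 (.lit 0) (.lit 0) .one).run σ := ⟨_, rfl⟩
  have hF₁ : (setF 12 (.lit 0) (.lit 0) .one).Frame σ σ₁ := h₁ ▸ frame_run _ _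
  have hrun : monomialAt.run σ =
    (loop 9 numVars (loop 24 (.get 2 (.var 7) (.var 9)) powerPass)).run σ₁ := by rw [h₁]; rfl
  have hb : numVars.eval σ₁ = m := (hσ.of_frame hF₁ (by decide) (by decide) (by decide)).numVars
  have key : ((loop 9 numVars (loop 24 (.get 2 (.var 7) (.var 9)) powerPass)).run σ₁).fld 12 0 0 =
      gridMonomial n x (numVars.eval σ₁) a (σ.nat 22 0 0) := by
    refine loop_induction (v := 9) (b := numVars)
      (c := loop 24 (.get 2 (.var 7) (.var 9)) powerPass) (σ := σ₁) (fun i τ =>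
      τ.fld 12 0 0 = gridMonomial n x i a (σ.nat 22 0 0)) ?_ ?_
    · simp [h₁, NExp.eval, FExp.eval, write, gridMonomial]
    · intro i τ hi hF hv h
      rw [hb] at hi
      have hτ := (hσ.of_frame hF₁ (by decide) (by decide) (by decide)).of_frame hF
        (by decide) (by decide) (by decide)
      have hbe : (NExp.get 2 (.var 7) (.var 9)).eval τ = digit n i a := by
        simp only [NExp.eval]
        rw [hv, hF.nat 2 (by decide), hF.nat 7 (by decide), hF₁.nat 2 (by decide),
          hF₁.nat 7 (by decide), h2 i hi]
      rw [State.setVar_fld, gridMonomial, Finset.prod_range_succ, ← gridMonomial, ← hbe]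
      refine loop_induction (v := 24) (b := .get 2 (.var 7) (.var 9)) (c := powerPass) (σ := τ)
        (fun l ρ => ρ.fld 12 0 0 = gridMonomial n x i a (σ.nat 22 0 0) *
          x i (digit n i (σ.nat 22 0 0)) ^ l) ?_ ?_
      · simpa using h
      · intro l ρ hl hF' hv' h'
        have hρ := hτ.of_frame hF' (by decide) (by decide) (by decide)
        have e9 : ρ.nat 9 0 0 = i := by rw [hF'.nat 9 (by decide), hv]
        have e22 : ρ.nat 22 0 0 = σ.nat 22 0 0 := by
          rw [hF'.nat 22 (by decide), hF.nat 22 (by decide), hF₁.nat 22 (by decide)]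
        have e3 := hρ.tables.digit_eq _ ht i hi
        simp [powerPass, NExp.eval, FExp.eval, write, e9, e22, e3, hρ.points, h', pow_succ,
          mul_assoc]
  rw [hrun, key, hb]

theorem run_subtract (σ : State F) (hσ : HoldsGrid n m x u σ) {a : ℕ}
    (h2 : ∀ i < m, σ.nat 2 (σ.nat 7 0 0) i = digit n i a) (t : ℕ) (ht : t < gridCard n m) :
    ((loop 22 numPoints subtractPass).run σ).fld 1 0 t =
      σ.fld 1 0 t - σ.fld 2 0 (σ.nat 7 0 0) * gridMonomial n x m a t := by
  have hb : numPoints.eval σ = gridCard n m := by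
    simp only [NExp.eval]
    rw [hσ.numVars, hσ.tables.card_eq m le_rfl]
  have key : ((loop 22 numPoints subtractPass).run σ).fld 1 0 t =
      if t < numPoints.eval σ then
        σ.fld 1 0 t - σ.fld 2 0 (σ.nat 7 0 0) * gridMonomial n x m a t else σ.fld 1 0 t := by
    refine loop_induction (v := 22) (b := numPoints) (c := subtractPass) (σ := σ) (fun i τ =>
      τ.fld 1 0 t = if t < i then
        σ.fld 1 0 t - σ.fld 2 0 (σ.nat 7 0 0) * gridMonomial n x m a t else σ.fld 1 0 t)
      (by simp) ?_
    intro i τ hi hF hv h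
    rw [hb] at hi
    have e7 := hF.nat 7 (by decide)
    have hmon := run_monomialAt τ (hσ.of_frame hF (by decide) (by decide) (by decide)) (a := a)
      (by rw [hF.nat 2 (by decide), e7]; exact h2) (by rw [hv]; exact hi)
    rw [hv] at hmon
    obtain ⟨τ₁, h₁⟩ : ∃ τ₁, τ₁ = monomialAt.run τ := ⟨_, rfl⟩
    have hF₁ : monomialAt.Frame τ τ₁ := h₁ ▸ frame_run _ _
    have hrun : subtractPass.run τ = (setF 1 (.lit 0) (.var 22)
      (.sub (.get 1 (.lit 0) (.var 22)) (.mul (.get 2 (.lit 0) (.var 7)) (.var 12)))).run τ₁ := by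
      rw [h₁]; rfl
    rw [← h₁] at hmon
    have d22 : τ₁.nat 22 0 0 = i := by rw [hF₁.nat 22 (by decide), hv]
    have d7 : τ₁.nat 7 = σ.nat 7 := (hF₁.nat 7 (by decide)).trans e7
    have g1 : τ₁.fld 1 = τ.fld 1 := hF₁.fld 1 (by decide)
    have g2 : τ₁.fld 2 = σ.fld 2 := (hF₁.fld 2 (by decide)).trans (hF.fld 2 (by decide))
    by_cases hti : t = i
    · subst hti
      simp only [lt_irrefl, if_false] at h
      simp [hrun, NExp.eval, FExp.eval, write, d22, d7, g1, g2, hmon, h]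
    · have : (t < i + 1) = (t < i) := by simp only [eq_iff_iff]; omega
      simp [hrun, NExp.eval, FExp.eval, write, d22, g1, hti, h, this]
  rw [key, if_pos (hb.symm ▸ ht)]

theorem gridEval_update {a : ℕ} (ha : a < gridCard n m) (c : ℕ → F) (t : ℕ) :
    gridEval n x m (Function.update c a 0) t =
      gridEval n x m c t - c a * gridMonomial n x m a t := by
  rw [gridEval, gridEval, eq_sub_iff_add_eq,
    ← Finset.sum_erase_add _ _ (Finset.mem_range.2 ha),
    ← Finset.sum_erase_add _ _ (Finset.mem_range.2 ha), Function.update_self, zero_mul, add_zero]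
  congr 1
  refine Finset.sum_congr rfl fun b hb => ?_
  rw [Function.update_of_ne (Finset.ne_of_mem_erase hb)]

theorem wdist_sub (N : ℕ) (f g h : ℕ → F) (u : ℕ → ℝ) :
    wdist N (fun t => f t - h t) u (fun t => g t - h t) = wdist N f u g := by
  refine Finset.sum_congr rfl fun t _ => ?_
  by_cases hfg : f t = g t <;> simp [hfg, sub_left_inj]

/-- Decoding the leading coefficient and removing the leading term. -/
theorem run_process (hG : IsGrid n m x u) (σ : State F) (hσ : HoldsGrid n m x u σ) {a : ℕ}
    (ha : a < gridCard n m) (h2 : ∀ i < m, σ.nat 2 (σ.nat 7 0 0) i = digit n i a) {c : ℕ → F}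
    (hc : ∀ b, a < b → c b = 0)
    (hd : wdist (gridCard n m) (σ.fld 1 0) u (gridEval n x m c) <
      (∏ i ∈ Finset.range m, ((n i : ℝ) - digit n i a)) / 2) :
    (process.run σ).fld 2 0 (σ.nat 7 0 0) = c a ∧
    (∀ q, q ≠ σ.nat 7 0 0 → (process.run σ).fld 2 0 q = σ.fld 2 0 q) ∧
    wdist (gridCard n m) ((process.run σ).fld 1 0) u
      (gridEval n x m (Function.update c a 0)) =
      wdist (gridCard n m) (σ.fld 1 0) u (gridEval n x m c) := by
  obtain ⟨σ₁, h₁⟩ : ∃ σ₁, σ₁ = descend.run σ := ⟨_, rfl⟩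
  obtain ⟨σ₂, h₂⟩ : ∃ σ₂, σ₂ = (setF 2 (.lit 0) (.var 7) (.get 3 (.lit 0) (.lit 0))).run σ₁ :=
    ⟨_, rfl⟩
  obtain ⟨σ₃, h₃⟩ : ∃ σ₃, σ₃ = (loop 22 numPoints subtractPass).run σ₂ := ⟨_, rfl⟩
  have hF₁ : descend.Frame σ σ₁ := h₁ ▸ frame_run _ _
  have hF₂ : (setF 2 (.lit 0) (.var 7) (.get 3 (.lit 0) (.lit 0))).Frame σ₁ σ₂ :=
    h₂ ▸ frame_run _ _
  have hF₃ : (loop 22 numPoints subtractPass).Frame σ₂ σ₃ := h₃ ▸ frame_run _ _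
  have hrun : process.run σ = σ₃ := by rw [h₃, h₂, h₁]; rfl
  have hσ₂ := (hσ.of_frame hF₁ (by decide) (by decide) (by decide)).of_frame hF₂
    (by decide) (by decide) (by decide)
  have hlead : σ₁.fld 3 0 0 = c a := by rw [h₁]; exact run_descend hG σ hσ ha h2 hc hd
  have e7 : σ₁.nat 7 = σ.nat 7 := hF₁.nat 7 (by decide)
  have hout : σ₂.fld 2 0 (σ.nat 7 0 0) = c a := by
    simp [h₂, NExp.eval, FExp.eval, write, e7, hlead]
  have hsub := run_subtract σ₂ hσ₂ (a := a) (by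
    rw [hF₂.nat 2 (by decide), hF₁.nat 2 (by decide), hF₂.nat 7 (by decide), e7]; exact h2)
  rw [← h₃, hF₂.nat 7 (by decide), e7, hout, hF₂.fld 1 (by decide), hF₁.fld 1 (by decide)] at hsub
  refine ⟨?_, fun q hq => ?_, ?_⟩
  · rw [hrun, hF₃.fld 2 (by decide), hout]
  · rw [hrun, hF₃.fld 2 (by decide)]
    simp [h₂, NExp.eval, FExp.eval, write, e7, hq, hF₁.fld 2 (by decide)]
  · rw [hrun, wdist_congr hsub (fun _ _ => rfl) fun t _ => gridEval_update ha c t]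
    exact wdist_sub _ _ _ (fun t => c a * gridMonomial n x m a t) _

theorem run_matchBlock (σ : State F) (hm : σ.nat 0 0 0 = m) :
    (matchBlock.run σ).nat 8 0 0 = 1 ↔
      ∀ i < m, σ.nat 2 (σ.nat 7 0 0) i = σ.nat 3 i (σ.nat 6 0 0) := by
  obtain ⟨σ₁, h₁⟩ : ∃ σ₁, σ₁ = (setN 8 (.lit 0) (.lit 0) (.lit 1)).run σ := ⟨_, rfl⟩
  have hF₁ : (setN 8 (.lit 0) (.lit 0) (.lit 1)).Frame σ σ₁ := h₁ ▸ frame_run _ _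
  have hrun : matchBlock.run σ = (loop 9 numVars matchPass).run σ₁ := by rw [h₁]; rfl
  have hb : numVars.eval σ₁ = m := by
    simp only [NExp.eval]
    rw [hF₁.nat 0 (by decide), hm]
  rw [hrun]
  conv_rhs => rw [← hb]
  refine loop_induction (v := 9) (b := numVars) (c := matchPass) (σ := σ₁) (fun l τ =>
    τ.nat 8 0 0 = 1 ↔ ∀ i < l, σ.nat 2 (σ.nat 7 0 0) i = σ.nat 3 i (σ.nat 6 0 0)) ?_ ?_
  · simp [h₁, NExp.eval, write]
  · intro l τ hl hF hv h
    have e2 := (hF.nat 2 (by decide)).trans (hF₁.nat 2 (by decide))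
    have e3 := (hF.nat 3 (by decide)).trans (hF₁.nat 3 (by decide))
    have e6 := (hF.nat 6 (by decide)).trans (hF₁.nat 6 (by decide))
    have e7 := (hF.nat 7 (by decide)).trans (hF₁.nat 7 (by decide))
    rw [Nat.forall_lt_succ_right, ← h, State.setVar_nat, write_ne _ _ _ _ (by decide)]
    by_cases heq : σ.nat 2 (σ.nat 7 0 0) l = σ.nat 3 l (σ.nat 6 0 0)
    · rw [matchPass, run_cond_pos]
      · simp [heq]
      · simp [BExp.Holds, NExp.eval, e2, e3, e6, e7, hv, heq]
    · rw [matchPass, run_cond_neg]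
      · simp [NExp.eval, write, heq]
      · simp [BExp.Holds, NExp.eval, e2, e3, e6, e7, hv, heq]

theorem eq_of_digit_eq (n : ℕ → ℕ) {a b : ℕ} (m : ℕ) (ha : a < gridCard n m)
    (hb : b < gridCard n m) (h : ∀ i < m, digit n i a = digit n i b) : a = b := by
  suffices hs : ∀ k ≤ m, a % gridCard n k = b % gridCard n k by
    have := hs m le_rfl
    rwa [Nat.mod_eq_of_lt ha, Nat.mod_eq_of_lt hb] at this
  intro k
  induction k with
  | zero => simp [Nat.mod_one]
  | succ k ih =>
    intro hk
    have := h k hk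
    rw [digit, digit] at this
    rw [gridCard_succ, Nat.mod_mul, Nat.mod_mul, ih (by omega), this]

end

/-! ### Correctness and running time of the whole decoder -/

section

open Block

variable {F : Type u} [Field F] {n : ℕ → ℕ} {m : ℕ} {x : ℕ → ℕ → F} {u : ℕ → ℝ}

/-- `idx q` is the index of the `q`-th of the `l` monomials, `c` vanishes at all other indices, and
words at distance less than `δ` can be decoded. -/
structure IsMonomialList (n : ℕ → ℕ) (m l : ℕ) (idx : ℕ → ℕ) (c : ℕ → F) (δ : ℝ) : Prop where
  lt : ∀ q < l, idx q < gridCard n m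
  inj : ∀ q < l, ∀ q' < l, idx q = idx q' → q = q'
  zero : ∀ b, (∀ q < l, idx q ≠ b) → c b = 0
  le : ∀ q < l, δ ≤ (∏ i ∈ Finset.range m, ((n i : ℝ) - digit n i (idx q))) / 2

/-- The memory contains the exponents of the monomials. -/
structure HoldsExponents (n : ℕ → ℕ) (m l : ℕ) (idx : ℕ → ℕ) (τ : State F) : Prop where
  count : τ.nat 0 0 1 = l
  exponent : ∀ q < l, ∀ i < m, τ.nat 2 q i = digit n i (idx q)

theorem HoldsExponents.of_frame {l : ℕ} {idx : ℕ → ℕ} {σ τ : State F} {c : Block}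
    (h : HoldsExponents n m l idx σ) (hF : c.Frame σ τ) (h0 : 0 ∉ c.wN) (h2 : 2 ∉ c.wN) :
    HoldsExponents n m l idx τ :=
  ⟨by rw [hF.nat 0 h0]; exact h.count, by rw [hF.nat 2 h2]; exact h.exponent⟩

open Classical in
-- The truncation of `c` describes what is left of the codeword: everything below `a`, and the term
-- at `a` unless its monomial has been met among the first `q` list entries. If entry `q` is that
-- monomial, no earlier one was, so the term is still present and `process` removes it.
theorem run_candidatePass (hG : IsGrid n m x u) (σ : State F) (hσ : HoldsGrid n m x u σ) {l : ℕ}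
    {idx : ℕ → ℕ} {c : ℕ → F} {δ : ℝ} (hD : IsMonomialList n m l idx c δ)
    (hσD : HoldsExponents n m l idx σ) {a q : ℕ} (ha : a < gridCard n m) (h6 : σ.nat 6 0 0 = a)
    (h7 : σ.nat 7 0 0 = q) (hq : q < l)
    (hd : wdist (gridCard n m) (σ.fld 1 0) u (gridEval n x m fun b =>
      if b < a ∨ (b = a ∧ ∀ q' < q, idx q' ≠ a) then c b else 0) < δ)
    (hout : ∀ q' < l, a < idx q' ∨ (idx q' = a ∧ q' < q) → σ.fld 2 0 q' = c (idx q')) :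
    wdist (gridCard n m) ((candidatePass.run σ).fld 1 0) u (gridEval n x m fun b =>
      if b < a ∨ (b = a ∧ ∀ q' < q + 1, idx q' ≠ a) then c b else 0) < δ ∧
    ∀ q' < l, a < idx q' ∨ (idx q' = a ∧ q' < q + 1) →
      (candidatePass.run σ).fld 2 0 q' = c (idx q') := by
  obtain ⟨σ₁, h₁⟩ : ∃ σ₁, σ₁ = matchBlock.run σ := ⟨_, rfl⟩
  have hF₁ : matchBlock.Frame σ σ₁ := h₁ ▸ frame_run _ _
  have hrun : candidatePass.run σ =
    (cond (.natEq (.var 8) (.lit 1)) process .skip).run σ₁ := by rw [h₁]; rfl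
  have hmatch : σ₁.nat 8 0 0 = 1 ↔ idx q = a := by
    rw [h₁, run_matchBlock σ hσ.numVars, h6, h7]
    constructor
    · intro h
      refine eq_of_digit_eq n m (hD.lt q hq) ha fun i hi => ?_
      rw [← hσD.exponent q hq i hi, h i hi, hσ.tables.digit_eq a ha i hi]
    · rintro rfl i hi
      rw [hσD.exponent q hq i hi, hσ.tables.digit_eq _ ha i hi]
  have hσ₁ := hσ.of_frame hF₁ (by decide) (by decide) (by decide)
  have hσD₁ := hσD.of_frame hF₁ (by decide) (by decide)
  rw [hrun]
  by_cases hqa : idx q = a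
  · have hnone : ∀ q' < q, idx q' ≠ a := fun q' hq' h =>
      hq'.ne (hD.inj q' (hq'.trans hq) q hq (h.trans hqa.symm))
    have e7 : σ₁.nat 7 0 0 = q := by rw [hF₁.nat 7 (by decide), h7]
    obtain ⟨p1, p2, p3⟩ := run_process hG σ₁ hσ₁ ha
      (by rw [e7, ← hqa]; exact hσD₁.exponent q hq)
      (c := fun b => if b < a ∨ (b = a ∧ ∀ q' < q, idx q' ≠ a) then c b else 0)
      (fun b hb => if_neg (by omega))
      (by rw [hF₁.fld 1 (by decide), ← hqa]; rw [← hqa] at hd; exact hd.trans_le (hD.le q hq))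
    rw [run_cond_pos]
    swap
    · simp [BExp.Holds, NExp.eval, hmatch, hqa]
    rw [e7] at p1 p2
    constructor
    · have hupd : (fun b => if b < a ∨ (b = a ∧ ∀ q' < q + 1, idx q' ≠ a) then c b else 0) =
          Function.update (fun b => if b < a ∨ (b = a ∧ ∀ q' < q, idx q' ≠ a) then c b else 0)
            a 0 := by
        funext b
        by_cases hb : b = a
        · subst hb
          rw [Function.update_self, if_neg]
          rintro (h | h)
          · exact h.false
          · exact h.2 q (Nat.lt_succ_self q) hqa
        · rw [Function.update_of_ne hb]
          simp [hb]
      rw [hupd, p3, hF₁.fld 1 (by decide)]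
      exact hd
    · intro q' hq' h
      by_cases hqq : q' = q
      · subst hqq
        rw [p1, if_pos (Or.inr ⟨rfl, hnone⟩), hqa]
      · rw [p2 q' hqq, hF₁.fld 2 (by decide)]
        exact hout q' hq' (by omega)
  · rw [run_cond_neg]
    swap
    · simp [BExp.Holds, NExp.eval, hmatch, hqa]
    rw [run_skip, hF₁.fld 1 (by decide), hF₁.fld 2 (by decide)]
    simp only [Nat.forall_lt_succ_right, ne_eq, hqa, not_false_eq_true, and_true]
    refine ⟨hd, fun q' hq' h => hout q' hq' ?_⟩
    rcases h with h | ⟨h, h'⟩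
    · exact Or.inl h
    · refine Or.inr ⟨h, lt_of_le_of_ne (Nat.lt_succ_iff.1 h') ?_⟩
      rintro rfl
      exact hqa h

theorem run_indexPass (hG : IsGrid n m x u) (σ : State F) (hσ : HoldsGrid n m x u σ) {l : ℕ}
    {idx : ℕ → ℕ} {c : ℕ → F} {δ : ℝ} (hD : IsMonomialList n m l idx c δ)
    (hσD : HoldsExponents n m l idx σ) {a a' : ℕ} (ha : a + a' + 1 = gridCard n m)
    (h5 : σ.nat 5 0 0 = a')
    (hd : wdist (gridCard n m) (σ.fld 1 0) u (gridEval n x m fun b =>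
      if b < a + 1 then c b else 0) < δ)
    (hout : ∀ q < l, a + 1 ≤ idx q → σ.fld 2 0 q = c (idx q)) :
    wdist (gridCard n m) ((indexPass.run σ).fld 1 0) u (gridEval n x m fun b =>
      if b < a then c b else 0) < δ ∧
    ∀ q < l, a ≤ idx q → (indexPass.run σ).fld 2 0 q = c (idx q) := by
  classical
  obtain ⟨σ₁, h₁⟩ : ∃ σ₁, σ₁ = (setN 6 (.lit 0) (.lit 0)
    (.sub numPoints (.add (.lit 1) (.var 5)))).run σ := ⟨_, rfl⟩
  have hF₁ : (setN 6 (.lit 0) (.lit 0) (.sub numPoints (.add (.lit 1) (.var 5)))).Frame σ σ₁ :=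
    h₁ ▸ frame_run _ _
  have hrun : indexPass.run σ =
    (loop 7 (.get 0 (.lit 0) (.lit 1)) candidatePass).run σ₁ := by rw [h₁]; rfl
  have hσ₁ := hσ.of_frame hF₁ (by decide) (by decide) (by decide)
  have hσD₁ := hσD.of_frame hF₁ (by decide) (by decide)
  have hb : (NExp.get 0 (.lit 0) (.lit 1)).eval σ₁ = l := hσD₁.count
  have e6 : σ₁.nat 6 0 0 = a := by
    simp only [h₁, run_setN, NExp.eval, write, hσ.numVars, hσ.tables.card_eq m le_rfl, h5]
    simp only [and_self, if_true]
    omega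
  have key : wdist (gridCard n m)
      (((loop 7 (.get 0 (.lit 0) (.lit 1)) candidatePass).run σ₁).fld 1 0) u
      (gridEval n x m fun b => if b < a ∨
        (b = a ∧ ∀ q' < (NExp.get 0 (.lit 0) (.lit 1)).eval σ₁, idx q' ≠ a) then c b else 0) < δ ∧
      ∀ q' < l, a < idx q' ∨ (idx q' = a ∧ q' < (NExp.get 0 (.lit 0) (.lit 1)).eval σ₁) →
      ((loop 7 (.get 0 (.lit 0) (.lit 1)) candidatePass).run σ₁).fld 2 0 q' = c (idx q') := by
    refine loop_induction (v := 7) (b := .get 0 (.lit 0) (.lit 1)) (c := candidatePass) (σ := σ₁)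
      (fun q τ => wdist (gridCard n m) (τ.fld 1 0) u (gridEval n x m fun b =>
        if b < a ∨ (b = a ∧ ∀ q' < q, idx q' ≠ a) then c b else 0) < δ ∧
      ∀ q' < l, a < idx q' ∨ (idx q' = a ∧ q' < q) → τ.fld 2 0 q' = c (idx q')) ?_ ?_
    · simp only [State.setVar_fld, Nat.not_lt_zero, false_implies, implies_true, and_true, and_false,
        or_false, ← Nat.lt_succ_iff_lt_or_eq]
      rw [hF₁.fld 1 (by decide), hF₁.fld 2 (by decide)]
      exact ⟨hd, hout⟩
    · rintro q τ hq hF hv ⟨hd', hout'⟩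
      rw [hb] at hq
      exact run_candidatePass hG τ (hσ₁.of_frame hF (by decide) (by decide) (by decide)) hD
        (hσD₁.of_frame hF (by decide) (by decide)) (by omega) (by rw [hF.nat 6 (by decide), e6]) hv
        hq hd' hout'
  rw [hb] at key
  rw [hrun]
  constructor
  -- If no list entry has index `a`, nothing was removed, but then `c a = 0`.
  · have hfun : (fun b => if b < a ∨ (b = a ∧ ∀ q' < l, idx q' ≠ a) then c b else 0) =
        fun b => if b < a then c b else 0 := by
      funext b
      by_cases hba : b = a ∧ ∀ q' < l, idx q' ≠ a
      · obtain ⟨rfl, hba⟩ := hba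
        simp [hD.zero b hba]
      · simp only [hba, or_false]
    rw [← hfun]
    exact key.1
  · intro q hq h
    exact key.2 q hq (by omega)

/-- Removing terms never changes the distance, so the same bound `δ` serves at every index; after
`a'` passes the outputs at the top `a'` indices are final. -/
theorem run_decoder (hG : IsGrid n m x u) (σ : State F) {l : ℕ} {idx : ℕ → ℕ} {c : ℕ → F} {δ : ℝ}
    (hD : IsMonomialList n m l idx c δ) (hσD : HoldsExponents n m l idx σ)
    (hm : σ.nat 0 0 0 = m) (h1 : σ.nat 1 0 = n) (hx : σ.fld 0 = x) (hu : σ.wgt 0 0 = u)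
    (h3 : ∀ i j, σ.nat 3 i j = 0) (h4 : ∀ i j, σ.nat 4 i j = 0)
    (hd : wdist (gridCard n m) (σ.fld 1 0) u (gridEval n x m c) < δ) (q : ℕ) (hq : q < l) :
    (decoder.run σ).fld 2 0 q = c (idx q) := by
  obtain ⟨σ₁, h₁⟩ : ∃ σ₁, σ₁ = tables.run σ := ⟨_, rfl⟩
  have hF₁ : tables.Frame σ σ₁ := h₁ ▸ frame_run _ _
  have hrun : decoder.run σ = (loop 5 numPoints indexPass).run σ₁ := by rw [h₁]; rfl
  have hσ₁ : HoldsGrid n m x u σ₁ :=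
    { numVars := by rw [hF₁.nat 0 (by decide), hm]
      sizes := by rw [hF₁.nat 1 (by decide), h1]
      points := by rw [hF₁.fld 0 (by decide), hx]
      weights := by rw [hF₁.wgt 0 (by decide), hu]
      tables := h₁ ▸ run_tables σ hG.pos hm h1 h3 h4 }
  have hσD₁ := hσD.of_frame hF₁ (by decide) (by decide)
  have hb : numPoints.eval σ₁ = gridCard n m := by
    simp only [NExp.eval]
    rw [hσ₁.numVars, hσ₁.tables.card_eq m le_rfl]
  have key : ∀ q < l, gridCard n m - numPoints.eval σ₁ ≤ idx q →
      ((loop 5 numPoints indexPass).run σ₁).fld 2 0 q = c (idx q) := by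
    refine (loop_induction (v := 5) (b := numPoints) (c := indexPass) (σ := σ₁) (fun a' τ =>
      wdist (gridCard n m) (τ.fld 1 0) u (gridEval n x m fun b =>
        if b < gridCard n m - a' then c b else 0) < δ ∧
      ∀ q < l, gridCard n m - a' ≤ idx q → τ.fld 2 0 q = c (idx q)) ?_ ?_).2
    · refine ⟨?_, fun q hq h => ?_⟩
      · rw [State.setVar_fld, hF₁.fld 1 (by decide)]
        refine lt_of_eq_of_lt (wdist_congr (fun _ _ => rfl) (fun _ _ => rfl) fun t _ => ?_) hd
        refine Finset.sum_congr rfl fun b hb' => ?_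
        dsimp only
        rw [if_pos (by simpa using hb')]
      · have := hD.lt q hq
        omega
    · rintro a' τ ha' hF hv ⟨hd', hout'⟩
      rw [hb] at ha'
      obtain ⟨a, ha⟩ : ∃ a, a + a' + 1 = gridCard n m := ⟨gridCard n m - a' - 1, by omega⟩
      have e1 : gridCard n m - a' = a + 1 := by omega
      have e2 : gridCard n m - (a' + 1) = a := by omega
      rw [e1] at hd' hout'
      rw [e2]
      exact run_indexPass hG τ (hσ₁.of_frame hF (by decide) (by decide) (by decide)) hD
        (hσD₁.of_frame hF (by decide) (by decide)) ha hv hd' hout'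
  rw [hrun]
  exact key q hq (by omega)

theorem bounded_decoder (σ : State F) {M : ℕ} (hn : ∀ i < m, 0 < n i)
    (hm : σ.nat 0 0 0 = m) (h1 : σ.nat 1 0 = n) (h3 : ∀ i j, σ.nat 3 i j = 0)
    (h4 : ∀ i j, σ.nat 4 i j = 0) (hM : gridCard n m ≤ M) (h0M : ∀ i j, σ.nat 0 i j ≤ M)
    (h1M : ∀ i j, σ.nat 1 i j ≤ M) (h2M : ∀ i j, σ.nat 2 i j ≤ M) : decoder.Bounded M σ := by
  refine ⟨bounded_tables σ hn hm h1 h3 h4 hM h0M h1M, bounded_of_boundsIn (L := [0, 1, 2, 4]) _ _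
    (by decide) (by decide) fun a ha i j => ?_⟩
  have hF := frame_run tables σ
  simp only [List.mem_cons, List.not_mem_nil, or_false] at ha
  rcases ha with rfl | rfl | rfl | rfl
  · rw [hF.nat 0 (by decide)]; exact h0M i j
  · rw [hF.nat 1 (by decide)]; exact h1M i j
  · rw [hF.nat 2 (by decide)]; exact h2M i j
  · exact ((run_tables σ hn hm h1 h3 h4).card_le hn le_rfl i j).trans hM

theorem wf_decoder : decoder.wf = true := by decide

end

/-! ### The minimum distance of a downset code -/

section MinDist

open MvPolynomial

variable {F : Type u} [Field F] {m : ℕ} {S : Fin m → Finset F}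

/-- The product of the `X i - a` for the first `α i` elements `a` of `S i`, over all `i`. -/
noncomputable def footprintPoly (e : (i : Fin m) → Fin (S i).card ≃ S i) (α : Fin m →₀ ℕ) :
    MvPolynomial (Fin m) F :=
  ∏ i, ∏ s ∈ Finset.univ.filter fun s : Fin (S i).card => (s : ℕ) < α i, (X i - C (e i s : F))

theorem card_filter_fin_lt {n a : ℕ} (h : a ≤ n) :
    (Finset.univ.filter fun s : Fin n => (s : ℕ) < a).card = a := by
  rw [Finset.card_filter, ← Finset.sum_range fun s => if s < a then 1 else 0, ← Finset.card_filter]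
  have : (Finset.range n).filter (fun s => s < a) = Finset.range a := by
    ext s
    simp only [Finset.mem_filter, Finset.mem_range]
    omega
  rw [this, Finset.card_range]

theorem le_of_mem_support_footprintPoly (e : (i : Fin m) → Fin (S i).card ≃ S i) {α : Fin m →₀ ℕ}
    (hα : ∀ i, α i < (S i).card) {β : Fin m →₀ ℕ} (hβ : β ∈ (footprintPoly e α).support) :
    β ≤ α := by
  intro i
  refine (monomial_le_degreeOf i hβ).trans ?_
  calc (footprintPoly e α).degreeOf i
      ≤ ∑ i', ∑ s ∈ Finset.univ.filter fun s : Fin (S i').card => (s : ℕ) < α i',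
          (X i' - C (e i' s : F) : MvPolynomial (Fin m) F).degreeOf i :=
        (degreeOf_prod_le _ _ _).trans (Finset.sum_le_sum fun i' _ => degreeOf_prod_le _ _ _)
    _ ≤ ∑ i', ∑ s ∈ Finset.univ.filter fun s : Fin (S i').card => (s : ℕ) < α i',
          if i = i' then 1 else 0 := by
        refine Finset.sum_le_sum fun i' _ => Finset.sum_le_sum fun s _ => ?_
        refine (degreeOf_sub_le _ _ _).trans ?_
        rw [degreeOf_C, degreeOf_X]
        simp
    _ = α i := by
        simp [Finset.sum_ite_irrel, card_filter_fin_lt (hα i).le]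

theorem eval_footprintPoly_ne_zero (e : (i : Fin m) → Fin (S i).card ≃ S i) (α : Fin m →₀ ℕ)
    (x : Grid S) : eval (fun i => (x i : F)) (footprintPoly e α) ≠ 0 ↔
      ∀ i, α i ≤ ((e i).symm (x i) : ℕ) := by
  simp only [footprintPoly, eval_prod, map_sub, eval_X, eval_C, Finset.prod_ne_zero_iff,
    Finset.mem_univ, true_implies, Finset.mem_filter, true_and, sub_ne_zero, ne_eq]
  refine forall_congr' fun i => ⟨fun h => ?_, fun h s hs hx => ?_⟩
  · by_contra! hlt
    exact h _ hlt (by simp)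
  · have : x i = e i s := Subtype.ext hx
    rw [this, Equiv.symm_apply_apply] at h
    omega

/-- The witness is `footprintPoly`, compared with the zero word: its monomials divide `X^α` and so
lie in the downset, and it is nonzero exactly where each coordinate avoids the first `α i` elements
of `S i`. -/
theorem minDist_le_prod [DecidableEq F] {D : Finset (Fin m →₀ ℕ)} (hD : IsDownset S D)
    (e : (i : Fin m) → Fin (S i).card ≃ S i) {α : Fin m →₀ ℕ} (hα : α ∈ D) :
    minDist S D ≤ ∏ i, ((S i).card - α i) := by
  have hlt := hD.2 α hα
  have hcard : hammingDist (fun x : Grid S => eval (fun i => (x i : F)) (footprintPoly e α)) 0 =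
      ∏ i, ((S i).card - α i) := by
    have hset : (Finset.univ.filter fun x : Grid S =>
        eval (fun i => (x i : F)) (footprintPoly e α) ≠ 0) =
        Fintype.piFinset fun i =>
          (Finset.univ.filter fun s : Fin (S i).card => ¬ (s : ℕ) < α i).map (e i).toEmbedding := by
      ext x
      rw [Finset.mem_filter, eval_footprintPoly_ne_zero, Fintype.mem_piFinset]
      simp [Finset.mem_map_equiv]
    change (Finset.univ.filter fun x : Grid S =>
        eval (fun i => (x i : F)) (footprintPoly e α) ≠ 0).card = _
    rw [hset, Fintype.card_piFinset]
    refine Finset.prod_congr rfl fun i _ => ?_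
    rw [Finset.card_map]
    have h := Finset.card_filter_add_card_filter_not (s := Finset.univ)
      (fun s : Fin (S i).card => (s : ℕ) < α i)
    rw [card_filter_fin_lt (hlt i).le, Finset.card_univ, Fintype.card_fin] at h
    omega
  rw [← hcard]
  refine Nat.sInf_le ⟨_, ⟨footprintPoly e α, fun β hβ =>
    hD.1 (le_of_mem_support_footprintPoly e hlt hβ) hα, fun _ => rfl⟩, 0,
    ⟨0, by simp, fun x => by simp⟩, ?_, rfl⟩
  rw [← hammingDist_ne_zero, hcard]
  exact (Finset.prod_pos fun i _ => Nat.sub_pos_of_lt (hlt i)).ne'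

end MinDist

/-! ### Correctness of the decoder -/

section Input

variable {F : Type u} [Field F] {m : ℕ} {S : Fin m → Finset F} {D : Finset (Fin m →₀ ℕ)}

/-- The sizes of the sets, as a sequence. -/
def sizeSeq (S : Fin m → Finset F) (i : ℕ) : ℕ := if h : i < m then (S ⟨i, h⟩).card else 0

theorem sizeSeq_fin (S : Fin m → Finset F) (i : Fin m) : sizeSeq S i = (S i).card := by
  simp [sizeSeq]

theorem gridCard_sizeSeq (S : Fin m → Finset F) : gridCard (sizeSeq S) m = ∏ i, (S i).card := by
  rw [gridCard, Finset.prod_range]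
  exact Finset.prod_congr rfl fun i _ => sizeSeq_fin S i

/-- `finPiFinEquiv` is by definition the mixed radix expansion with the first coordinate varying
fastest. -/
theorem digit_sizeSeq (S : Fin m → Finset F) (t : Fin (∏ i, (S i).card)) (i : Fin m) :
    digit (sizeSeq S) i t = finPiFinEquiv.symm t i := by
  have h : gridCard (sizeSeq S) i = ∏ j : Fin i, (S (Fin.castLE i.is_lt.le j)).card := by
    rw [gridCard, Finset.prod_range]
    exact Finset.prod_congr rfl fun j _ => sizeSeq_fin S (Fin.castLE i.is_lt.le j)
  rw [digit, h, sizeSeq_fin]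
  rfl

/-- The index of a monomial of the downset. -/
def monomialIndex (hD : IsDownset S D) (d : Fin D.card ≃ D) (q : ℕ) : ℕ :=
  if hq : q < D.card then finPiFinEquiv (n := fun i => (S i).card)
    fun i => ⟨(d ⟨q, hq⟩ : Fin m →₀ ℕ) i, hD.2 _ (d ⟨q, hq⟩).2 i⟩ else 0

theorem monomialIndex_fin (hD : IsDownset S D) (d : Fin D.card ≃ D) (q : Fin D.card) :
    monomialIndex hD d q = finPiFinEquiv (n := fun i => (S i).card)
      fun i => ⟨(d q : Fin m →₀ ℕ) i, hD.2 _ (d q).2 i⟩ := by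
  simp [monomialIndex]

theorem digit_monomialIndex (hD : IsDownset S D) (d : Fin D.card ≃ D) (q : Fin D.card)
    (i : Fin m) : digit (sizeSeq S) i (monomialIndex hD d q) = (d q : Fin m →₀ ℕ) i := by
  rw [monomialIndex_fin, digit_sizeSeq, Equiv.symm_apply_apply]

theorem monomialIndex_lt (hD : IsDownset S D) (d : Fin D.card ≃ D) (q : Fin D.card) :
    monomialIndex hD d q < gridCard (sizeSeq S) m := by
  rw [monomialIndex_fin, gridCard_sizeSeq]
  exact Fin.is_lt _

theorem monomialIndex_injective (hD : IsDownset S D) (d : Fin D.card ≃ D) {q q' : Fin D.card}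
    (h : monomialIndex hD d q = monomialIndex hD d q') : q = q' := by
  refine d.injective (Subtype.ext (Finsupp.ext fun i => ?_))
  rw [← digit_monomialIndex hD, ← digit_monomialIndex hD, h]

/-- The coefficients of a polynomial, as a function of the indices of the monomials. -/
noncomputable def coeffSeq (hD : IsDownset S D) (d : Fin D.card ≃ D) (P : MvPolynomial (Fin m) F)
    (b : ℕ) : F :=
  ∑ q : Fin D.card, if monomialIndex hD d q = b then P.coeff (d q) else 0

theorem coeffSeq_monomialIndex (hD : IsDownset S D) (d : Fin D.card ≃ D)
    (P : MvPolynomial (Fin m) F) (q : Fin D.card) :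
    coeffSeq hD d P (monomialIndex hD d q) = P.coeff (d q) := by
  rw [coeffSeq, Finset.sum_eq_single q, if_pos rfl]
  · exact fun q' _ h => if_neg fun h' => h (monomialIndex_injective hD d h')
  · simp

/-- Both sides are reduced to a sum over the list of monomials; indices outside the list contribute
zero. -/
theorem eval_eq_gridEval (hD : IsDownset S D) (e : (i : Fin m) → Fin (S i).card ≃ S i)
    (d : Fin D.card ≃ D) {P : MvPolynomial (Fin m) F} (hP : P.support ⊆ D) {x : ℕ → ℕ → F}
    (hx : ∀ i : Fin m, ∀ s : Fin (S i).card, x i s = e i s) (t : Fin (∏ i, (S i).card)) :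
    gridEval (sizeSeq S) x m (coeffSeq hD d P) t =
      MvPolynomial.eval (fun i => (gridPoint e t i : F)) P := by
  have hmon : ∀ q : Fin D.card, gridMonomial (sizeSeq S) x m (monomialIndex hD d q) t =
      ∏ i, (gridPoint e t i : F) ^ (d q : Fin m →₀ ℕ) i := fun q => by
    rw [gridMonomial, Finset.prod_range]
    refine Finset.prod_congr rfl fun i _ => ?_
    rw [digit_monomialIndex, digit_sizeSeq, hx, gridPoint]
  rw [MvPolynomial.eval_eq', Finset.sum_subset hP fun α _ hα => by
    rw [MvPolynomial.notMem_support_iff.1 hα, zero_mul], ← Finset.sum_coe_sort D,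
    ← Equiv.sum_comp d, gridEval]
  simp only [coeffSeq, Finset.sum_mul]
  rw [Finset.sum_comm]
  refine Finset.sum_congr rfl fun q _ => ?_
  rw [Finset.sum_eq_single (monomialIndex hD d q)]
  · rw [if_pos rfl, hmon]
  · intro b _ hb
    rw [if_neg hb.symm, zero_mul]
  · exact fun h => absurd (Finset.mem_range.2 (monomialIndex_lt hD d q)) h

variable (e : (i : Fin m) → Fin (S i).card ≃ S i) (d : Fin D.card ≃ D) (w : WeightedWord S)

theorem gridPoint_bijective : Function.Bijective (gridPoint e) :=
  ((finPiFinEquiv.symm).trans (Equiv.piCongrRight e)).bijective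

theorem weightedDist_eq_wdist [DecidableEq F] {C : Grid S → F} {g : ℕ → F}
    (hg : ∀ t : Fin (∏ i, (S i).card), g t = C (gridPoint e t)) :
    weightedDist w C = wdist (gridCard (sizeSeq S) m) ((inputState S D e d w).fld 1 0)
      ((inputState S D e d w).wgt 0 0) g := by
  classical
  rw [gridCard_sizeSeq, wdist, Finset.sum_range, weightedDist,
    ← (Equiv.ofBijective _ (gridPoint_bijective e)).sum_comp]
  refine Finset.sum_congr rfl fun t _ => ?_
  simp [inputState, hg]

theorem isGrid_inputState (hS : ∀ i, (S i).Nonempty) :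
    IsGrid (sizeSeq S) m ((inputState S D e d w).fld 0) ((inputState S D e d w).wgt 0 0) where
  pos i hi := by
    rw [sizeSeq, dif_pos hi]
    exact (hS _).card_pos
  injOn i hi s hs t ht h := by
    rw [sizeSeq, dif_pos hi, Finset.coe_range, Set.mem_Iio] at hs ht
    simp only [inputState, dif_pos hi, dif_pos hs, dif_pos ht] at h
    simpa using (e ⟨i, hi⟩).injective (Subtype.ext h)
  nonneg t ht := by
    rw [gridCard_sizeSeq] at ht
    simp only [inputState, dif_pos ht, if_true]
    exact (w _).2.2.1
  le_one t ht := by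
    rw [gridCard_sizeSeq] at ht
    simp only [inputState, dif_pos ht, if_true]
    exact (w _).2.2.2

theorem holdsExponents_inputState (hD : IsDownset S D) :
    HoldsExponents (sizeSeq S) m D.card (monomialIndex hD d) (inputState S D e d w) where
  count := by simp [inputState]
  exponent q hq i hi := by
    have h := digit_monomialIndex hD d ⟨q, hq⟩ ⟨i, hi⟩
    simp only at h
    rw [h]
    simp [inputState, hq, hi]

/-- The radius `δ` is half the minimum distance, and `minDist_le_prod` makes it admissible for every
monomial of the downset. -/
theorem isMonomialList_monomialIndex [DecidableEq F] (e : (i : Fin m) → Fin (S i).card ≃ S i)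
    (hD : IsDownset S D) (P : MvPolynomial (Fin m) F) :
    IsMonomialList (sizeSeq S) m D.card (monomialIndex hD d) (coeffSeq hD d P)
      ((minDist S D : ℝ) / 2) where
  lt q hq := monomialIndex_lt hD d ⟨q, hq⟩
  inj q hq q' hq' h := by
    simpa using monomialIndex_injective hD d (q := ⟨q, hq⟩) (q' := ⟨q', hq'⟩) h
  zero b hb := Finset.sum_eq_zero fun q _ => if_neg (hb q q.2)
  le q hq := by
    have h := minDist_le_prod hD e (d ⟨q, hq⟩).2
    have hcast : ((∏ i, ((S i).card - (d ⟨q, hq⟩ : Fin m →₀ ℕ) i) : ℕ) : ℝ) =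
        ∏ i ∈ Finset.range m, ((sizeSeq S i : ℝ) - digit (sizeSeq S) i (monomialIndex hD d q)) := by
      rw [Finset.prod_range, Nat.cast_prod]
      refine Finset.prod_congr rfl fun i _ => ?_
      rw [sizeSeq_fin, digit_monomialIndex hD d ⟨q, hq⟩ i,
        Nat.cast_sub (hD.2 _ (d ⟨q, hq⟩).2 i).le]
    rw [← hcast]
    gcongr

theorem card_le_inputSize (hD : IsDownset S D) : D.card ≤ inputSize S D := by
  -- Without variables the exponent vectors occupy no cells, but then there is at most one of them.
  rcases Nat.eq_zero_or_pos m with rfl | hm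
  · have : D.card ≤ 1 := Finset.card_le_one.2 fun a _ b _ => Subsingleton.elim a b
    unfold inputSize
    omega
  · have : D.card ≤ m * D.card := Nat.le_mul_of_pos_left _ hm
    unfold inputSize
    omega

theorem card_fin_le_inputSize (D : Finset (Fin m →₀ ℕ)) (i : Fin m) :
    (S i).card ≤ inputSize S D := by
  have : (S i).card ≤ ∑ j, (S j).card :=
    Finset.single_le_sum (f := fun j => (S j).card) (fun _ _ => Nat.zero_le _) (Finset.mem_univ i)
  unfold inputSize
  omega

theorem bounded_decoder_inputState (hS : ∀ i, (S i).Nonempty) (hD : IsDownset S D) :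
    decoder.Bounded (inputSize S D) (inputState S D e d w) := by
  refine bounded_decoder (n := sizeSeq S) (m := m) _ (fun i hi => ?_) ?_ ?_ ?_ ?_ ?_ ?_ ?_ ?_
  · rw [sizeSeq, dif_pos hi]
    exact (hS _).card_pos
  · simp [inputState]
  · funext j
    simp [inputState, sizeSeq]
  · intro i j
    simp [inputState]
  · intro i j
    simp [inputState]
  · rw [gridCard_sizeSeq]
    unfold inputSize
    omega
  · intro i j
    have hm : m ≤ inputSize S D := by
      unfold inputSize
      omega
    simp only [inputState]
    split_ifs
    exacts [hm, card_le_inputSize hD, Nat.zero_le _]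
  · intro i j
    simp only [inputState]
    split_ifs
    exacts [card_fin_le_inputSize D _, Nat.zero_le _, Nat.zero_le _]
  · intro i j
    simp only [inputState]
    split_ifs with hi hj
    · exact (hD.2 _ (d ⟨i, hi⟩).2 ⟨j, hj⟩).le.trans (card_fin_le_inputSize D _)
    · exact Nat.zero_le _
    · exact Nat.zero_le _

theorem run_decoder_inputState [DecidableEq F] (hS : ∀ i, (S i).Nonempty) (hD : IsDownset S D)
    {P : MvPolynomial (Fin m) F} (hP : P.support ⊆ D) {C : Grid S → F}
    (hC : ∀ x, C x = MvPolynomial.eval (fun i => (x i : F)) P)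
    (hd : weightedDist w C < (minDist S D : ℝ) / 2) (q : Fin D.card) :
    (decoder.run (inputState S D e d w)).fld 2 0 q = P.coeff (d q) := by
  rw [← coeffSeq_monomialIndex hD d P q]
  refine run_decoder (isGrid_inputState e d w hS) _ (isMonomialList_monomialIndex d e hD P)
    (holdsExponents_inputState e d w hD) ?_ ?_ rfl rfl ?_ ?_ ?_ q q.2
  · simp [inputState]
  · funext j
    simp [inputState, sizeSeq]
  · intro i j
    simp [inputState]
  · intro i j
    simp [inputState]
  · refine lt_of_eq_of_lt (weightedDist_eq_wdist e d w fun t => ?_).symm hd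
    rw [eval_eq_gridEval hD e d hP (fun i s => by simp [inputState]) t, hC]

theorem outputPoly_eq {P : MvPolynomial (Fin m) F} (hP : P.support ⊆ D) {σ : State F}
    (hσ : ∀ q : Fin D.card, σ.fld 2 0 q = P.coeff (d q)) : outputPoly d σ = P := by
  simp only [outputPoly, hσ]
  rw [Equiv.sum_comp d fun α : D => MvPolynomial.monomial (α : Fin m →₀ ℕ) (P.coeff α),
    Finset.sum_coe_sort D fun α => MvPolynomial.monomial α (P.coeff α)]
  conv_rhs => rw [← MvPolynomial.support_sum_monomial_coeff P]
  refine (Finset.sum_subset hP fun α _ hα => ?_).symm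
  rw [MvPolynomial.notMem_support_iff.1 hα, MvPolynomial.monomial_zero]

theorem outputWord_decoder [DecidableEq F] (hS : ∀ i, (S i).Nonempty) (hD : IsDownset S D)
    {C : Grid S → F} (hC : C ∈ downsetCode S D)
    (hd : weightedDist w C < (minDist S D : ℝ) / 2) :
    outputWord S d (decoder.run (inputState S D e d w)) = C := by
  obtain ⟨P, hP, hPC⟩ := hC
  funext x
  rw [outputWord, outputPoly_eq d hP (run_decoder_inputState e d w hS hD hP hPC hd), hPC]

end Input

/-- With `u = 0` an agreement costs `0` and a disagreement `1`, so unweighted decoding is a special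
case. -/
theorem weightedDist_zero {F : Type u} [DecidableEq F] {m : ℕ} {S : Fin m → Finset F}
    (f C : Grid S → F) :
    weightedDist (fun x => (f x, (0 : Set.Icc (0 : ℝ) 1))) C = hammingDist f C := by
  rw [weightedDist, hammingDist, Finset.card_filter, Nat.cast_sum]
  refine Finset.sum_congr rfl fun x _ => ?_
  by_cases h : f x = C x <;> simp [h]

end DownsetDecoding

theorem theorem1 :
    ∃ (P : DownsetDecoding.Program) (p : Polynomial ℕ),
      ∀ (F : Type u) [Field F] [DecidableEq F] (m : ℕ) (S : Fin m → Finset F)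
        (D : Finset (Fin m →₀ ℕ)),
        (∀ i, (S i).Nonempty) → DownsetDecoding.IsDownset S D →
      ∀ (e : (i : Fin m) → Fin (S i).card ≃ S i) (d : Fin D.card ≃ D),
        (∀ w : DownsetDecoding.WeightedWord S,
          ∃ (σ : DownsetDecoding.State F) (t : ℕ),
            P.Run (DownsetDecoding.inputState S D e d w) σ t ∧
            t ≤ p.eval (DownsetDecoding.inputSize S D) ∧
            ∀ C ∈ DownsetDecoding.downsetCode S D,
              DownsetDecoding.weightedDist w C < (DownsetDecoding.minDist S D : ℝ) / 2 →
                DownsetDecoding.outputWord S d σ = C) ∧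
        (∀ f : DownsetDecoding.Grid S → F,
          ∃ (σ : DownsetDecoding.State F) (t : ℕ),
            P.Run (DownsetDecoding.inputState S D e d (fun x => (f x, 0))) σ t ∧
            t ≤ p.eval (DownsetDecoding.inputSize S D) ∧
            ∀ C ∈ DownsetDecoding.downsetCode S D,
              (hammingDist f C : ℝ) < (DownsetDecoding.minDist S D : ℝ) / 2 →
                DownsetDecoding.outputWord S d σ = C) := by
  -- The decoder uses only loops, so the list of procedures is empty.
  refine ⟨⟨DownsetDecoding.decoder.toCom, []⟩, DownsetDecoding.decoder.time, ?_⟩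
  intro F _ _ m S D hS hD e d
  have main : ∀ w : DownsetDecoding.WeightedWord S,
      ∃ (σ : DownsetDecoding.State F) (t : ℕ),
        DownsetDecoding.Program.Run ⟨DownsetDecoding.decoder.toCom, []⟩
          (DownsetDecoding.inputState S D e d w) σ t ∧
        t ≤ DownsetDecoding.decoder.time.eval (DownsetDecoding.inputSize S D) ∧
        ∀ C ∈ DownsetDecoding.downsetCode S D,
          DownsetDecoding.weightedDist w C < (DownsetDecoding.minDist S D : ℝ) / 2 →
            DownsetDecoding.outputWord S d σ = C := fun w => by
    obtain ⟨t, ht, hrun⟩ := DownsetDecoding.Block.exec_toCom (procs := [])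
      DownsetDecoding.decoder _ DownsetDecoding.wf_decoder
      (DownsetDecoding.bounded_decoder_inputState e d w hS hD)
    exact ⟨_, t, hrun, ht, fun C hC hd => DownsetDecoding.outputWord_decoder e d w hS hD hC hd⟩
  refine ⟨main, fun f => ?_⟩
  obtain ⟨σ, t, hrun, ht, h⟩ := main fun x => (f x, 0)
  exact ⟨σ, t, hrun, ht, fun C hC hd =>
    h C hC (by rwa [DownsetDecoding.weightedDist_zero])⟩
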